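/- Let $k$ be an algebraically closed field of characteristic $0$ and write $D=\operatorname{Hom}_k(-,k)$. All modules are left modules. A finite-dimensional $k$-algebra $\Lambda$ of global dimension $n$ is called $n$-representation-infinite if for every $l\ge 0$ the complex $\mathbb S_n^{-l}(\Lambda)$, where $\mathbb S_n^{-1}=\mathbf R\operatorname{Hom}_\Lambda(D\Lambda,-)[n]$, is isomorphic in the derived category to a finitely generated $\Lambda$-module placed in degree $0$. For such $\Lambda$, its $(n+1)$-preprojective algebra is the tensor algebra $\Pi(\Lambda)=T_\Lambda\operatorname{Ext}^n_\Lambda(D\Lambda,\Lambda)$ of the $\Lambda$-bimodule $\operatorname{Ext}^n_\Lambda(D\Lambda,\Lambda)$, with its tensor grading, so that $\Pi(\Lambda)_0=\Lambda$. An algebra is connected if it is nonzero and is not a product of two nonzero algebras. Let $n_1,n_2\ge 0$ and let $\Lambda_1,\Lambda_2$ be connected $k$-algebras such that $\Lambda_i$ is $n_i$-representation-infinite, $i=1,2$. Then $\Lambda_1\otimes_k\Lambda_2$ is connected and $(n_1+n_2)$-representation-infinite, and the Segre product $$\Pi(\Lambda_1)*\Pi(\Lambda_2)=\bigoplus_{l\ge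 0}\Pi(\Lambda_1)_l\otimes_k\Pi(\Lambda_2)_l$$ (a subalgebra of $\Pi(\Lambda_1)\otimes_k\Pi(\Lambda_2)$, with the displayed grading) is its $(n_1+n_2+1)$-preprojective algebra: there is an isomorphism of graded $k$-algebras $$\Pi(\Lambda_1)*\Pi(\Lambda_2)\;\cong\;\Pi(\Lambda_1\otimes_k\Lambda_2)$$ which is the identity of $\Lambda_1\otimes_k\Lambda_2$ in degree $0$. -/

import Mathlib

open CategoryTheory
open scoped TensorProduct DirectSum MulOpposite

universe u

/-! ### Connected algebras and global dimension -/

/-- A `k`-algebra is connected if it is nonzero and it is not a product of two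
nonzero `k`-algebras. -/
def IsConnectedAlgebra (k : Type u) [Field k] (Λ : Type u) [Ring Λ] [Algebra k Λ] : Prop :=
  Nontrivial Λ ∧
    ∀ (A B : Type u) [Ring A] [Algebra k A] [Ring B] [Algebra k B],
      Nonempty (Λ ≃ₐ[k] A × B) → Subsingleton A ∨ Subsingleton B

/-- The (left) global dimension of a ring: the supremum of the projective dimensions of its
left modules. -/
noncomputable def globalDim (Λ : Type u) [Ring Λ] : WithBot ℕ∞ :=
  ⨆ M : ModuleCat.{u} Λ, projectiveDimension M

/-! ### The dual bimodule `DΛ = Hom_k(Λ, k)` -/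

section Dual

variable (k : Type u) [Field k] (Λ : Type u) [Ring Λ] [Algebra k Λ]

/-- The `k`-dual `DΛ` of a `k`-algebra `Λ`, with its `Λ`-bimodule structure
`(a • f • b) x = f (b * x * a)`. -/
def DualBimodule : Type u := Module.Dual k Λ

namespace DualBimodule

noncomputable instance : AddCommGroup (DualBimodule k Λ) :=
  inferInstanceAs (AddCommGroup (Module.Dual k Λ))

instance : FunLike (DualBimodule k Λ) Λ k :=
  inferInstanceAs (FunLike (Λ →ₗ[k] k) Λ k)

variable {k Λ}

@[ext]
theorem ext {f g : DualBimodule k Λ} (h : ∀ x, f x = g x) : f = g := DFunLike.ext f g h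

@[simp]
theorem add_apply (f g : DualBimodule k Λ) (x : Λ) : (f + g) x = f x + g x := rfl

@[simp]
theorem zero_apply (x : Λ) : (0 : DualBimodule k Λ) x = 0 := rfl

theorem map_add' (f : DualBimodule k Λ) (x y : Λ) : f (x + y) = f x + f y :=
  LinearMap.map_add (show Λ →ₗ[k] k from f) x y

theorem map_zero' (f : DualBimodule k Λ) : f 0 = 0 :=
  LinearMap.map_zero (show Λ →ₗ[k] k from f)

/-- The left action `(a • f) x = f (x * a)`. -/
noncomputable instance : Module Λ (DualBimodule k Λ) where
  smul a f := (show Λ →ₗ[k] k from f) ∘ₗ LinearMap.mulRight k a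
  one_smul f := ext fun x => congrArg f (mul_one x)
  mul_smul a b f := ext fun x => congrArg f (mul_assoc x a b).symm
  smul_zero _ := rfl
  smul_add _ _ _ := rfl
  add_smul a b f := ext fun x => (congrArg f (mul_add x a b)).trans (map_add' f _ _)
  zero_smul f := ext fun x => (congrArg f (mul_zero x)).trans (map_zero' f)

/-- The right action `(f • b) x = f (b * x)`. -/
noncomputable instance : Module Λᵐᵒᵖ (DualBimodule k Λ) where
  smul b f := (show Λ →ₗ[k] k from f) ∘ₗ LinearMap.mulLeft k b.unop
  one_smul f := ext fun x => congrArg f (one_mul x)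
  mul_smul a b f := ext fun x => congrArg f (mul_assoc b.unop a.unop x)
  smul_zero _ := rfl
  smul_add _ _ _ := rfl
  add_smul a b f := ext fun x => (congrArg f (add_mul a.unop b.unop x)).trans (map_add' f _ _)
  zero_smul f := ext fun x => (congrArg f (zero_mul x)).trans (map_zero' f)

@[simp]
theorem smul_apply (a : Λ) (f : DualBimodule k Λ) (x : Λ) : (a • f) x = f (x * a) := rfl

@[simp]
theorem op_smul_apply (b : Λᵐᵒᵖ) (f : DualBimodule k Λ) (x : Λ) :
    (b • f) x = f (b.unop * x) := rfl

instance : SMulCommClass Λ Λᵐᵒᵖ (DualBimodule k Λ) where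
  smul_comm a b f := ext fun x => by simp [mul_assoc]

variable (k Λ)

/-- Right multiplication by `a` on `DΛ`, a morphism of left `Λ`-modules. -/
noncomputable def rightMul (a : Λ) : DualBimodule k Λ →ₗ[Λ] DualBimodule k Λ where
  toFun f := MulOpposite.op a • f
  map_add' f g := smul_add _ f g
  map_smul' b f := (smul_comm b (MulOpposite.op a) f).symm

@[simp]
theorem rightMul_apply (a : Λ) (f : DualBimodule k Λ) (x : Λ) :
    rightMul k Λ a f x = f (a * x) := rfl

end DualBimodule

/-! ### The inverse Serre functor `RHom_Λ(DΛ, -)` -/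

/-- `Hom_Λ(DΛ, X)` for a left `Λ`-module `X`, a left `Λ`-module through the right action
of `Λ` on `DΛ`, i.e. `(a • φ) f = φ (f • a)`. -/
def DualHom (X : Type u) [AddCommGroup X] [Module Λ X] : Type u := DualBimodule k Λ →ₗ[Λ] X

namespace DualHom

variable (X : Type u) [AddCommGroup X] [Module Λ X]

noncomputable instance : AddCommGroup (DualHom k Λ X) :=
  inferInstanceAs (AddCommGroup (DualBimodule k Λ →ₗ[Λ] X))

instance : FunLike (DualHom k Λ X) (DualBimodule k Λ) X :=
  inferInstanceAs (FunLike (DualBimodule k Λ →ₗ[Λ] X) (DualBimodule k Λ) X)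

variable {k Λ X}

@[ext]
theorem ext {f g : DualHom k Λ X} (h : ∀ x, f x = g x) : f = g := DFunLike.ext f g h

theorem map_add' (f : DualHom k Λ X) (x y : DualBimodule k Λ) : f (x + y) = f x + f y :=
  LinearMap.map_add (show DualBimodule k Λ →ₗ[Λ] X from f) x y

theorem map_zero' (f : DualHom k Λ X) : f 0 = 0 :=
  LinearMap.map_zero (show DualBimodule k Λ →ₗ[Λ] X from f)

noncomputable instance : Module Λ (DualHom k Λ X) where
  smul a φ := (show DualBimodule k Λ →ₗ[Λ] X from φ) ∘ₗ DualBimodule.rightMul k Λ a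
  one_smul φ := ext fun f => congrArg φ (one_smul Λᵐᵒᵖ f)
  mul_smul a b φ := ext fun f => congrArg φ (mul_smul (MulOpposite.op b) (MulOpposite.op a) f)
  smul_zero _ := rfl
  smul_add _ _ _ := rfl
  add_smul a b φ := ext fun f =>
    (congrArg φ (add_smul (MulOpposite.op a) (MulOpposite.op b) f)).trans (map_add' φ _ _)
  zero_smul φ := ext fun f => (congrArg φ (zero_smul Λᵐᵒᵖ f)).trans (map_zero' φ)

@[simp]
theorem smul_apply (a : Λ) (φ : DualHom k Λ X) (f : DualBimodule k Λ) :
    (a • φ) f = φ (MulOpposite.op a • f) := rfl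

end DualHom

/-- The functor `Hom_Λ(DΛ, -)` from left `Λ`-modules to left `Λ`-modules. -/
noncomputable def dualHomFunctor : ModuleCat.{u} Λ ⥤ ModuleCat.{u} Λ where
  obj X := ModuleCat.of Λ (DualHom k Λ X)
  map {X _} g := ModuleCat.ofHom
    { toFun := fun φ => g.hom ∘ₗ (show DualBimodule k Λ →ₗ[Λ] X from φ)
      map_add' := fun φ ψ => DualHom.ext fun f => g.hom.map_add (φ f) (ψ f)
      map_smul' := fun _ _ => rfl }
  map_id _ := rfl
  map_comp _ _ := rfl

instance : (dualHomFunctor k Λ).Additive where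
  map_add := rfl

attribute [local instance] HasDerivedCategory.standard

/-- The functor `𝕊ₙ⁻¹ = RHom_Λ(DΛ, -)[n]` on the bounded below derived category of left
`Λ`-modules, which contains the bounded derived category of finitely generated modules as a
full subcategory. -/
noncomputable def inverseSerre (n : ℕ) :
    DerivedCategory.Plus (ModuleCat.{u} Λ) ⥤ DerivedCategory.Plus (ModuleCat.{u} Λ) :=
  (dualHomFunctor k Λ).rightDerivedFunctorPlus ⋙ shiftFunctor _ (n : ℤ)

/-- The complex `𝕊ₙ⁻ˡ(Λ)`. -/
noncomputable def inverseSerrePow (n l : ℕ) : DerivedCategory.Plus (ModuleCat.{u} Λ) :=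
  (inverseSerre k Λ n).obj^[l]
    ((DerivedCategory.Plus.singleFunctor (ModuleCat.{u} Λ) 0).obj (ModuleCat.of Λ Λ))

/-- `Λ` is `n`-representation-infinite: it is a finite-dimensional algebra of global dimension
`n`, and every `𝕊ₙ⁻ˡ(Λ)`, `l ≥ 0`, is isomorphic in the derived category to a finitely
generated module, placed in degree `0`. -/
def IsRepresentationInfinite (n : ℕ) : Prop :=
  Module.Finite k Λ ∧ globalDim Λ = n ∧
    ∀ l : ℕ, ∃ M : ModuleCat.{u} Λ, Module.Finite Λ M ∧
      Nonempty (inverseSerrePow k Λ n l ≅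
        (DerivedCategory.Plus.singleFunctor (ModuleCat.{u} Λ) 0).obj M)

/-! ### The bimodule `Extⁿ_Λ(DΛ, Λ)` -/

/-- `Extⁿ_Λ(DΛ, Λ)`, the extension group of left `Λ`-modules. -/
def ExtDual (n : ℕ) : Type u :=
  Abelian.Ext.{u} (ModuleCat.of Λ (DualBimodule k Λ)) (ModuleCat.of Λ Λ) n

namespace ExtDual

variable {k Λ} {n : ℕ}

noncomputable instance : AddCommGroup (ExtDual k Λ n) :=
  inferInstanceAs (AddCommGroup (Abelian.Ext.{u} _ _ n))

noncomputable instance : Module k (ExtDual k Λ n) :=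
  inferInstanceAs (Module k
    (Abelian.Ext.{u} (ModuleCat.of Λ (DualBimodule k Λ)) (ModuleCat.of Λ Λ) n))

variable (k Λ) in
/-- Right multiplication by `a` on `DΛ`, in the category of left `Λ`-modules. -/
noncomputable def dualMul (a : Λ) :
    ModuleCat.of Λ (DualBimodule k Λ) ⟶ ModuleCat.of Λ (DualBimodule k Λ) :=
  ModuleCat.ofHom (DualBimodule.rightMul k Λ a)

variable (Λ) in
/-- Right multiplication by `a` on `Λ`, in the category of left `Λ`-modules. -/
noncomputable def regMul (a : Λ) : ModuleCat.of Λ Λ ⟶ ModuleCat.of Λ Λ :=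
  ModuleCat.ofHom (LinearMap.toSpanSingleton Λ Λ a)

theorem dualMul_one : dualMul k Λ 1 = 𝟙 _ :=
  ModuleCat.hom_ext (LinearMap.ext fun f => one_smul Λᵐᵒᵖ f)

theorem dualMul_mul (a b : Λ) : dualMul k Λ (a * b) = dualMul k Λ a ≫ dualMul k Λ b :=
  ModuleCat.hom_ext (LinearMap.ext fun f => mul_smul (MulOpposite.op b) (MulOpposite.op a) f)

theorem dualMul_add (a b : Λ) : dualMul k Λ (a + b) = dualMul k Λ a + dualMul k Λ b :=
  ModuleCat.hom_ext (LinearMap.ext fun f => add_smul (MulOpposite.op a) (MulOpposite.op b) f)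

theorem dualMul_zero : dualMul k Λ 0 = 0 :=
  ModuleCat.hom_ext (LinearMap.ext fun f => zero_smul Λᵐᵒᵖ f)

theorem dualMul_smul (c : k) (a : Λ) : dualMul k Λ (c • a) = c • dualMul k Λ a :=
  ModuleCat.hom_ext (LinearMap.ext fun f => DualBimodule.ext fun x => by
    change (show DualBimodule k Λ from f) ((c • a) * x) =
      (show DualBimodule k Λ from f) (a * (x * algebraMap k Λ c))
    rw [← Algebra.commutes, ← Algebra.smul_def, Algebra.mul_smul_comm, Algebra.smul_mul_assoc])

theorem regMul_one : regMul Λ 1 = 𝟙 _ :=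
  ModuleCat.hom_ext (LinearMap.ext fun x => mul_one x)

theorem regMul_mul (a b : Λ) : regMul Λ (a * b) = regMul Λ a ≫ regMul Λ b :=
  ModuleCat.hom_ext (LinearMap.ext fun x => (mul_assoc x a b).symm)

theorem regMul_add (a b : Λ) : regMul Λ (a + b) = regMul Λ a + regMul Λ b :=
  ModuleCat.hom_ext (LinearMap.ext fun x => mul_add x a b)

theorem regMul_zero : regMul Λ 0 = 0 :=
  ModuleCat.hom_ext (LinearMap.ext fun x => mul_zero x)

theorem eq_smul_of_apply {M N : ModuleCat.{u} Λ} (c : k) {f g : M ⟶ N}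
    (h : ∀ x, f.hom x = algebraMap k Λ c • g.hom x) : f = c • g :=
  ModuleCat.hom_ext (LinearMap.ext h)

/-- The operation `a • e`: the right multiplication `DΛ → DΛ` by `a`, followed by `e`. -/
noncomputable def leftAct (a : Λ)
    (e : Abelian.Ext.{u} (ModuleCat.of Λ (DualBimodule k Λ)) (ModuleCat.of Λ Λ) n) :
    Abelian.Ext.{u} (ModuleCat.of Λ (DualBimodule k Λ)) (ModuleCat.of Λ Λ) n :=
  (Abelian.Ext.mk₀ (dualMul k Λ a)).comp e (zero_add n)

/-- The operation `e • a`: `e` followed by the right multiplication `Λ → Λ` by `a`. -/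
noncomputable def rightAct (a : Λ)
    (e : Abelian.Ext.{u} (ModuleCat.of Λ (DualBimodule k Λ)) (ModuleCat.of Λ Λ) n) :
    Abelian.Ext.{u} (ModuleCat.of Λ (DualBimodule k Λ)) (ModuleCat.of Λ Λ) n :=
  e.comp (Abelian.Ext.mk₀ (regMul Λ a)) (add_zero n)

section

variable (c : k) (a b : Λ)
  (e e' : Abelian.Ext.{u} (ModuleCat.of Λ (DualBimodule k Λ)) (ModuleCat.of Λ Λ) n)

theorem one_leftAct : leftAct 1 e = e := by
  rw [leftAct, dualMul_one, Abelian.Ext.mk₀_id_comp]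

theorem mul_leftAct : leftAct (a * b) e = leftAct a (leftAct b e) := by
  rw [leftAct, leftAct, leftAct, dualMul_mul, Abelian.Ext.mk₀_comp_mk₀_assoc]

theorem leftAct_zero : leftAct a (0 : Abelian.Ext.{u}
    (ModuleCat.of Λ (DualBimodule k Λ)) (ModuleCat.of Λ Λ) n) = 0 := by
  rw [leftAct, Abelian.Ext.comp_zero]

theorem leftAct_add : leftAct a (e + e') = leftAct a e + leftAct a e' := by
  rw [leftAct, Abelian.Ext.comp_add]; rfl

theorem add_leftAct : leftAct (a + b) e = leftAct a e + leftAct b e := by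
  rw [leftAct, dualMul_add, Abelian.Ext.mk₀_add, Abelian.Ext.add_comp]; rfl

theorem zero_leftAct : leftAct 0 e = 0 := by
  rw [leftAct, dualMul_zero, Abelian.Ext.mk₀_zero, Abelian.Ext.zero_comp]

theorem smul_leftAct : leftAct (c • a) e = c • leftAct a e := by
  rw [leftAct, dualMul_smul, Abelian.Ext.mk₀_smul, Abelian.Ext.smul_comp]; rfl

theorem one_rightAct : rightAct 1 e = e := by
  rw [rightAct, regMul_one, Abelian.Ext.comp_mk₀_id]

theorem mul_rightAct : rightAct (a * b) e = rightAct b (rightAct a e) := by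
  rw [rightAct, rightAct, rightAct, regMul_mul, Abelian.Ext.comp_assoc_of_third_deg_zero,
    Abelian.Ext.mk₀_comp_mk₀]

theorem rightAct_zero : rightAct a (0 : Abelian.Ext.{u}
    (ModuleCat.of Λ (DualBimodule k Λ)) (ModuleCat.of Λ Λ) n) = 0 := by
  rw [rightAct, Abelian.Ext.zero_comp]

theorem rightAct_add : rightAct a (e + e') = rightAct a e + rightAct a e' := by
  rw [rightAct, Abelian.Ext.add_comp]; rfl

theorem add_rightAct : rightAct (a + b) e = rightAct a e + rightAct b e := by
  rw [rightAct, regMul_add, Abelian.Ext.mk₀_add, Abelian.Ext.comp_add]; rfl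

theorem zero_rightAct : rightAct 0 e = 0 := by
  rw [rightAct, regMul_zero, Abelian.Ext.mk₀_zero, Abelian.Ext.comp_zero]

theorem smul_rightAct : rightAct (c • a) e = c • rightAct a e := by
  rw [rightAct, eq_smul_of_apply (f := regMul Λ (c • a)) (g := regMul Λ a) c,
    Abelian.Ext.mk₀_smul, Abelian.Ext.comp_smul]
  · rfl
  · intro x
    change (x : Λ) * (c • a) = algebraMap k Λ c * ((x : Λ) * a)
    rw [← Algebra.smul_def, Algebra.mul_smul_comm]

theorem leftAct_rightAct : leftAct a (rightAct b e) = rightAct b (leftAct a e) := by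
  rw [leftAct, leftAct, rightAct, rightAct, Abelian.Ext.comp_assoc_of_third_deg_zero]

end

/-- The left action of `Λ` on `Extⁿ_Λ(DΛ, Λ)`, induced by the right action of `Λ` on `DΛ`. -/
noncomputable instance : Module Λ (ExtDual k Λ n) where
  smul := leftAct
  one_smul := one_leftAct
  mul_smul := mul_leftAct
  smul_zero := leftAct_zero
  smul_add := leftAct_add
  add_smul := add_leftAct
  zero_smul := zero_leftAct

/-- The right action of `Λ` on `Extⁿ_Λ(DΛ, Λ)`, induced by the right action of `Λ` on `Λ`. -/
noncomputable instance : Module Λᵐᵒᵖ (ExtDual k Λ n) where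
  smul a := rightAct a.unop
  one_smul := one_rightAct
  mul_smul a b := mul_rightAct b.unop a.unop
  smul_zero a := rightAct_zero a.unop
  smul_add a := rightAct_add a.unop
  add_smul a b := add_rightAct a.unop b.unop
  zero_smul := zero_rightAct

instance : SMulCommClass Λ Λᵐᵒᵖ (ExtDual k Λ n) where
  smul_comm a b := leftAct_rightAct a b.unop

instance : IsScalarTower k Λ (ExtDual k Λ n) where
  smul_assoc := smul_leftAct

instance : IsScalarTower k Λᵐᵒᵖ (ExtDual k Λ n) where
  smul_assoc c a := smul_rightAct c a.unop

end ExtDual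

end Dual

/-! ### The tensor algebra of a bimodule -/

section TensorAlgebra

variable (k : Type u) [Field k] (Λ : Type u) [Ring Λ] [Algebra k Λ]
  (E : Type u) [AddCommGroup E] [Module k E] [Module Λ E] [Module Λᵐᵒᵖ E]

/-- The relations that define the tensor algebra `T_Λ(E)` as a quotient of the free `k`-algebra
on the set `Λ ⊔ E`: the map from `Λ` is a homomorphism of `k`-algebras and the map from `E` is
`k`-linear and `Λ`-bilinear. -/
inductive BimoduleTensorAlgebra.Rel :
    FreeAlgebra k (Λ ⊕ E) → FreeAlgebra k (Λ ⊕ E) → Prop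
  | add_left (a b : Λ) : Rel (FreeAlgebra.ι k (Sum.inl (a + b)))
      (FreeAlgebra.ι k (Sum.inl a) + FreeAlgebra.ι k (Sum.inl b))
  | mul_left (a b : Λ) : Rel (FreeAlgebra.ι k (Sum.inl (a * b)))
      (FreeAlgebra.ι k (Sum.inl a) * FreeAlgebra.ι k (Sum.inl b))
  | scalar (c : k) : Rel (FreeAlgebra.ι k (Sum.inl (algebraMap k Λ c)))
      (algebraMap k (FreeAlgebra k (Λ ⊕ E)) c)
  | add_right (x y : E) : Rel (FreeAlgebra.ι k (Sum.inr (x + y)))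
      (FreeAlgebra.ι k (Sum.inr x) + FreeAlgebra.ι k (Sum.inr y))
  | smul_right (c : k) (x : E) : Rel (FreeAlgebra.ι k (Sum.inr (c • x)))
      (algebraMap k (FreeAlgebra k (Λ ⊕ E)) c * FreeAlgebra.ι k (Sum.inr x))
  | left_act (a : Λ) (x : E) : Rel (FreeAlgebra.ι k (Sum.inr (a • x)))
      (FreeAlgebra.ι k (Sum.inl a) * FreeAlgebra.ι k (Sum.inr x))
  | right_act (a : Λ) (x : E) : Rel (FreeAlgebra.ι k (Sum.inr (MulOpposite.op a • x)))
      (FreeAlgebra.ι k (Sum.inr x) * FreeAlgebra.ι k (Sum.inl a))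

/-- The tensor algebra `T_Λ(E) = ⨁ E ⊗_Λ ⋯ ⊗_Λ E` of a `Λ`-bimodule `E` (with `k` acting
centrally): the universal `k`-algebra with a `k`-algebra map from `Λ` and a map of
`Λ`-bimodules from `E`. -/
def BimoduleTensorAlgebra : Type u := RingQuot (BimoduleTensorAlgebra.Rel k Λ E)

namespace BimoduleTensorAlgebra

noncomputable instance : Ring (BimoduleTensorAlgebra k Λ E) :=
  inferInstanceAs (Ring (RingQuot (Rel k Λ E)))

noncomputable instance : Algebra k (BimoduleTensorAlgebra k Λ E) :=
  inferInstanceAs (Algebra k (RingQuot (Rel k Λ E)))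

/-- The quotient map from the free algebra. -/
noncomputable def mk : FreeAlgebra k (Λ ⊕ E) →ₐ[k] BimoduleTensorAlgebra k Λ E :=
  RingQuot.mkAlgHom k (Rel k Λ E)

variable {k Λ E} in
theorem mk_rel {x y : FreeAlgebra k (Λ ⊕ E)} (h : Rel k Λ E x y) :
    mk k Λ E x = mk k Λ E y :=
  RingQuot.mkAlgHom_rel k h

/-- The structure map `Λ → T_Λ(E)`. -/
noncomputable def incl : Λ →ₐ[k] BimoduleTensorAlgebra k Λ E :=
  AlgHom.ofLinearMap
    { toFun := fun a => mk k Λ E (FreeAlgebra.ι k (Sum.inl a))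
      map_add' := fun a b => (mk_rel (Rel.add_left a b)).trans (map_add _ _ _)
      map_smul' := fun c a => by
        rw [Algebra.smul_def, mk_rel (Rel.mul_left _ _), map_mul, mk_rel (Rel.scalar _),
          AlgHom.commutes, RingHom.id_apply, Algebra.smul_def] }
    (by
      change mk k Λ E (FreeAlgebra.ι k (Sum.inl 1)) = 1
      rw [← map_one (algebraMap k Λ), mk_rel (Rel.scalar _), AlgHom.commutes, map_one])
    (fun a b => (mk_rel (Rel.mul_left a b)).trans (map_mul _ _ _))

/-- The structure map `E → T_Λ(E)`. -/
noncomputable def ι : E →ₗ[k] BimoduleTensorAlgebra k Λ E where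
  toFun x := mk k Λ E (FreeAlgebra.ι k (Sum.inr x))
  map_add' x y := (mk_rel (Rel.add_right x y)).trans (map_add _ _ _)
  map_smul' c x := by
    rw [mk_rel (Rel.smul_right c x), map_mul, AlgHom.commutes, RingHom.id_apply,
      Algebra.smul_def]

/-- The degree `l` part of `T_Λ(E)`: the span of the products `a x₁ ⋯ x_l`, with `a` in `Λ`
and `x₁, …, x_l` in `E`. -/
noncomputable def grading (l : ℕ) : Submodule k (BimoduleTensorAlgebra k Λ E) :=
  LinearMap.range (incl k Λ E).toLinearMap * LinearMap.range (ι k Λ E) ^ l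

variable {k Λ E}

theorem ι_smul (a : Λ) (x : E) : ι k Λ E (a • x) = incl k Λ E a * ι k Λ E x :=
  (mk_rel (Rel.left_act a x)).trans (map_mul _ _ _)

theorem ι_op_smul (a : Λ) (x : E) :
    ι k Λ E (MulOpposite.op a • x) = ι k Λ E x * incl k Λ E a :=
  (mk_rel (Rel.right_act a x)).trans (map_mul _ _ _)

/-- The universal property of the tensor algebra: existence. -/
noncomputable def lift {A : Type*} [Semiring A] [Algebra k A] (f : Λ →ₐ[k] A) (g : E →ₗ[k] A)
    (hl : ∀ a x, g (a • x) = f a * g x) (hr : ∀ a x, g (MulOpposite.op a • x) = g x * f a) :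
    BimoduleTensorAlgebra k Λ E →ₐ[k] A :=
  RingQuot.liftAlgHom k ⟨FreeAlgebra.lift k (Sum.elim f g), by
    intro x y h
    induction h <;> simp [hl, hr, Algebra.smul_def]⟩

section

variable {A : Type*} [Semiring A] [Algebra k A] (f : Λ →ₐ[k] A) (g : E →ₗ[k] A)
  (hl : ∀ a x, g (a • x) = f a * g x) (hr : ∀ a x, g (MulOpposite.op a • x) = g x * f a)

theorem lift_mk (x : FreeAlgebra k (Λ ⊕ E)) :
    lift f g hl hr (mk k Λ E x) = FreeAlgebra.lift k (Sum.elim f g) x :=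
  RingQuot.liftAlgHom_mkAlgHom_apply _ _ _ _

@[simp]
theorem lift_incl (a : Λ) : lift f g hl hr (incl k Λ E a) = f a :=
  (lift_mk f g hl hr _).trans (by simp)

@[simp]
theorem lift_ι (x : E) : lift f g hl hr (ι k Λ E x) = g x :=
  (lift_mk f g hl hr _).trans (by simp)

end

/-- The universal property of the tensor algebra: uniqueness. -/
theorem hom_ext {A : Type*} [Semiring A] [Algebra k A] {f g : BimoduleTensorAlgebra k Λ E →ₐ[k] A}
    (h₀ : ∀ a, f (incl k Λ E a) = g (incl k Λ E a))
    (h₁ : ∀ x, f (ι k Λ E x) = g (ι k Λ E x)) : f = g := by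
  refine RingQuot.ringQuot_ext' k f g (FreeAlgebra.hom_ext (funext fun z => ?_))
  rcases z with a | x
  · exact h₀ a
  · exact h₁ x

theorem incl_mem_grading (a : Λ) : incl k Λ E a ∈ grading k Λ E 0 := by
  simp [grading]

theorem ι_mem_grading (x : E) : ι k Λ E x ∈ grading k Λ E 1 := by
  rw [grading, pow_one]
  simpa using Submodule.mul_mem_mul
    (LinearMap.mem_range_self (incl k Λ E).toLinearMap 1) (LinearMap.mem_range_self (ι k Λ E) x)

section Graded

variable (k Λ E)

theorem range_incl_mul_self :
    LinearMap.range (incl k Λ E).toLinearMap * LinearMap.range (incl k Λ E).toLinearMap ≤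
      LinearMap.range (incl k Λ E).toLinearMap := by
  rw [Submodule.mul_le]
  rintro _ ⟨a, rfl⟩ _ ⟨b, rfl⟩
  exact ⟨a * b, map_mul (incl k Λ E) a b⟩

theorem range_ι_mul_range_incl :
    LinearMap.range (ι k Λ E) * LinearMap.range (incl k Λ E).toLinearMap ≤
      LinearMap.range (ι k Λ E) := by
  rw [Submodule.mul_le]
  rintro _ ⟨x, rfl⟩ _ ⟨a, rfl⟩
  exact ⟨MulOpposite.op a • x, ι_op_smul a x⟩

theorem one_le_range_incl : 1 ≤ LinearMap.range (incl k Λ E).toLinearMap := by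
  rw [Submodule.one_le]
  exact ⟨1, map_one (incl k Λ E)⟩

theorem range_ι_pow_mul_range_incl (l : ℕ) :
    LinearMap.range (ι k Λ E) ^ l * LinearMap.range (incl k Λ E).toLinearMap ≤
      LinearMap.range (incl k Λ E).toLinearMap * LinearMap.range (ι k Λ E) ^ l := by
  cases l with
  | zero => simp
  | succ l =>
    rw [pow_succ, mul_assoc]
    refine (mul_le_mul' le_rfl (range_ι_mul_range_incl k Λ E)).trans ?_
    exact (one_mul _).symm.le.trans (mul_le_mul' (one_le_range_incl k Λ E) le_rfl)

instance : SetLike.GradedMonoid (grading k Λ E) where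
  one_mem := by simpa using incl_mem_grading (k := k) (E := E) (1 : Λ)
  mul_mem i j x y hx hy := by
    have h : grading k Λ E i * grading k Λ E j ≤ grading k Λ E (i + j) := by
      rw [grading, grading, grading, mul_assoc, ← mul_assoc (_ ^ i), pow_add]
      refine (mul_le_mul' le_rfl
        (mul_le_mul' (range_ι_pow_mul_range_incl k Λ E i) le_rfl)).trans ?_
      rw [mul_assoc, ← mul_assoc]
      exact mul_le_mul' (range_incl_mul_self k Λ E) le_rfl
    exact h (Submodule.mul_mem_mul hx hy)

/-- The structure map from `Λ` to the direct sum of the graded pieces. -/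
noncomputable def gradedIncl : Λ →ₐ[k] ⨁ l, grading k Λ E l :=
  AlgHom.ofLinearMap
    (DirectSum.lof k ℕ (fun l => grading k Λ E l) 0 ∘ₗ
      (incl k Λ E).toLinearMap.codRestrict _ incl_mem_grading)
    (DirectSum.of_eq_of_gradedMonoid_eq (Sigma.subtype_ext rfl (map_one (incl k Λ E))))
    (fun a b => by
      simp only [LinearMap.comp_apply, DirectSum.lof_eq_of, DirectSum.of_mul_of]
      exact DirectSum.of_eq_of_gradedMonoid_eq
        (Sigma.subtype_ext (add_zero 0).symm (map_mul (incl k Λ E) a b)))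

/-- The structure map from `E` to the direct sum of the graded pieces. -/
noncomputable def gradedι : E →ₗ[k] ⨁ l, grading k Λ E l :=
  DirectSum.lof k ℕ (fun l => grading k Λ E l) 1 ∘ₗ
    (ι k Λ E).codRestrict _ ι_mem_grading

/-- The map that splits an element of the tensor algebra into its homogeneous components. -/
noncomputable def decomposeHom : BimoduleTensorAlgebra k Λ E →ₐ[k] ⨁ l, grading k Λ E l :=
  lift (gradedIncl k Λ E) (gradedι k Λ E)
    (fun a x => by
      change DirectSum.of (fun l => grading k Λ E l) 1 _ =
        DirectSum.of (fun l => grading k Λ E l) 0 _ * DirectSum.of (fun l => grading k Λ E l) 1 _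
      rw [DirectSum.of_mul_of]
      exact DirectSum.of_eq_of_gradedMonoid_eq
        (Sigma.subtype_ext (zero_add 1).symm (ι_smul a x)))
    (fun a x => by
      change DirectSum.of (fun l => grading k Λ E l) 1 _ =
        DirectSum.of (fun l => grading k Λ E l) 1 _ * DirectSum.of (fun l => grading k Λ E l) 0 _
      rw [DirectSum.of_mul_of]
      exact DirectSum.of_eq_of_gradedMonoid_eq
        (Sigma.subtype_ext (add_zero 1).symm (ι_op_smul a x)))

theorem decomposeHom_incl (a : Λ) : decomposeHom k Λ E (incl k Λ E a) =
    DirectSum.of (fun l => grading k Λ E l) 0 ⟨incl k Λ E a, incl_mem_grading a⟩ :=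
  lift_incl _ _ _ _ a

theorem decomposeHom_ι (x : E) : decomposeHom k Λ E (ι k Λ E x) =
    DirectSum.of (fun l => grading k Λ E l) 1 ⟨ι k Λ E x, ι_mem_grading x⟩ :=
  lift_ι _ _ _ _ x

theorem coe_decomposeHom :
    (DirectSum.coeAlgHom (grading k Λ E)).comp (decomposeHom k Λ E) = AlgHom.id k _ := by
  refine hom_ext (fun a => ?_) (fun x => ?_)
  · rw [AlgHom.comp_apply, decomposeHom_incl]
    exact DirectSum.coeAlgHom_of _ _ _
  · rw [AlgHom.comp_apply, decomposeHom_ι]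
    exact DirectSum.coeAlgHom_of _ _ _

theorem lof_mul_lof_le (i j : ℕ) :
    LinearMap.range (DirectSum.lof k ℕ (fun l => grading k Λ E l) i) *
        LinearMap.range (DirectSum.lof k ℕ (fun l => grading k Λ E l) j) ≤
      LinearMap.range (DirectSum.lof k ℕ (fun l => grading k Λ E l) (i + j)) := by
  rw [Submodule.mul_le]
  rintro _ ⟨a, rfl⟩ _ ⟨b, rfl⟩
  rw [DirectSum.lof_eq_of, DirectSum.lof_eq_of, DirectSum.of_mul_of]
  exact LinearMap.mem_range_self (DirectSum.lof k ℕ (fun l => grading k Λ E l) (i + j)) _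

theorem grading_le_comap (l : ℕ) :
    (grading k Λ E l).map (decomposeHom k Λ E).toLinearMap ≤
      LinearMap.range (DirectSum.lof k ℕ (fun l => grading k Λ E l) l) := by
  have h₀ : (LinearMap.range (incl k Λ E).toLinearMap).map (decomposeHom k Λ E).toLinearMap ≤
      LinearMap.range (DirectSum.lof k ℕ (fun l => grading k Λ E l) 0) := by
    rintro _ ⟨_, ⟨a, rfl⟩, rfl⟩
    exact ⟨⟨incl k Λ E a, incl_mem_grading a⟩, (decomposeHom_incl k Λ E a).symm⟩
  have h₁ : (LinearMap.range (ι k Λ E)).map (decomposeHom k Λ E).toLinearMap ≤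
      LinearMap.range (DirectSum.lof k ℕ (fun l => grading k Λ E l) 1) := by
    rintro _ ⟨_, ⟨a, rfl⟩, rfl⟩
    exact ⟨⟨ι k Λ E a, ι_mem_grading a⟩, (decomposeHom_ι k Λ E a).symm⟩
  induction l with
  | zero => simpa [grading] using h₀
  | succ l ih =>
    have e : grading k Λ E (l + 1) = grading k Λ E l * LinearMap.range (ι k Λ E) := by
      rw [grading, grading, pow_succ, mul_assoc]
    refine (Submodule.map_mono e.le).trans ?_
    rw [Submodule.map_mul]
    exact (mul_le_mul' ih h₁).trans (lof_mul_lof_le k Λ E l 1)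

/-- The tensor algebra is the direct sum of its graded pieces. -/
noncomputable instance gradedAlgebra : GradedAlgebra (grading k Λ E) :=
  GradedAlgebra.ofAlgHom _ (decomposeHom k Λ E) (coe_decomposeHom k Λ E) (by
    intro i x
    obtain ⟨y, hy⟩ := grading_le_comap k Λ E i ⟨x, x.2, rfl⟩
    have h := AlgHom.congr_fun (coe_decomposeHom k Λ E) x
    change decomposeHom k Λ E x = _
    change _ = decomposeHom k Λ E x at hy
    rw [AlgHom.comp_apply, ← hy] at h
    have hyx : y = x := Subtype.ext ((DirectSum.coeAlgHom_of _ _ _).symm.trans h)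
    rw [← hy, hyx]
    rfl)

end Graded

end BimoduleTensorAlgebra

end TensorAlgebra

/-! ### The preprojective algebra -/

section Preprojective

variable (k : Type u) [Field k] (Λ : Type u) [Ring Λ] [Algebra k Λ] (n : ℕ)

/-- The `(n+1)`-preprojective algebra `Π(Λ) = T_Λ Extⁿ_Λ(DΛ, Λ)`. -/
abbrev PreprojectiveAlgebra : Type u := BimoduleTensorAlgebra k Λ (ExtDual k Λ n)

namespace PreprojectiveAlgebra

/-- The grading of `Π(Λ)` as a tensor algebra. -/
noncomputable abbrev grading (l : ℕ) : Submodule k (PreprojectiveAlgebra k Λ n) :=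
  BimoduleTensorAlgebra.grading k Λ (ExtDual k Λ n) l

/-- The structure map `Λ → Π(Λ)`, with image the degree `0` part. -/
noncomputable abbrev incl : Λ →ₐ[k] PreprojectiveAlgebra k Λ n :=
  BimoduleTensorAlgebra.incl k Λ (ExtDual k Λ n)

end PreprojectiveAlgebra

end Preprojective

/-! ### The Segre product -/

section Segre

variable {k : Type u} [Field k] {A B : Type u} [Ring A] [Algebra k A] [Ring B] [Algebra k B]
  (𝒜 : ℕ → Submodule k A) (ℬ : ℕ → Submodule k B)

/-- The image of `A_l ⊗ B_l` in `A ⊗ B`. -/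
def segrePiece (l : ℕ) : Submodule k (A ⊗[k] B) :=
  Submodule.map₂ (TensorProduct.mk k A B) (𝒜 l) (ℬ l)

theorem tmul_mem_segrePiece {l : ℕ} {a : A} {b : B} (ha : a ∈ 𝒜 l) (hb : b ∈ ℬ l) :
    a ⊗ₜ[k] b ∈ segrePiece 𝒜 ℬ l :=
  Submodule.apply_mem_map₂ _ ha hb

theorem segrePiece_mul_le [SetLike.GradedMonoid 𝒜] [SetLike.GradedMonoid ℬ] (i j : ℕ) :
    segrePiece 𝒜 ℬ i * segrePiece 𝒜 ℬ j ≤ segrePiece 𝒜 ℬ (i + j) := by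
  rw [segrePiece, segrePiece, Submodule.map₂_eq_span_image2, Submodule.map₂_eq_span_image2,
    Submodule.span_mul_span, Submodule.span_le]
  rintro _ ⟨_, ⟨a, ha, b, hb, rfl⟩, _, ⟨a', ha', b', hb', rfl⟩, rfl⟩
  change (a ⊗ₜ[k] b) * (a' ⊗ₜ[k] b') ∈ segrePiece 𝒜 ℬ (i + j)
  rw [Algebra.TensorProduct.tmul_mul_tmul]
  exact tmul_mem_segrePiece 𝒜 ℬ (SetLike.mul_mem_graded ha ha') (SetLike.mul_mem_graded hb hb')

/-- The Segre product `⨁ A_l ⊗ B_l` of two graded algebras, as a subalgebra of `A ⊗ B`. -/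
def segreProduct [SetLike.GradedMonoid 𝒜] [SetLike.GradedMonoid ℬ] : Subalgebra k (A ⊗[k] B) :=
  (⨆ l, segrePiece 𝒜 ℬ l).toSubalgebra
    (Submodule.mem_iSup_of_mem 0
      (tmul_mem_segrePiece 𝒜 ℬ (SetLike.one_mem_graded 𝒜) (SetLike.one_mem_graded ℬ)))
    (fun x y hx hy => by
      have h : (⨆ l, segrePiece 𝒜 ℬ l) * (⨆ l, segrePiece 𝒜 ℬ l) ≤ ⨆ l, segrePiece 𝒜 ℬ l := by
        simp only [Submodule.iSup_mul, Submodule.mul_iSup]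
        exact iSup_le fun i => iSup_le fun j =>
          (segrePiece_mul_le 𝒜 ℬ _ _).trans (le_iSup (segrePiece 𝒜 ℬ) _)
      exact h (Submodule.mul_mem_mul hx hy))

theorem segrePiece_le [SetLike.GradedMonoid 𝒜] [SetLike.GradedMonoid ℬ] (l : ℕ) :
    segrePiece 𝒜 ℬ l ≤ Subalgebra.toSubmodule (segreProduct 𝒜 ℬ) := by
  rw [segreProduct, Submodule.toSubalgebra_toSubmodule]
  exact le_iSup (segrePiece 𝒜 ℬ) l

/-- The degree `l` part `A_l ⊗ B_l` of the Segre product. -/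
def segreGrading [SetLike.GradedMonoid 𝒜] [SetLike.GradedMonoid ℬ] (l : ℕ) :
    Submodule k (segreProduct 𝒜 ℬ) :=
  (segrePiece 𝒜 ℬ l).comap (segreProduct 𝒜 ℬ).val.toLinearMap

/-- The pure tensor `a ⊗ b`, with `a` in `A_l` and `b` in `B_l`, in the Segre product. -/
def segreTmul [SetLike.GradedMonoid 𝒜] [SetLike.GradedMonoid ℬ] {l : ℕ} (a : 𝒜 l) (b : ℬ l) :
    segreProduct 𝒜 ℬ :=
  ⟨(a : A) ⊗ₜ[k] (b : B), segrePiece_le 𝒜 ℬ l (tmul_mem_segrePiece 𝒜 ℬ a.2 b.2)⟩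

/-- The natural map from the (external) direct sum `⨁ A_l ⊗ B_l` to `A ⊗ B`. -/
noncomputable def segreMap : (⨁ l, (𝒜 l ⊗[k] ℬ l)) →ₗ[k] A ⊗[k] B :=
  DirectSum.toModule k ℕ _ fun l => TensorProduct.mapIncl (𝒜 l) (ℬ l)

@[simp]
theorem segreMap_lof (l : ℕ) (x : 𝒜 l ⊗[k] ℬ l) :
    segreMap 𝒜 ℬ (DirectSum.lof k ℕ (fun l => 𝒜 l ⊗[k] ℬ l) l x) =
      TensorProduct.mapIncl (𝒜 l) (ℬ l) x := by
  rw [segreMap, DirectSum.toModule_lof]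

/-- `⨁ A_l ⊗ B_l` embeds in `A ⊗ B`; the image is the Segre product, see `range_segreMap`. -/
theorem segreMap_injective [GradedAlgebra 𝒜] [GradedAlgebra ℬ] :
    Function.Injective (segreMap 𝒜 ℬ) := by
  let p (l : ℕ) : A →ₗ[k] 𝒜 l :=
    DirectSum.component k ℕ (fun l => 𝒜 l) l ∘ₗ (DirectSum.decomposeLinearEquiv 𝒜).toLinearMap
  let q (l : ℕ) : B →ₗ[k] ℬ l :=
    DirectSum.component k ℕ (fun l => ℬ l) l ∘ₗ (DirectSum.decomposeLinearEquiv ℬ).toLinearMap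
  have h (l : ℕ) : TensorProduct.map (p l) (q l) ∘ₗ segreMap 𝒜 ℬ =
      DirectSum.component k ℕ (fun l => 𝒜 l ⊗[k] ℬ l) l := by
    refine DirectSum.linearMap_ext k fun m => TensorProduct.ext' fun a b => ?_
    simp only [LinearMap.comp_apply, segreMap, DirectSum.toModule_lof, TensorProduct.mapIncl,
      TensorProduct.map_tmul, Submodule.subtype_apply, p, q, LinearEquiv.coe_coe,
      DirectSum.decomposeLinearEquiv_apply, DirectSum.decompose_coe]
    rw [← DirectSum.lof_eq_of k, ← DirectSum.lof_eq_of k]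
    by_cases hml : m = l
    · subst hml
      simp only [DirectSum.component.lof_self]
    · rw [DirectSum.component.of, DirectSum.component.of, DirectSum.component.of]
      simp [hml]
  intro x y hxy
  refine DFinsupp.ext fun l => ?_
  have := congrArg (TensorProduct.map (p l) (q l)) hxy
  rwa [← LinearMap.comp_apply, ← LinearMap.comp_apply, h] at this

theorem range_segreMap [SetLike.GradedMonoid 𝒜] [SetLike.GradedMonoid ℬ] :
    LinearMap.range (segreMap 𝒜 ℬ) = Subalgebra.toSubmodule (segreProduct 𝒜 ℬ) := by
  rw [segreProduct, Submodule.toSubalgebra_toSubmodule]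
  refine le_antisymm ?_ (iSup_le fun l => ?_)
  · rintro _ ⟨x, rfl⟩
    induction x using DirectSum.induction_on with
    | zero => simp
    | of l x =>
      rw [← DirectSum.lof_eq_of k, segreMap_lof]
      refine Submodule.mem_iSup_of_mem l ?_
      rw [segrePiece, ← TensorProduct.range_mapIncl]
      exact LinearMap.mem_range_self _ x
    | add x y hx hy => rw [map_add]; exact add_mem hx hy
  · rw [segrePiece, ← TensorProduct.range_mapIncl]
    rintro _ ⟨x, rfl⟩
    exact ⟨_, segreMap_lof 𝒜 ℬ l x⟩

end Segre

/-! ### Maps out of a tensor algebra that are determined by right multiplication by generators -/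

namespace BimoduleTensorAlgebra

section Extend

variable {k : Type u} [Field k] {Λ : Type u} [Ring Λ] [Algebra k Λ]
  {E : Type u} [AddCommGroup E] [Module k E] [Module Λ E] [Module Λᵐᵒᵖ E]

/-! Write `Λ = Λ₁ ⊗ Λ₂`, and let `⊠` be the external tensor product of modules. The central tool is
a Künneth formula (`ExternalTensor.bijective_extProd`): for finitely generated `X₁`, `X₂` over
Noetherian algebras, with `Ext(X₂, Y₂)` concentrated in degree `b`, the product of extension classes
`Extⁱ(X₁, Y₁) ⊗ Extᵇ(X₂, Y₂) → Extⁱ⁺ᵇ(X₁ ⊠ X₂, Y₁ ⊠ Y₂)` is bijective. It is proved by dimension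
shifting, first in `X₂` and then in `X₁` (`bijective_ext_comparison`), down to homomorphisms between
modules with finite free source. Since `Λ ≅ Λ₁ ⊠ Λ₂` and `DΛ ≅ DΛ₁ ⊠ DΛ₂`, compatibly with right
multiplications, the formula computes `Ext_Λ(DΛ, M₁ ⊠ M₂)` with its module structure.

On a module `M` the functor `𝕊ₙ⁻¹` has cohomology `Extⁿ⁺ⁱ(DΛ, M)` in degree `i`. So the condition on
all `𝕊ₙ⁻ˡ(Λ)` says that there are finitely generated modules `M l` with `M 0 ≅ Λ`, with `Extⁿ(DΛ, M
l) ≅ M (l + 1)`, and with no other extension groups (`exists_inverseSerrePow_iso_iff`). By Künneth,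
`M₁ l ⊠ M₂ l` is such a sequence for `Λ`. At `l = 0` Künneth also gives `E ≅ E₁ ⊗ E₂` as bimodules,
for `E = Ext(DΛ, Λ)` in the top degree.

Such an isomorphism induces an algebra map from `T_Λ(E)` to the tensor product of the two tensor
algebras, with image the Segre product. It is injective because the degree `l` component of an
element can be read off from its image by a map built recursively from `(p x, q y) ↦ (p, q) · (x ⊗
y)` (`exists_zip`). The recursion needs that the positive part of a tensor algebra is `T ⊗_Λ E`;
`extend` derives what is needed of this from the universal property, by means of a twisted action.

For the global dimension, filter a module by powers of the radical of `Λ₁`. A module killed by the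
radical is a retract of some `(Λ₁ / rad) ⊠ N`, because the semisimple quotient is separable over an
algebraically closed field; this bounds the dimension by `n₁ + n₂`. The bound is attained because
`Ext(DΛ, Λ)` in degree `n₁ + n₂` is a tensor product of two nonzero spaces. Connectedness follows
because central elements of each factor, hence of the product, are scalars up to nilpotents. -/

theorem grading_succ (l : ℕ) :
    grading k Λ E (l + 1) = grading k Λ E l * LinearMap.range (ι k Λ E) := by
  rw [grading, grading, pow_succ, mul_assoc]

/-- Every element of the tensor algebra is a sum of elements of `Λ` and of products `p * x`. -/
theorem induction_right {P : BimoduleTensorAlgebra k Λ E → Prop}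
    (hadd : ∀ s t, P s → P t → P (s + t)) (hincl : ∀ a, P (incl k Λ E a))
    (hmul : ∀ p x, P p → P (p * ι k Λ E x)) (t : BimoduleTensorAlgebra k Λ E) : P t := by
  classical
  have hz : P 0 := by simpa using hincl 0
  have hl (l : ℕ) : ∀ t ∈ grading k Λ E l, P t := by
    induction l with
    | zero =>
      intro t ht
      obtain ⟨a, rfl⟩ : t ∈ LinearMap.range (incl k Λ E).toLinearMap := by simpa [grading] using ht
      exact hincl a
    | succ l ih =>
      intro t ht
      rw [grading_succ] at ht
      refine Submodule.mul_induction_on ht ?_ hadd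
      rintro p hp _ ⟨x, rfl⟩
      exact hmul p x (ih p hp)
  rw [← DirectSum.sum_support_decompose (grading k Λ E) t]
  exact Finset.sum_induction _ P hadd hz fun l _ => hl l _ (SetLike.coe_mem _)

variable {V : Type u} [AddCommGroup V] [Module k V]

variable (k Λ E V) in
/-- The left action of the tensor algebra on `Hom_k(T_Λ(E), V)`. -/
noncomputable def coinducedAction :
    BimoduleTensorAlgebra k Λ E →ₐ[k] Module.End k (BimoduleTensorAlgebra k Λ E →ₗ[k] V) :=
  AlgHom.ofLinearMap
    { toFun t := LinearMap.lcomp k V (LinearMap.mulRight k t)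
      map_add' s t := by ext φ q; simp [mul_add]
      map_smul' c t := by ext φ q; simp }
    (by ext φ q; simp) (fun s t => by ext φ q; simp [mul_assoc])

@[simp]
theorem coinducedAction_apply (t q : BimoduleTensorAlgebra k Λ E)
    (φ : BimoduleTensorAlgebra k Λ E →ₗ[k] V) : coinducedAction k Λ E V t φ q = φ (q * t) := rfl

section

variable [IsScalarTower k Λᵐᵒᵖ E]

/-- For a bilinear map `f`, the linear map `(b, q) ↦ f q (x b)`. -/
noncomputable def rightSmulMap (f : BimoduleTensorAlgebra k Λ E →ₗ[k] E →ₗ[k] V) (x : E) :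
    Λ →ₗ[k] BimoduleTensorAlgebra k Λ E →ₗ[k] V where
  toFun b := f.flip (MulOpposite.op b • x)
  map_add' b c := by rw [MulOpposite.op_add, add_smul, map_add]
  map_smul' c b := by rw [MulOpposite.op_smul, smul_assoc, map_smul]; rfl

@[simp]
theorem rightSmulMap_apply (f : BimoduleTensorAlgebra k Λ E →ₗ[k] E →ₗ[k] V) (x : E) (b : Λ)
    (q : BimoduleTensorAlgebra k Λ E) :
    rightSmulMap f x b q = f q (MulOpposite.op b • x) := rfl

end

section

variable [IsScalarTower k Λᵐᵒᵖ E] [SMulCommClass Λ Λᵐᵒᵖ E]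
  (f : BimoduleTensorAlgebra k Λ E →ₗ[k] E →ₗ[k] V)
  (hf : ∀ p a x, f (p * incl k Λ E a) x = f p (a • x))

/-- The left action of the tensor algebra on `Λ ⊕ Hom_k(T_Λ(E), V)`, twisted by a balanced
bilinear map. -/
noncomputable def twistedAction : BimoduleTensorAlgebra k Λ E →ₐ[k]
    Module.End k (Λ × (BimoduleTensorAlgebra k Λ E →ₗ[k] V)) :=
  lift
    (AlgHom.ofLinearMap
      { toFun a := LinearMap.prodMap (LinearMap.mulLeft k a)
          (coinducedAction k Λ E V (incl k Λ E a))
        map_add' a b := by ext <;> simp [add_mul]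
        map_smul' c a := by ext <;> simp }
      (by ext <;> simp) (fun a b => by ext <;> simp))
    -- A generator `x` sends `(b, ψ)` to `(0, q ↦ f q (x b) + ψ (q x))`. Compatibility with the left
    -- action is where `hf` is needed: `f (q a) (x b) = f q (a x b)`.
    { toFun x := LinearMap.prod 0 (LinearMap.coprod (rightSmulMap f x)
          (coinducedAction k Λ E V (ι k Λ E x)))
      map_add' x y := by ext <;> simp
      map_smul' c x := by ext <;> simp [smul_algebra_smul_comm] }
    (fun a x => by ext <;> simp [ι_smul, hf, mul_assoc, smul_comm a])
    (fun a x => by ext <;> simp [ι_op_smul, mul_assoc, mul_smul])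

/-- The linear map with value `f p x` on `p * x` and value `0` on `Λ`. -/
noncomputable def extend : BimoduleTensorAlgebra k Λ E →ₗ[k] V :=
  -- The product `p * x` moves `(1, 0)` first to `(0, q ↦ f q x)` and then to `(0, q ↦ f (q p) x)`,
  -- whose value at `1` is `f p x`.
  LinearMap.applyₗ 1 ∘ₗ LinearMap.snd k _ _ ∘ₗ LinearMap.applyₗ (1, 0) ∘ₗ
    (twistedAction f hf).toLinearMap

theorem extend_incl (a : Λ) : extend f hf (incl k Λ E a) = 0 := by
  simp [extend, twistedAction]

/-- The twist only sees the `Λ`-component, so once a generator has moved `(1, 0)` into the second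
summand, only right translation is left. -/
theorem twistedAction_inr (p : BimoduleTensorAlgebra k Λ E)
    (φ : BimoduleTensorAlgebra k Λ E →ₗ[k] V) :
    twistedAction f hf p (0, φ) = (0, coinducedAction k Λ E V p φ) := by
  induction p using induction_right generalizing φ with
  | hadd s t hs ht => simp [map_add, hs, ht]
  | hincl a => simp [twistedAction]
  | hmul p x ih =>
    rw [map_mul, Module.End.mul_apply]
    have h : twistedAction f hf (ι k Λ E x) (0, φ) =
        (0, coinducedAction k Λ E V (ι k Λ E x) φ) := by
      simp [twistedAction]
    rw [h, ih, map_mul, Module.End.mul_apply]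

theorem extend_mul_ι (p : BimoduleTensorAlgebra k Λ E) (x : E) :
    extend f hf (p * ι k Λ E x) = f p x := by
  simp only [extend, LinearMap.comp_apply, AlgHom.toLinearMap_apply, map_mul,
    LinearMap.applyₗ_apply_apply, Module.End.mul_apply]
  have : twistedAction f hf (ι k Λ E x) (1, 0) = (0, f.flip x) := by
    ext <;> simp [twistedAction]
  rw [this, twistedAction_inr]
  simp

end

end Extend

end BimoduleTensorAlgebra

/-! ### The Segre product of two tensor algebras -/

namespace BimoduleTensorAlgebra

section Segre

variable {k : Type u} [Field k] {Λ₁ Λ₂ : Type u} [Ring Λ₁] [Algebra k Λ₁] [Ring Λ₂] [Algebra k Λ₂]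
  {E₁ : Type u} [AddCommGroup E₁] [Module k E₁] [Module Λ₁ E₁] [Module Λ₁ᵐᵒᵖ E₁]
  {E₂ : Type u} [AddCommGroup E₂] [Module k E₂] [Module Λ₂ E₂] [Module Λ₂ᵐᵒᵖ E₂]
  {E : Type u} [AddCommGroup E] [Module k E] [Module (Λ₁ ⊗[k] Λ₂) E] [Module (Λ₁ ⊗[k] Λ₂)ᵐᵒᵖ E]

variable (k Λ₁ E₁) in
/-- The projection of the tensor algebra onto its degree `0` part. -/
noncomputable def projZero : BimoduleTensorAlgebra k Λ₁ E₁ →ₐ[k] Λ₁ :=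
  lift (AlgHom.id k Λ₁) 0 (by simp) (by simp)

@[simp]
theorem projZero_incl (a : Λ₁) : projZero k Λ₁ E₁ (incl k Λ₁ E₁ a) = a := lift_incl _ _ _ _ a

@[simp]
theorem projZero_ι (x : E₁) : projZero k Λ₁ E₁ (ι k Λ₁ E₁ x) = 0 := lift_ι _ _ _ _ x

section

variable (φ : E₁ ⊗[k] E₂ ≃ₗ[k] E)
  (hl : ∀ a b x y, φ ((a • x) ⊗ₜ[k] (b • y)) = (a ⊗ₜ[k] b : Λ₁ ⊗[k] Λ₂) • φ (x ⊗ₜ[k] y))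
  (hr : ∀ a b x y, φ ((MulOpposite.op a • x) ⊗ₜ[k] (MulOpposite.op b • y)) =
    MulOpposite.op (a ⊗ₜ[k] b : Λ₁ ⊗[k] Λ₂) • φ (x ⊗ₜ[k] y))

include hl hr in
-- The comparison map starts at the tensor algebra of `E`, where the universal property applies. Its
-- two bimodule conditions are additive, so they reduce to pure tensors, where they are `hl` and
-- `hr`.
theorem exists_segreHom : ∃ Ψ : BimoduleTensorAlgebra k (Λ₁ ⊗[k] Λ₂) E →ₐ[k]
    BimoduleTensorAlgebra k Λ₁ E₁ ⊗[k] BimoduleTensorAlgebra k Λ₂ E₂,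
    (∀ a b, Ψ (incl k _ E (a ⊗ₜ[k] b)) = incl k Λ₁ E₁ a ⊗ₜ[k] incl k Λ₂ E₂ b) ∧
    ∀ x y, Ψ (ι k _ E (φ (x ⊗ₜ[k] y))) = ι k Λ₁ E₁ x ⊗ₜ[k] ι k Λ₂ E₂ y := by
  refine ⟨lift (Algebra.TensorProduct.map (incl k Λ₁ E₁) (incl k Λ₂ E₂))
    (TensorProduct.map (ι k Λ₁ E₁) (ι k Λ₂ E₂) ∘ₗ φ.symm.toLinearMap) ?_ ?_, ?_, ?_⟩
  · intro c z
    obtain ⟨z, rfl⟩ := φ.surjective z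
    induction c using TensorProduct.induction_on with
    | zero => simp
    | add c d hc hd => simp only [add_smul, map_add, hc, hd, add_mul]
    | tmul a b =>
      induction z using TensorProduct.induction_on with
      | zero => simp
      | add c d hc hd => simp only [smul_add, map_add, hc, hd, mul_add]
      | tmul x y => rw [← hl]; simp [ι_smul]
  · intro c z
    obtain ⟨z, rfl⟩ := φ.surjective z
    induction c using TensorProduct.induction_on with
    | zero => simp
    | add c d hc hd => simp only [MulOpposite.op_add, add_smul, map_add, hc, hd, mul_add]
    | tmul a b =>
      induction z using TensorProduct.induction_on with
      | zero => simp
      | add c d hc hd => simp only [smul_add, map_add, hc, hd, add_mul]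
      | tmul x y => rw [← hr]; simp [ι_op_smul]
  · intro a b
    rw [lift_incl, Algebra.TensorProduct.map_tmul]
  · intro x y
    simp

variable [IsScalarTower k Λ₁ᵐᵒᵖ E₁] [SMulCommClass Λ₁ Λ₁ᵐᵒᵖ E₁]
  [IsScalarTower k Λ₂ᵐᵒᵖ E₂] [SMulCommClass Λ₂ Λ₂ᵐᵒᵖ E₂]

include hl hr in
/-- The maps inverse to the degree `l` parts of the comparison homomorphism. -/
theorem exists_zip (l : ℕ) : ∃ β : BimoduleTensorAlgebra k Λ₁ E₁ →ₗ[k]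
    BimoduleTensorAlgebra k Λ₂ E₂ →ₗ[k] BimoduleTensorAlgebra k (Λ₁ ⊗[k] Λ₂) E,
    (∀ p q a b, β (p * incl k Λ₁ E₁ a) (q * incl k Λ₂ E₂ b) =
      β p q * incl k _ E (a ⊗ₜ[k] b)) ∧
    ∀ Ψ : BimoduleTensorAlgebra k (Λ₁ ⊗[k] Λ₂) E →ₐ[k]
      BimoduleTensorAlgebra k Λ₁ E₁ ⊗[k] BimoduleTensorAlgebra k Λ₂ E₂,
    (∀ a b, Ψ (incl k _ E (a ⊗ₜ[k] b)) = incl k Λ₁ E₁ a ⊗ₜ[k] incl k Λ₂ E₂ b) →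
    (∀ x y, Ψ (ι k _ E (φ (x ⊗ₜ[k] y))) = ι k Λ₁ E₁ x ⊗ₜ[k] ι k Λ₂ E₂ y) →
    ∀ t, TensorProduct.lift β (Ψ t) =
      (DirectSum.decompose (grading k (Λ₁ ⊗[k] Λ₂) E) t l : BimoduleTensorAlgebra k _ E) := by
  induction l with
  | zero =>
    -- In degree `0`, project both factors to their degree `0` parts and include the tensor.
    refine ⟨(TensorProduct.mk k Λ₁ Λ₂).compr₂ (incl k _ E).toLinearMap |>.compl₁₂
      (projZero k Λ₁ E₁).toLinearMap (projZero k Λ₂ E₂).toLinearMap, ?_, ?_⟩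
    · intro p q a b
      simp [map_mul, ← Algebra.TensorProduct.tmul_mul_tmul]
    intro Ψ h₀ h₁ t
    induction t using induction_right with
    | hadd s t hs ht => rw [map_add, map_add, hs, ht, DirectSum.decompose_add]; rfl
    | hincl a =>
      rw [DirectSum.decompose_of_mem_same _ (incl_mem_grading a)]
      induction a using TensorProduct.induction_on with
      | zero => simp
      | add c d hc hd => simp only [map_add, hc, hd]
      | tmul a b => simp [h₀]
    | hmul p x _ =>
      rw [DirectSum.coe_decompose_mul_of_right_mem_of_not_le _ (ι_mem_grading x) (by simp)]
      obtain ⟨x, rfl⟩ := φ.surjective x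
      induction x using TensorProduct.induction_on with
      | zero => simp
      | add c d hc hd => simp only [map_add, hc, hd, mul_add, add_zero]
      | tmul x y =>
        rw [map_mul, h₁]
        -- The identity holds with any element of the tensor product in place of `Ψ p`, so pure
        -- tensors suffice.
        induction Ψ p using TensorProduct.induction_on with
        | zero => simp
        | add c d hc hd => rw [add_mul, map_add, hc, hd, add_zero]
        | tmul p q => simp
  | succ l ih =>
    obtain ⟨β, hβ, hΨ⟩ := ih
    have hβ₁ (p q a) : β (p * incl k Λ₁ E₁ a) q = β p q * incl k _ E (a ⊗ₜ[k] 1) := by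
      simpa using hβ p q a 1
    have hβ₂ (p q b) : β p (q * incl k Λ₂ E₂ b) = β p q * incl k _ E (1 ⊗ₜ[k] b) := by
      simpa using hβ p q 1 b
    have hl₁ (a x y) : φ ((a • x) ⊗ₜ[k] y) = (a ⊗ₜ[k] 1 : Λ₁ ⊗[k] Λ₂) • φ (x ⊗ₜ[k] y) := by
      simpa using hl a 1 x y
    have hl₂ (b x y) : φ (x ⊗ₜ[k] (b • y)) = (1 ⊗ₜ[k] b : Λ₁ ⊗[k] Λ₂) • φ (x ⊗ₜ[k] y) := by
      simpa using hl 1 b x y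
    -- The recursion is `β' (p x) (q y) = β p q * φ (x ⊗ y)`, with value `0` if one argument lies in
    -- degree `0`. It is built by extending one variable at a time, starting with `q y` for fixed
    -- `p` and `x`. Balancedness over `Λ₂` comes from the right equivariance of `β`.
    have hg (p x) : ∃ γ : BimoduleTensorAlgebra k Λ₂ E₂ →ₗ[k]
        BimoduleTensorAlgebra k (Λ₁ ⊗[k] Λ₂) E,
        (∀ b, γ (incl k Λ₂ E₂ b) = 0) ∧
        ∀ q y, γ (q * ι k Λ₂ E₂ y) = β p q * ι k _ E (φ (x ⊗ₜ[k] y)) := by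
      refine ⟨extend ((LinearMap.mul k _).compl₁₂ (β p)
        (ι k _ E ∘ₗ φ.toLinearMap ∘ₗ TensorProduct.mk k E₁ E₂ x)) ?_,
        extend_incl _ _, extend_mul_ι _ _⟩
      intro q b y
      simp only [LinearMap.compl₁₂_apply, LinearMap.comp_apply, LinearMap.mul_apply',
        TensorProduct.mk_apply, LinearEquiv.coe_coe]
      rw [hβ₂, mul_assoc, ← ι_smul, hl₂]
    choose γ hγi hγm using hg
    -- Each `γ p x` is determined by its values on `Λ₂` and on products `q * y`, so bilinearity in
    -- `(p, x)` can be checked on these values.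
    obtain ⟨G, hG⟩ : ∃ G : BimoduleTensorAlgebra k Λ₁ E₁ →ₗ[k] E₁ →ₗ[k]
        BimoduleTensorAlgebra k Λ₂ E₂ →ₗ[k] BimoduleTensorAlgebra k (Λ₁ ⊗[k] Λ₂) E,
        ∀ p x, G p x = γ p x := by
      refine ⟨LinearMap.mk₂ k γ ?_ ?_ ?_ ?_, fun p x => rfl⟩
      · intro p p' x
        ext q
        induction q using induction_right with
        | hadd s t hs ht => rw [map_add, map_add, hs, ht]
        | hincl a => rw [LinearMap.add_apply, hγi, hγi, hγi, add_zero]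
        | hmul q y _ =>
          rw [LinearMap.add_apply, hγm, hγm, hγm, map_add, LinearMap.add_apply, add_mul]
      · intro c p x
        ext q
        induction q using induction_right with
        | hadd s t hs ht => rw [map_add, map_add, hs, ht]
        | hincl a => rw [LinearMap.smul_apply, hγi, hγi, smul_zero]
        | hmul q y _ =>
          rw [LinearMap.smul_apply, hγm, hγm, map_smul, LinearMap.smul_apply, smul_mul_assoc]
      · intro p x x'
        ext q
        induction q using induction_right with
        | hadd s t hs ht => rw [map_add, map_add, hs, ht]
        | hincl a => rw [LinearMap.add_apply, hγi, hγi, hγi, add_zero]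
        | hmul q y _ =>
          rw [LinearMap.add_apply, hγm, hγm, hγm, TensorProduct.add_tmul, map_add, map_add, mul_add]
      · intro c p x
        ext q
        induction q using induction_right with
        | hadd s t hs ht => rw [map_add, map_add, hs, ht]
        | hincl a => rw [LinearMap.smul_apply, hγi, hγi, smul_zero]
        | hmul q y _ =>
          rw [LinearMap.smul_apply, hγm, hγm, ← TensorProduct.smul_tmul', map_smul, map_smul,
            mul_smul_comm]
    have hGi (p x b) : G p x (incl k Λ₂ E₂ b) = 0 := by rw [hG, hγi]
    have hGm (p x q y) : G p x (q * ι k Λ₂ E₂ y) = β p q * ι k _ E (φ (x ⊗ₜ[k] y)) := by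
      rw [hG, hγm]
    -- Balancedness over `Λ₁` is what allows the second extension, in the variable `p x`.
    have hGb (p a x) : G (p * incl k Λ₁ E₁ a) x = G p (a • x) := by
      ext q
      induction q using induction_right with
      | hadd s t hs ht => rw [map_add, map_add, hs, ht]
      | hincl a => rw [hGi, hGi]
      | hmul q y _ => rw [hGm, hGm, hβ₁, mul_assoc, ← ι_smul, hl₁]
    refine ⟨extend G hGb, ?_, ?_⟩
    -- Right equivariance is carried through the induction because the next step uses it for
    -- balancedness. Here it comes from `hr`.
    · intro p q a b
      induction p using induction_right with
      | hadd s t hs ht => rw [add_mul, map_add, map_add, LinearMap.add_apply, LinearMap.add_apply,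
          add_mul, hs, ht]
      | hincl c => simp [← map_mul, extend_incl]
      | hmul p x ih =>
        clear ih
        rw [mul_assoc, ← ι_op_smul, extend_mul_ι, extend_mul_ι]
        induction q using induction_right with
        | hadd s t hs ht => rw [add_mul, map_add, map_add, add_mul, hs, ht]
        | hincl c => simp [← map_mul, hGi]
        | hmul q y _ => rw [mul_assoc, ← ι_op_smul, hGm, hGm, mul_assoc, ← ι_op_smul, hr]
    · intro Ψ h₀ h₁ t
      induction t using induction_right with
      | hadd s t hs ht => rw [map_add, map_add, hs, ht, DirectSum.decompose_add]; rfl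
      | hincl a =>
        rw [DirectSum.decompose_of_mem_ne _ (incl_mem_grading a) (by simp)]
        induction a using TensorProduct.induction_on with
        | zero => simp
        | add c d hc hd => simp only [map_add, hc, hd, add_zero]
        | tmul a b => simp [h₀, extend_incl]
      | hmul p x _ =>
        rw [DirectSum.coe_decompose_mul_of_right_mem_of_le _ (ι_mem_grading x) (by simp),
          Nat.add_sub_cancel, ← hΨ Ψ h₀ h₁ p]
        obtain ⟨x, rfl⟩ := φ.surjective x
        induction x using TensorProduct.induction_on with
        | zero => simp
        | add c d hc hd => simp only [map_add, hc, hd, mul_add]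
        | tmul x y =>
          rw [map_mul, h₁]
          induction Ψ p using TensorProduct.induction_on with
          | zero => simp
          | add c d hc hd => rw [add_mul, map_add, hc, hd, map_add, add_mul]
          | tmul p q =>
            rw [Algebra.TensorProduct.tmul_mul_tmul, TensorProduct.lift.tmul, extend_mul_ι, hGm,
              TensorProduct.lift.tmul]

include hl hr in
/-- If `E ≅ E₁ ⊗ E₂` as bimodules over `Λ₁ ⊗ Λ₂`, then the tensor algebra of `E` is the Segre
product of the tensor algebras of `E₁` and `E₂`. -/
theorem exists_segreProduct_algEquiv :
    ∃ e : segreProduct (grading k Λ₁ E₁) (grading k Λ₂ E₂) ≃ₐ[k]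
        BimoduleTensorAlgebra k (Λ₁ ⊗[k] Λ₂) E,
      (∀ l : ℕ, (segreGrading (grading k Λ₁ E₁) (grading k Λ₂ E₂) l).map e.toLinearMap =
          grading k (Λ₁ ⊗[k] Λ₂) E l) ∧
      ∀ (a : Λ₁) (b : Λ₂),
        e (segreTmul _ _ ⟨incl k Λ₁ E₁ a, incl_mem_grading a⟩
            ⟨incl k Λ₂ E₂ b, incl_mem_grading b⟩) = incl k (Λ₁ ⊗[k] Λ₂) E (a ⊗ₜ[k] b) := by
  obtain ⟨Ψ, h₀, h₁⟩ := exists_segreHom φ hl hr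
  -- By `exists_zip` every homogeneous component of `t` is a function of `Ψ t`.
  have hinj : Function.Injective Ψ := by
    rw [injective_iff_map_eq_zero]
    intro t ht
    apply (DirectSum.decompose (grading k (Λ₁ ⊗[k] Λ₂) E)).injective
    ext l
    obtain ⟨β, -, hβ⟩ := exists_zip φ hl hr l
    rw [← hβ Ψ h₀ h₁ t, ht]
    simp
  -- Both sides are multiplicative in the generators: the degree `l + 1` piece is the degree `l`
  -- piece times the degree one generators, and `(p ⊗ q)(x ⊗ y) = p x ⊗ q y`.
  have hmap (l : ℕ) : (grading k (Λ₁ ⊗[k] Λ₂) E l).map Ψ.toLinearMap =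
      segrePiece (grading k Λ₁ E₁) (grading k Λ₂ E₂) l := by
    have hE : (LinearMap.range (ι k _ E)).map Ψ.toLinearMap =
        Submodule.map₂ (TensorProduct.mk k _ _) (LinearMap.range (ι k Λ₁ E₁))
          (LinearMap.range (ι k Λ₂ E₂)) := by
      rw [← LinearMap.range_comp, ← TensorProduct.range_map,
        ← LinearMap.range_comp_of_range_eq_top _ φ.range]
      congr 1
      exact TensorProduct.ext' h₁
    induction l with
    | zero =>
      rw [segrePiece, grading, grading, grading, pow_zero, pow_zero, pow_zero, mul_one, mul_one,
        mul_one, ← LinearMap.range_comp, ← TensorProduct.range_map]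
      congr 1
      exact TensorProduct.ext' h₀
    | succ l ih =>
      rw [grading_succ, Submodule.map_mul, ih, hE, segrePiece, segrePiece, grading_succ,
        grading_succ]
      simp only [Submodule.map₂_eq_span_image2, Submodule.span_mul_span]
      apply le_antisymm
      · rw [Submodule.span_le]
        rintro _ ⟨_, ⟨p, hp, q, hq, rfl⟩, _, ⟨x, hx, y, hy, rfl⟩, rfl⟩
        exact Submodule.subset_span ⟨p * x, Submodule.mul_mem_mul hp hx, q * y,
          Submodule.mul_mem_mul hq hy, (Algebra.TensorProduct.tmul_mul_tmul _ _ _ _).symm⟩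
      · rw [Submodule.span_le]
        rintro _ ⟨p, hp, q, hq, rfl⟩
        refine Submodule.mul_induction_on hp ?_ ?_
        · intro p hp x hx
          refine Submodule.mul_induction_on hq ?_ ?_
          · intro q hq y hy
            exact Submodule.subset_span ⟨_, ⟨p, hp, q, hq, rfl⟩, _, ⟨x, hx, y, hy, rfl⟩,
              Algebra.TensorProduct.tmul_mul_tmul _ _ _ _⟩
          · intro q q' h h'
            beta_reduce at h h' ⊢
            rw [map_add]
            exact add_mem h h'
        · intro p p' h h'
          beta_reduce at h h' ⊢
          rw [map_add, LinearMap.add_apply]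
          exact add_mem h h'
  have hrange : Subalgebra.toSubmodule Ψ.range =
      Subalgebra.toSubmodule (segreProduct (grading k Λ₁ E₁) (grading k Λ₂ E₂)) := by
    rw [segreProduct, Submodule.toSubalgebra_toSubmodule]
    simp only [← hmap, ← Submodule.map_iSup]
    rw [(DirectSum.Decomposition.isInternal (grading k (Λ₁ ⊗[k] Λ₂) E)).submodule_iSup_eq_top,
      Submodule.map_top]
    rfl
  let e := (AlgEquiv.ofInjective Ψ hinj).trans
    (Subalgebra.equivOfEq _ _ (Subalgebra.toSubmodule_injective hrange))
  have he (t) : (e t : _ ⊗[k] _) = Ψ t := rfl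
  refine ⟨e.symm, fun l => ?_, fun a b => ?_⟩
  · ext t
    have : t ∈ grading k (Λ₁ ⊗[k] Λ₂) E l ↔
        Ψ t ∈ segrePiece (grading k Λ₁ E₁) (grading k Λ₂ E₂) l := by
      rw [← hmap]
      exact ⟨fun h => ⟨t, h, rfl⟩, fun ⟨s, hs, hst⟩ => hinj hst ▸ hs⟩
    rw [this, ← he]
    constructor
    · rintro ⟨s, hs, rfl⟩
      change (e (e.symm s)).1 ∈ _
      rw [AlgEquiv.apply_symm_apply]
      exact hs
    · intro h
      exact ⟨e t, h, e.symm_apply_apply t⟩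
  · rw [AlgEquiv.symm_apply_eq]
    exact Subtype.ext ((h₀ a b).symm.trans (he _).symm)

end

end Segre

end BimoduleTensorAlgebra

/-! ### Connectedness of tensor products -/

section Connected

variable {k : Type u} [Field k] {Λ : Type u} [Ring Λ] [Algebra k Λ]

/-- The annihilators of `e` and `1 - e` are two-sided ideals, and `Λ` is the product of the two
quotients. One of the quotients is zero exactly if `1` annihilates `e` or `1 - e`. -/
theorem IsConnectedAlgebra.eq_zero_or_eq_one (h : IsConnectedAlgebra k Λ) {e : Λ}
    (hc : ∀ x, e * x = x * e) (he : e * e = e) : e = 0 ∨ e = 1 := by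
  let I (f : Λ) : Ideal Λ := LinearMap.ker (LinearMap.toSpanSingleton Λ Λ f)
  have hI (f x : Λ) : x ∈ I f ↔ x * f = 0 := by simp [I]
  have ht (f : Λ) (hf : ∀ x, f * x = x * f) : (I f).IsTwoSided :=
    ⟨fun {a} b ha => by rw [hI] at ha ⊢; rw [mul_assoc, ← hf, ← mul_assoc, ha, zero_mul]⟩
  have := ht e hc
  have := ht (1 - e) (fun x => by rw [sub_mul, mul_sub, one_mul, mul_one, hc])
  let F : Λ →ₐ[k] (Λ ⧸ I e) × (Λ ⧸ I (1 - e)) :=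
    (Ideal.Quotient.mkₐ k (I e)).prod (Ideal.Quotient.mkₐ k (I (1 - e)))
  have hF (x) : F x = (Ideal.Quotient.mk _ x, Ideal.Quotient.mk _ x) := rfl
  have hb : Function.Bijective F := by
    constructor
    · rw [injective_iff_map_eq_zero]
      intro x hx
      rw [hF, Prod.mk_eq_zero, Ideal.Quotient.eq_zero_iff_mem, Ideal.Quotient.eq_zero_iff_mem, hI,
        hI, mul_sub, mul_one] at hx
      rw [sub_eq_zero.1 hx.2, hx.1]
    · rintro ⟨x, y⟩
      obtain ⟨x, rfl⟩ := Ideal.Quotient.mk_surjective x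
      obtain ⟨y, rfl⟩ := Ideal.Quotient.mk_surjective y
      refine ⟨x * e + y * (1 - e), ?_⟩
      rw [hF, Prod.mk.injEq, Ideal.Quotient.eq, Ideal.Quotient.eq, hI, hI]
      constructor
      · simp [sub_mul, add_mul, mul_sub, mul_assoc, he]
      · simp [sub_mul, add_mul, mul_sub, mul_assoc, he]
        abel
  rcases h.2 _ _ ⟨AlgEquiv.ofBijective F hb⟩ with h | h
  · left
    have := Ideal.Quotient.eq_zero_iff_mem.1 (Subsingleton.elim (Ideal.Quotient.mk (I e) 1) 0)
    rwa [hI, one_mul] at this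
  · right
    have := Ideal.Quotient.eq_zero_iff_mem.1 (Subsingleton.elim (Ideal.Quotient.mk (I (1 - e)) 1) 0)
    rw [hI, one_mul] at this
    exact (sub_eq_zero.1 this).symm

theorem isConnectedAlgebra_of_forall_idempotent [Nontrivial Λ]
    (h : ∀ e : Λ, (∀ x, e * x = x * e) → e * e = e → e = 0 ∨ e = 1) : IsConnectedAlgebra k Λ := by
  refine ⟨inferInstance, fun A B _ _ _ _ ⟨F⟩ => ?_⟩
  rcases h (F.symm (1, 0)) (fun x => F.injective (by ext <;> simp))
    (F.injective (by ext <;> simp)) with h | h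
  · left
    have : ((1, 0) : A × B) = 0 := by simpa using h
    exact subsingleton_of_zero_eq_one (congrArg Prod.fst this).symm
  · right
    have : ((1, 0) : A × B) = 1 := by simpa using congrArg F h
    exact subsingleton_of_zero_eq_one (congrArg Prod.snd this)

/-- For an eigenvalue `c` of `z`, the element `z - c` is not a unit. The Fitting decomposition in
the Artinian centre attaches to it a central idempotent; this must be `0` or `1`, and `1` would make
`z - c` invertible. -/
theorem IsConnectedAlgebra.exists_isNilpotent_sub [IsAlgClosed k] [Module.Finite k Λ]
    (h : IsConnectedAlgebra k Λ) {z : Λ} (hz : z ∈ Subalgebra.center k Λ) :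
    ∃ c : k, IsNilpotent (z - algebraMap k Λ c) := by
  have := h.1
  obtain ⟨c, hc⟩ := spectrum.nonempty_of_isAlgClosed_of_finiteDimensional k z
  refine ⟨c, ?_⟩
  obtain ⟨x, hx⟩ : ∃ x : Subalgebra.center k Λ, (x : Λ) = z - algebraMap k Λ c :=
    ⟨⟨z, hz⟩ - algebraMap k _ c, rfl⟩
  have : IsArtinianRing (Subalgebra.center k Λ) := IsArtinianRing.of_finite k _
  obtain ⟨n, y, hy⟩ := IsArtinian.exists_pow_succ_smul_dvd x (1 : Subalgebra.center k Λ)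
  simp only [smul_eq_mul, mul_one, Nat.succ_eq_add_one] at hy
  have hm (m : ℕ) : x ^ n * (x * y) ^ m = x ^ n := by
    induction m with
    | zero => simp
    | succ m ih =>
      calc x ^ n * (x * y) ^ (m + 1) = x ^ n * (x * y) ^ m * x * y := by ring
      _ = x ^ (n + 1) * y := by rw [ih]; ring
      _ = x ^ n := hy
  have hm' (m : ℕ) : (x * y) ^ (n + 1) * (x * y) ^ m = (x * y) ^ (n + 1) := by
    calc _ = x * y ^ (n + 1) * (x ^ n * (x * y) ^ m) := by ring
    _ = _ := by rw [hm]; ring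
  -- From `x ^ (n + 1) * y = x ^ n` it follows that `(x * y) ^ (n + 1)` is idempotent and fixes `x ^
  -- n`. The exponent `n + 1` keeps a factor `x` even for `n = 0`, so that the value `1` makes `x` a
  -- unit.
  rcases h.eq_zero_or_eq_one (e := (((x * y) ^ (n + 1) : Subalgebra.center k Λ) : Λ))
    (fun w => ((Subalgebra.mem_center_iff.1 ((x * y) ^ (n + 1)).2) w).symm)
    (congrArg Subtype.val (hm' (n + 1))) with h0 | h1
  · refine ⟨n, ?_⟩
    have h0 : (x * y) ^ (n + 1) = 0 := Subtype.ext h0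
    rw [← hx]
    refine congrArg Subtype.val (a₂ := (0 : Subalgebra.center k Λ)) (?_ : x ^ n = 0)
    rw [← hm (n + 1), h0, mul_zero]
  · exfalso
    have h1 : (x * y) ^ (n + 1) = 1 := Subtype.ext h1
    have hu : IsUnit x := IsUnit.of_mul_eq_one (y * (x * y) ^ n) (by rw [← h1]; ring)
    rw [spectrum.mem_iff] at hc
    apply hc
    rw [← IsUnit.neg_iff, neg_sub, ← hx]
    exact hu.map (Subalgebra.center k Λ).val

/-- Commuting with `Λ₁ ⊗ 1` puts an element in `Z(Λ₁) ⊗ Λ₂`. This embeds in `Λ₁ ⊗ Λ₂` by flatness,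
so commuting with `1 ⊗ Λ₂` can be tested there and puts the element in `Z(Λ₁) ⊗ Z(Λ₂)`. -/
theorem Subalgebra.center_tensorProduct_le {Λ₁ Λ₂ : Type u} [Ring Λ₁] [Algebra k Λ₁] [Ring Λ₂]
    [Algebra k Λ₂] : Subalgebra.center k (Λ₁ ⊗[k] Λ₂) ≤
      (Algebra.TensorProduct.map (Subalgebra.center k Λ₁).val
        (Subalgebra.center k Λ₂).val).range := by
  intro w hw
  rw [Subalgebra.mem_center_iff] at hw
  have h₁ : w ∈
      (Algebra.TensorProduct.map (Subalgebra.center k Λ₁).val (AlgHom.id k Λ₂)).range := by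
    rw [← Subalgebra.centralizer_coe_range_includeLeft_eq_center_tensorProduct,
      Subalgebra.mem_centralizer_iff]
    exact fun x _ => hw x
  obtain ⟨w, rfl⟩ := h₁
  have hinj : Function.Injective
      (Algebra.TensorProduct.map (Subalgebra.center k Λ₁).val (AlgHom.id k Λ₂)) :=
    Module.Flat.rTensor_preserves_injective_linearMap (M := Λ₂)
      (Subalgebra.center k Λ₁).val.toLinearMap Subtype.val_injective
  have h₂ : w ∈ (Algebra.TensorProduct.map (AlgHom.id k (Subalgebra.center k Λ₁))
      (Subalgebra.center k Λ₂).val).range := by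
    rw [← Subalgebra.centralizer_range_includeRight_eq_center_tensorProduct,
      Subalgebra.mem_centralizer_iff]
    intro x _
    apply hinj
    rw [map_mul, map_mul]
    exact hw _
  obtain ⟨w, rfl⟩ := h₂
  exact ⟨w, DFunLike.congr_fun (Algebra.TensorProduct.map_comp (Subalgebra.center k Λ₁).val
    (AlgHom.id k _) (AlgHom.id k _) (Subalgebra.center k Λ₂).val) w⟩

/-- Every element of the commutative ring `Z(Λ₁) ⊗ Z(Λ₂)` is a scalar plus a nilpotent. So a central
idempotent is either nilpotent, hence `0`, or a unit, hence `1`. -/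
theorem IsConnectedAlgebra.tensorProduct [IsAlgClosed k] {Λ₁ Λ₂ : Type u} [Ring Λ₁] [Algebra k Λ₁]
    [Ring Λ₂] [Algebra k Λ₂] [Module.Finite k Λ₁] [Module.Finite k Λ₂]
    (h₁ : IsConnectedAlgebra k Λ₁) (h₂ : IsConnectedAlgebra k Λ₂) :
    IsConnectedAlgebra k (Λ₁ ⊗[k] Λ₂) := by
  have := h₁.1
  have := h₂.1
  refine isConnectedAlgebra_of_forall_idempotent fun e hc he => ?_
  have key : ∃ c : k, IsNilpotent (e - algebraMap k _ c) := by
    obtain ⟨w, hw⟩ := Subalgebra.center_tensorProduct_le (k := k) (Λ₁ := Λ₁) (Λ₂ := Λ₂)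
      (Subalgebra.mem_center_iff.2 fun x => (hc x).symm)
    obtain ⟨c, hc⟩ : ∃ c : k, IsNilpotent (w - algebraMap k _ c) := by
      clear hw
      have hadd {v w : Subalgebra.center k Λ₁ ⊗[k] Subalgebra.center k Λ₂}
          (hv : ∃ c : k, IsNilpotent (v - algebraMap k _ c))
          (hw : ∃ c : k, IsNilpotent (w - algebraMap k _ c)) :
          ∃ c : k, IsNilpotent (v + w - algebraMap k _ c) := by
        obtain ⟨c, hv⟩ := hv
        obtain ⟨d, hw⟩ := hw
        refine ⟨c + d, ?_⟩
        rw [map_add, add_sub_add_comm]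
        exact (Commute.all _ _).isNilpotent_add hv hw
      induction w using TensorProduct.induction_on with
      | zero => exact ⟨0, by simp⟩
      | add v w hv hw => exact hadd hv hw
      | tmul a b =>
        obtain ⟨c, ha⟩ := h₁.exists_isNilpotent_sub a.2
        obtain ⟨d, hb⟩ := h₂.exists_isNilpotent_sub b.2
        refine ⟨c * d, ?_⟩
        have ha' : IsNilpotent (a - algebraMap k _ c) := by
          rwa [← IsNilpotent.map_iff (f := (Subalgebra.center k Λ₁).val) Subtype.val_injective]
        have hb' : IsNilpotent (b - algebraMap k _ d) := by
          rwa [← IsNilpotent.map_iff (f := (Subalgebra.center k Λ₂).val) Subtype.val_injective]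
        -- Both summands have a nilpotent factor, and in a commutative ring this makes each summand,
        -- and their sum, nilpotent.
        have e₁ : a ⊗ₜ[k] b - algebraMap k _ (c * d) = (a - algebraMap k _ c) ⊗ₜ[k] b +
            algebraMap k _ c ⊗ₜ[k] (b - algebraMap k _ d) := by
          rw [TensorProduct.sub_tmul, TensorProduct.tmul_sub, map_mul,
            Algebra.TensorProduct.algebraMap_apply, Algebra.TensorProduct.algebraMap_apply',
            Algebra.TensorProduct.tmul_mul_tmul, one_mul, mul_one]
          abel
        rw [e₁]
        refine (Commute.all _ _).isNilpotent_add ?_ ?_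
        · rw [show (a - algebraMap k _ c) ⊗ₜ[k] b = Algebra.TensorProduct.includeLeft (S := k)
            (a - algebraMap k _ c) * (1 ⊗ₜ[k] b) by simp]
          exact (Commute.all _ _).isNilpotent_mul_right (ha'.map _)
        · rw [show algebraMap k (Subalgebra.center k Λ₁) c ⊗ₜ[k] (b - algebraMap k _ d) =
            Algebra.TensorProduct.includeRight (b - algebraMap k _ d) *
              (algebraMap k (Subalgebra.center k Λ₁) c ⊗ₜ[k] 1) by simp]
          exact (Commute.all _ _).isNilpotent_mul_right (hb'.map _)
    refine ⟨c, ?_⟩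
    have := hc.map (Algebra.TensorProduct.map (Subalgebra.center k Λ₁).val
      (Subalgebra.center k Λ₂).val)
    rw [map_sub, AlgHom.commutes] at this
    rwa [← hw]
  obtain ⟨c, hn⟩ := key
  by_cases hc0 : c = 0
  · left
    obtain ⟨n, hn⟩ := hn
    rw [hc0, map_zero, sub_zero] at hn
    have hi : IsIdempotentElem e := he
    rcases n with _ | n
    · rw [pow_zero] at hn
      exact absurd hn one_ne_zero
    · rwa [hi.pow_succ_eq] at hn
  · right
    have hu : IsUnit e := by
      have h2 := hn.isUnit_add_left_of_commute
        ((Ne.isUnit hc0).map (algebraMap k (Λ₁ ⊗[k] Λ₂))) (Algebra.commutes _ _).symm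
      rwa [add_sub_cancel] at h2
    exact hu.mul_left_cancel (by rw [he, mul_one])

end Connected

/-! ### External tensor products of modules -/

section ExternalTensor

open scoped ModuleCat

variable (k : Type u) [Field k] {Λ₁ Λ₂ : Type u} [Ring Λ₁] [Algebra k Λ₁] [Ring Λ₂] [Algebra k Λ₂]

/-- The action of `Λ₁ ⊗ Λ₂` on `M ⊗ N`. -/
noncomputable def tensorAction (M : ModuleCat.{u} Λ₁) (N : ModuleCat.{u} Λ₂) :
    Λ₁ ⊗[k] Λ₂ →ₐ[k] Module.End k (M ⊗[k] N) :=
  Module.endTensorEndAlgHom.comp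
    (Algebra.TensorProduct.map (Algebra.lsmul k k M) (Algebra.lsmul k k N))

/-- The tensor product over `k` of a `Λ₁`-module and a `Λ₂`-module. -/
def ExternalTensor (M : ModuleCat.{u} Λ₁) (N : ModuleCat.{u} Λ₂) : Type u := M ⊗[k] N

noncomputable instance (M : ModuleCat.{u} Λ₁) (N : ModuleCat.{u} Λ₂) :
    AddCommGroup (ExternalTensor k M N) := inferInstanceAs (AddCommGroup (M ⊗[k] N))

noncomputable instance (M : ModuleCat.{u} Λ₁) (N : ModuleCat.{u} Λ₂) :
    Module (Λ₁ ⊗[k] Λ₂) (ExternalTensor k M N) :=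
  Module.compHom (M ⊗[k] N) (tensorAction k M N).toRingHom

/-- The external tensor product of a `Λ₁`-module and a `Λ₂`-module. -/
noncomputable def externalTensor (M : ModuleCat.{u} Λ₁) (N : ModuleCat.{u} Λ₂) :
    ModuleCat.{u} (Λ₁ ⊗[k] Λ₂) := ModuleCat.of _ (ExternalTensor k M N)

namespace ExternalTensor

variable {k} {M M' M'' : ModuleCat.{u} Λ₁} {N N' N'' : ModuleCat.{u} Λ₂}

variable (k M N) in
/-- The identity map from `M ⊗ N` to its type synonym. -/
noncomputable def equiv : M ⊗[k] N ≃ₗ[k] externalTensor k M N where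
  toFun z := z
  invFun z := z
  left_inv _ := rfl
  right_inv _ := rfl
  map_add' _ _ := rfl
  map_smul' c z := by
    change c • z = tensorAction k M N (algebraMap k _ c) z
    rw [AlgHom.commutes]
    rfl

theorem smul_equiv_tmul (a : Λ₁) (b : Λ₂) (x : M) (y : N) :
    (a ⊗ₜ[k] b : Λ₁ ⊗[k] Λ₂) • equiv k M N (x ⊗ₜ y) = equiv k M N ((a • x) ⊗ₜ (b • y)) := by
  change tensorAction k M N (a ⊗ₜ b) (x ⊗ₜ y) = _
  simp only [tensorAction, AlgHom.comp_apply, Algebra.TensorProduct.map_tmul,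
    Module.endTensorEndAlgHom_apply]
  rfl

/-- Construct a `Λ₁ ⊗ Λ₂`-linear map out of an external tensor product. -/
noncomputable def homMk {Z : ModuleCat.{u} (Λ₁ ⊗[k] Λ₂)} (f : M ⊗[k] N →ₗ[k] Z)
    (hf : ∀ a b x y, f ((a • x) ⊗ₜ (b • y)) = (a ⊗ₜ[k] b : Λ₁ ⊗[k] Λ₂) • f (x ⊗ₜ y)) :
    externalTensor k M N ⟶ Z :=
  ConcreteCategory.ofHom (C := ModuleCat.{u} (Λ₁ ⊗[k] Λ₂)) (X := externalTensor k M N) (Y := Z)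
    { toFun := fun z => f ((equiv k M N).symm z)
      map_add' := fun x y => by rw [map_add, map_add]
      map_smul' := fun c z => by
        obtain ⟨z, rfl⟩ := (equiv k M N).surjective z
        rw [RingHom.id_apply]
        induction c using TensorProduct.induction_on with
        | zero => rw [zero_smul, zero_smul, map_zero, map_zero]
        | add c d hc hd => rw [add_smul, add_smul, map_add, map_add, hc, hd]
        | tmul a b =>
          induction z using TensorProduct.induction_on with
          | zero => rw [map_zero, smul_zero, map_zero, map_zero, smul_zero]
          | add c d hc hd => rw [map_add, smul_add, map_add, map_add, hc, hd, map_add, map_add,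
              smul_add]
          | tmul x y => rw [smul_equiv_tmul, LinearEquiv.symm_apply_apply,
              LinearEquiv.symm_apply_apply, hf] }

@[simp]
theorem homMk_equiv {Z : ModuleCat.{u} (Λ₁ ⊗[k] Λ₂)} (f : M ⊗[k] N →ₗ[k] Z) (hf) (z : M ⊗[k] N) :
    (homMk f hf).hom (equiv k M N z) = f z := rfl

theorem hom_ext {Z : ModuleCat.{u} (Λ₁ ⊗[k] Λ₂)} {f g : externalTensor k M N ⟶ Z}
    (h : ∀ x y, f.hom (equiv k M N (x ⊗ₜ y)) = g.hom (equiv k M N (x ⊗ₜ y))) : f = g := by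
  ext z
  obtain ⟨z, rfl⟩ := (equiv k M N).surjective z
  induction z using TensorProduct.induction_on with
  | zero => simp
  | add c d hc hd => rw [map_add, map_add, map_add, hc, hd]
  | tmul x y => exact h x y

variable (k) in
/-- Functoriality of the external tensor product. -/
noncomputable def map (f : M ⟶ M') (g : N ⟶ N') : externalTensor k M N ⟶ externalTensor k M' N' :=
  homMk ((equiv k M' N').toLinearMap ∘ₗ
      TensorProduct.map (f.hom.restrictScalars k) (g.hom.restrictScalars k))
    (fun a b x y => by
      simp only [LinearMap.comp_apply, TensorProduct.map_tmul, LinearMap.restrictScalars_apply,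
        map_smul, LinearEquiv.coe_coe]
      rw [smul_equiv_tmul])

@[simp]
theorem map_tmul (f : M ⟶ M') (g : N ⟶ N') (x : M) (y : N) :
    (map k f g).hom (equiv k M N (x ⊗ₜ y)) = equiv k M' N' (f.hom x ⊗ₜ g.hom y) := rfl

theorem map_id : map k (𝟙 M) (𝟙 N) = 𝟙 _ := hom_ext fun _ _ => rfl

theorem map_comp (f : M ⟶ M') (f' : M' ⟶ M'') (g : N ⟶ N') (g' : N' ⟶ N'') :
    map k (f ≫ f') (g ≫ g') = map k f g ≫ map k f' g' := hom_ext fun _ _ => rfl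

theorem map_add_left (f f' : M ⟶ M') (g : N ⟶ N') :
    map k (f + f') g = map k f g + map k f' g := hom_ext fun _ _ =>
  (congrArg (equiv k M' N') (TensorProduct.add_tmul _ _ _)).trans
    (_root_.map_add (equiv k M' N') _ _)

theorem map_add_right (f : M ⟶ M') (g g' : N ⟶ N') :
    map k f (g + g') = map k f g + map k f g' := hom_ext fun _ _ =>
  (congrArg (equiv k M' N') (TensorProduct.tmul_add _ _ _)).trans
    (_root_.map_add (equiv k M' N') _ _)

theorem map_smul_left (c : k) (f : M ⟶ M') (g : N ⟶ N') :
    map k (c • f) g = c • map k f g := hom_ext fun _ _ =>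
  (congrArg (equiv k M' N') (TensorProduct.smul_tmul' _ _ _).symm).trans
    (_root_.map_smul (equiv k M' N') _ _)

theorem map_smul_right (c : k) (f : M ⟶ M') (g : N ⟶ N') :
    map k f (c • g) = c • map k f g := hom_ext fun x y => by
  change equiv k M' N' (f.hom x ⊗ₜ (c • g.hom y)) = c • equiv k M' N' (f.hom x ⊗ₜ g.hom y)
  rw [TensorProduct.tmul_smul, _root_.map_smul]

variable (k) in
/-- The functor `- ⊠ N`. -/
noncomputable def rightFunctor (Λ₁ : Type u) [Ring Λ₁] [Algebra k Λ₁] (N : ModuleCat.{u} Λ₂) :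
    ModuleCat.{u} Λ₁ ⥤ ModuleCat.{u} (Λ₁ ⊗[k] Λ₂) where
  obj M := externalTensor k M N
  map f := map k f (𝟙 N)
  map_id _ := map_id
  map_comp _ _ := map_comp _ _ (𝟙 N) (𝟙 N)

variable (k) in
/-- The functor `M ⊠ -`. -/
noncomputable def leftFunctor (M : ModuleCat.{u} Λ₁) (Λ₂ : Type u) [Ring Λ₂] [Algebra k Λ₂] :
    ModuleCat.{u} Λ₂ ⥤ ModuleCat.{u} (Λ₁ ⊗[k] Λ₂) where
  obj N := externalTensor k M N
  map g := map k (𝟙 M) g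
  map_id _ := map_id
  map_comp _ _ := map_comp (𝟙 M) (𝟙 M) _ _

instance : (rightFunctor k Λ₁ N).Additive where
  map_add := map_add_left _ _ _

instance : (rightFunctor k Λ₁ N).Linear k where
  map_smul _ _ := map_smul_left _ _ _

instance : (leftFunctor k M Λ₂).Additive where
  map_add := map_add_right _ _ _

instance : (leftFunctor k M Λ₂).Linear k where
  map_smul _ _ := map_smul_right _ _ _

/-- Exactness is a property of the underlying vector spaces, and every module over the field `k` is
flat. -/
theorem rightFunctor_exact (S : ShortComplex (ModuleCat.{u} Λ₁)) (hS : S.Exact) :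
    (S.map (rightFunctor k Λ₁ N)).Exact := by
  rw [ShortComplex.ShortExact.moduleCat_exact_iff_function_exact] at hS ⊢
  exact Module.Flat.rTensor_exact (R := k) N (f := S.f.hom.restrictScalars k)
    (g := S.g.hom.restrictScalars k) hS

theorem leftFunctor_exact (S : ShortComplex (ModuleCat.{u} Λ₂)) (hS : S.Exact) :
    (S.map (leftFunctor k M Λ₂)).Exact := by
  rw [ShortComplex.ShortExact.moduleCat_exact_iff_function_exact] at hS ⊢
  exact Module.Flat.lTensor_exact (R := k) M (f := S.f.hom.restrictScalars k)
    (g := S.g.hom.restrictScalars k) hS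

instance : Limits.PreservesFiniteLimits (rightFunctor k Λ₁ N) :=
  (((rightFunctor k Λ₁ N).exact_tfae.out 1 3 rfl rfl).1 rightFunctor_exact).1

instance : Limits.PreservesFiniteColimits (rightFunctor k Λ₁ N) :=
  (((rightFunctor k Λ₁ N).exact_tfae.out 1 3 rfl rfl).1 rightFunctor_exact).2

instance : Limits.PreservesFiniteLimits (leftFunctor k M Λ₂) :=
  (((leftFunctor k M Λ₂).exact_tfae.out 1 3 rfl rfl).1 leftFunctor_exact).1

instance : Limits.PreservesFiniteColimits (leftFunctor k M Λ₂) :=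
  (((leftFunctor k M Λ₂).exact_tfae.out 1 3 rfl rfl).1 leftFunctor_exact).2

variable (k) in
/-- The isomorphism of external tensor products induced by isomorphisms. -/
noncomputable def mapIso (e : M ≅ M') (f : N ≅ N') :
    externalTensor k M N ≅ externalTensor k M' N' where
  hom := map k e.hom f.hom
  inv := map k e.inv f.inv
  hom_inv_id := by rw [← map_comp, e.hom_inv_id, f.hom_inv_id, map_id]
  inv_hom_id := by rw [← map_comp, e.inv_hom_id, f.inv_hom_id, map_id]

end ExternalTensor

end ExternalTensor

/-! ### Products of extension classes -/

section Naturality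

open Abelian Limits

universe w w' v v' u'

/-- The maps on `Ext`-groups that are induced by exact functors are natural in the functor. -/
theorem CategoryTheory.Abelian.Ext.mapExactFunctor_naturality
    {C : Type u} [Category.{v} C] [Abelian C] [EnoughProjectives C] [HasExt.{w} C]
    {D : Type u'} [Category.{v'} D] [Abelian D] [HasExt.{w'} D]
    {F G : C ⥤ D} [F.Additive] [PreservesFiniteLimits F] [PreservesFiniteColimits F]
    [G.Additive] [PreservesFiniteLimits G] [PreservesFiniteColimits G] (τ : F ⟶ G) {n : ℕ} :
    ∀ {X Y : C} (e : Ext.{w} X Y n),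
      (Ext.mk₀ (τ.app X)).comp (e.mapExactFunctor G) (zero_add n) =
        (e.mapExactFunctor F).comp (Ext.mk₀ (τ.app Y)) (add_zero n) := by
  induction n with
  | zero =>
    intro X Y e
    obtain ⟨f, rfl⟩ := (Ext.mk₀_bijective X Y).2 e
    rw [Ext.mapExactFunctor_mk₀, Ext.mapExactFunctor_mk₀, Ext.mk₀_comp_mk₀, Ext.mk₀_comp_mk₀,
      τ.naturality]
  | succ n ih =>
    intro X Y e
    let S : ShortComplex C := ShortComplex.mk _ _ (kernel.condition (Projective.π X))
    have hS : S.ShortExact :=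
      { exact := ShortComplex.exact_of_f_is_kernel _ (kernelIsKernel _) }
    -- A class of positive degree dies on a projective cover of `X`, so it is the extension class of
    -- the presentation followed by a class of degree one less. Naturality is then known for both
    -- parts.
    obtain ⟨x, rfl⟩ := Ext.contravariant_sequence_exact₃ hS Y e
      (Ext.eq_zero_of_projective (P := Projective.over X) _) (add_comm 1 n)
    have h := ShortComplex.ShortExact.extClass_naturality (hS.map_of_exact F)
      (hS.map_of_exact G) (S.mapNatTrans τ)
    rw [Ext.mapExactFunctor_comp, Ext.mapExactFunctor_comp, Ext.mapExactFunctor_extClass,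
      Ext.mapExactFunctor_extClass]
    refine (Ext.comp_assoc _ _ _ (zero_add 1) (add_comm 1 n) (by omega)).symm.trans ?_
    refine (congrArg (fun z => Ext.comp z _ (add_comm 1 n)) h.symm).trans ?_
    refine (Ext.comp_assoc _ _ _ (add_zero 1) (zero_add n) (by omega)).trans ?_
    refine (congrArg (fun z => Ext.comp _ z (add_comm 1 n)) (ih x)).trans ?_
    exact (Ext.comp_assoc _ _ _ (add_comm 1 n) (add_zero n) (by omega)).symm

end Naturality

namespace ExternalTensor

open Abelian

variable (k : Type u) [Field k] {Λ₁ Λ₂ : Type u} [Ring Λ₁] [Algebra k Λ₁] [Ring Λ₂] [Algebra k Λ₂]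
  {X₁ X₁' Y₁ Y₁' : ModuleCat.{u} Λ₁} {X₂ X₂' Y₂ Y₂' : ModuleCat.{u} Λ₂}

/-- The product of extension classes, `Extⁱ(X₁, Y₁) × Extʲ(X₂, Y₂) → Extⁱ⁺ʲ(X₁ ⊠ X₂, Y₁ ⊠ Y₂)`. -/
noncomputable def extProd {i j n : ℕ} (h : i + j = n) :
    Ext.{u} X₁ Y₁ i →ₗ[k] Ext.{u} X₂ Y₂ j →ₗ[k]
      Ext.{u} (externalTensor k X₁ X₂) (externalTensor k Y₁ Y₂) n :=
  (Ext.bilinearCompOfLinear k (externalTensor k X₁ X₂) (externalTensor k Y₁ X₂)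
    (externalTensor k Y₁ Y₂) i j n h).compl₁₂
    ((rightFunctor k Λ₁ X₂).mapExtLinearMap k X₁ Y₁ i)
    ((leftFunctor k Y₁ Λ₂).mapExtLinearMap k X₂ Y₂ j)

variable {k} {i j n : ℕ} (h : i + j = n)

theorem extProd_apply (e₁ : Ext.{u} X₁ Y₁ i) (e₂ : Ext.{u} X₂ Y₂ j) :
    extProd k h e₁ e₂ = (e₁.mapExactFunctor (rightFunctor k Λ₁ X₂)).comp
      (e₂.mapExactFunctor (leftFunctor k Y₁ Λ₂)) h := rfl

theorem extProd_mk₀_mk₀ (f : X₁ ⟶ Y₁) (g : X₂ ⟶ Y₂) :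
    extProd k (zero_add 0) (Ext.mk₀ f) (Ext.mk₀ g) = Ext.mk₀ (map k f g) := by
  rw [extProd_apply, Ext.mapExactFunctor_mk₀, Ext.mapExactFunctor_mk₀]
  refine (Ext.mk₀_comp_mk₀ _ _).trans (congrArg Ext.mk₀ ?_)
  exact (map_comp _ _ _ _).symm

/-- The first variable is composed first, so this is associativity and involves no sign. With `e` an
extension class it gives compatibility with connecting morphisms. -/
theorem extProd_comp_left {a i' n' : ℕ} (e : Ext.{u} X₁' X₁ a) (e₁ : Ext.{u} X₁ Y₁ i)
    (e₂ : Ext.{u} X₂ Y₂ j) (hi : a + i = i') (h' : i' + j = n') (hn : a + n = n') :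
    extProd k h' (e.comp e₁ hi) e₂ =
      (e.mapExactFunctor (rightFunctor k Λ₁ X₂)).comp (extProd k h e₁ e₂) hn := by
  rw [extProd_apply, extProd_apply, Ext.mapExactFunctor_comp]
  exact Ext.comp_assoc _ _ _ _ _ (by omega)

/-- The natural transformation of functors `- ⊠ X₂` induced by a morphism. -/
noncomputable def rightFunctorMap (Λ₁ : Type u) [Ring Λ₁] [Algebra k Λ₁] (g : X₂ ⟶ X₂') :
    rightFunctor k Λ₁ X₂ ⟶ rightFunctor k Λ₁ X₂' where
  app M := map k (𝟙 M) g
  naturality _ _ _ := hom_ext fun _ _ => rfl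

/-- The natural transformation of functors `X₁ ⊠ -` induced by a morphism. -/
noncomputable def leftFunctorMap (f : X₁ ⟶ X₁') (Λ₂ : Type u) [Ring Λ₂] [Algebra k Λ₂] :
    leftFunctor k X₁ Λ₂ ⟶ leftFunctor k X₁' Λ₂ where
  app N := map k f (𝟙 N)
  naturality _ _ _ := hom_ext fun _ _ => rfl

theorem extProd_mk₀_comp_left (f : X₁' ⟶ X₁) (e₁ : Ext.{u} X₁ Y₁ i) (e₂ : Ext.{u} X₂ Y₂ j) :
    extProd k h ((Ext.mk₀ f).comp e₁ (zero_add i)) e₂ =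
      (Ext.mk₀ (map k f (𝟙 X₂))).comp (extProd k h e₁ e₂) (zero_add n) := by
  rw [extProd_comp_left h _ _ _ (zero_add i) h (zero_add n), Ext.mapExactFunctor_mk₀]
  rfl

/-- The product passes through the middle object `Y₁ ⊠ X₂`, so `f` has to be moved past `e₁ ⊠ X₂`;
this is the naturality of `e₁ ⊠ -`. -/
theorem extProd_mk₀_comp_right (f : X₂' ⟶ X₂) (e₁ : Ext.{u} X₁ Y₁ i) (e₂ : Ext.{u} X₂ Y₂ j) :
    extProd k h e₁ ((Ext.mk₀ f).comp e₂ (zero_add j)) =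
      (Ext.mk₀ (map k (𝟙 X₁) f)).comp (extProd k h e₁ e₂) (zero_add n) := by
  rw [extProd_apply, extProd_apply, Ext.mapExactFunctor_comp, Ext.mapExactFunctor_mk₀]
  refine (Ext.comp_assoc _ _ _ (add_zero i) (zero_add j) (by omega)).symm.trans ?_
  refine (congrArg (fun z => Ext.comp z _ _)
    (Ext.mapExactFunctor_naturality (rightFunctorMap (k := k) Λ₁ f) e₁).symm).trans ?_
  exact Ext.comp_assoc _ _ _ (zero_add i) h (by omega)

theorem extProd_comp_mk₀_right (e₁ : Ext.{u} X₁ Y₁ i) (e₂ : Ext.{u} X₂ Y₂ j) (g : Y₂ ⟶ Y₂') :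
    extProd k h e₁ (e₂.comp (Ext.mk₀ g) (add_zero j)) =
      (extProd k h e₁ e₂).comp (Ext.mk₀ (map k (𝟙 Y₁) g)) (add_zero n) := by
  rw [extProd_apply, extProd_apply, Ext.mapExactFunctor_comp, Ext.mapExactFunctor_mk₀]
  exact (Ext.comp_assoc _ _ _ h (add_zero j) (by omega)).symm

theorem extProd_comp_mk₀_left (e₁ : Ext.{u} X₁ Y₁ i) (e₂ : Ext.{u} X₂ Y₂ j) (g : Y₁ ⟶ Y₁') :
    extProd k h (e₁.comp (Ext.mk₀ g) (add_zero i)) e₂ =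
      (extProd k h e₁ e₂).comp (Ext.mk₀ (map k g (𝟙 Y₂))) (add_zero n) := by
  rw [extProd_apply, extProd_apply, Ext.mapExactFunctor_comp, Ext.mapExactFunctor_mk₀]
  refine (Ext.comp_assoc _ _ _ (add_zero i) (zero_add j) (by omega)).trans ?_
  refine (congrArg (fun z => Ext.comp _ z _)
    (Ext.mapExactFunctor_naturality (leftFunctorMap (k := k) g Λ₂) e₂)).trans ?_
  exact (Ext.comp_assoc _ _ _ h (add_zero j) (by omega)).symm

/-- The product with a class of degree `0` commutes with composition in the second variable. -/
theorem extProd_mk₀_comp {a i' : ℕ} (f : X₁ ⟶ Y₁) (e : Ext.{u} X₂' X₂ a) (e₂ : Ext.{u} X₂ Y₂ i)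
    (hi : a + i = i') :
    extProd k (zero_add i') (Ext.mk₀ f) (e.comp e₂ hi) =
      (e.mapExactFunctor (leftFunctor k X₁ Λ₂)).comp
        (extProd k (zero_add i) (Ext.mk₀ f) e₂) hi := by
  rw [extProd_apply, extProd_apply, Ext.mapExactFunctor_comp, Ext.mapExactFunctor_mk₀,
    Ext.mapExactFunctor_mk₀]
  refine (Ext.comp_assoc _ _ _ (zero_add a) hi (by omega)).symm.trans ?_
  refine (congrArg (fun z => Ext.comp z _ _)
    (Ext.mapExactFunctor_naturality (leftFunctorMap (k := k) f Λ₂) e)).trans ?_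
  exact Ext.comp_assoc _ _ _ (add_zero a) (zero_add i) (by omega)

end ExternalTensor

/-! ### Comparison of extension groups by dimension shifting -/

section Comparison

open Abelian Limits

universe w w' v v' u₁ u₂ t

variable {k : Type t} [Field k] {C : Type u₁} [Category.{v} C] [Abelian C] [HasExt.{w} C]
  [Linear k C]

section Exact

variable {S : ShortComplex C} (hS : S.ShortExact) (Y : C)

include hS

theorem CategoryTheory.ShortComplex.ShortExact.exact_precomp (n : ℕ) :
    Function.Exact ((Ext.mk₀ S.g).precompOfLinear k Y (zero_add n))
      ((Ext.mk₀ S.f).precompOfLinear k Y (zero_add n)) := fun x =>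
  ⟨Ext.contravariant_sequence_exact₂ hS Y x, by
    rintro ⟨y, rfl⟩
    change (Ext.mk₀ S.f).comp ((Ext.mk₀ S.g).comp y (zero_add n)) (zero_add n) = 0
    rw [Ext.mk₀_comp_mk₀_assoc, S.zero, Ext.mk₀_zero, Ext.zero_comp]⟩

theorem CategoryTheory.ShortComplex.ShortExact.exact_precomp_extClass {m n : ℕ} (h : 1 + m = n) :
    Function.Exact ((Ext.mk₀ S.f).precompOfLinear k Y (zero_add m))
      (hS.extClass.precompOfLinear k Y h) := fun x =>
  ⟨fun hx => Ext.contravariant_sequence_exact₁ hS Y x h hx, by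
    rintro ⟨y, rfl⟩
    exact hS.extClass_comp_assoc y (h := h)⟩

theorem CategoryTheory.ShortComplex.ShortExact.surjective_extClass_precomp {m n : ℕ}
    (h : 1 + m = n) (hs : Subsingleton (Ext.{w} S.X₂ Y n)) :
    Function.Surjective (hS.extClass.precompOfLinear k Y h) := fun x =>
  Ext.contravariant_sequence_exact₃ hS Y x (Subsingleton.elim _ _) h

/-- In degree `0` this holds because `S.g` is an epimorphism. In positive degree the kernel comes
from the extension group of `S.X₁` one degree below, which vanishes. -/
theorem CategoryTheory.ShortComplex.ShortExact.injective_precomp {n : ℕ}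
    (hs : ∀ m, m < n → Subsingleton (Ext.{w} S.X₁ Y m)) :
    Function.Injective ((Ext.mk₀ S.g).precompOfLinear k Y (zero_add n)) := by
  have := hS.epi_g
  cases n with
  | zero => exact Ext.precomp_mk₀_injective_of_epi Y S.g
  | succ m =>
    refine (injective_iff_map_eq_zero _).2 fun x hx => ?_
    obtain ⟨y, rfl⟩ := Ext.contravariant_sequence_exact₃ hS Y x hx (add_comm 1 m)
    have := hs m m.lt_succ_self
    rw [Subsingleton.elim y 0, Ext.comp_zero]

end Exact

variable {D : Type u₂} [Category.{v'} D] [Abelian D] [HasExt.{w'} D] [Linear k D]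
  {fg free : C → Prop}

omit [HasExt.{w} C] in
/-- The vanishing part of `bijective_ext_comparison`. -/
theorem subsingleton_ext_of_lt (Φ : C ⥤ D) [Φ.Additive] [PreservesFiniteLimits Φ]
    [PreservesFiniteColimits Φ]
    (hres : ∀ X, fg X → ∃ (K P : C) (f : K ⟶ P) (g : P ⟶ X) (w : f ≫ g = 0),
      fg K ∧ free P ∧ (ShortComplex.mk f g w).ShortExact) (Z : D) (b : ℕ)
    (h₂ : ∀ P, free P → ∀ j, j ≠ b → Subsingleton (Ext.{w'} (Φ.obj P) Z j)) (j : ℕ) (hj : j < b) :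
    ∀ X, fg X → Subsingleton (Ext.{w'} (Φ.obj X) Z j) := by
  induction j with
  | zero =>
    intro X hX
    obtain ⟨K, P, f, g, w, hK, hP, hS⟩ := hres X hX
    have := h₂ P hP 0 hj.ne
    have hS' := hS.map_of_exact Φ
    have : Epi (Φ.map g) := hS'.epi_g
    exact (Ext.precomp_mk₀_injective_of_epi Z (Φ.map g)).subsingleton
  | succ j ih =>
    intro X hX
    obtain ⟨K, P, f, g, w, hK, hP, hS⟩ := hres X hX
    have := h₂ P hP (j + 1) hj.ne
    have := ih (by omega) K hK
    refine ⟨fun x y => ?_⟩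
    -- The group of `Φ P` vanishes in degree `j + 1`, so both classes come from the group of `Φ K`
    -- in degree `j`, which vanishes by induction.
    obtain ⟨x', rfl⟩ := Ext.contravariant_sequence_exact₃ (hS.map_of_exact Φ) Z x
      (Subsingleton.elim (α := Ext.{w'} (Φ.obj P) Z (j + 1)) _ _) (add_comm 1 j)
    obtain ⟨y', rfl⟩ := Ext.contravariant_sequence_exact₃ (hS.map_of_exact Φ) Z y
      (Subsingleton.elim (α := Ext.{w'} (Φ.obj P) Z (j + 1)) _ _) (add_comm 1 j)
    rw [Subsingleton.elim (α := Ext.{w'} (Φ.obj K) Z j) x' y']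

/-- A natural transformation `Extⁱ(X, Y) ⊗ A ⟶ Extⁱ⁺ᵇ(Φ X, Z)` that is compatible with connecting
morphisms is an isomorphism as soon as it is so for `i = 0` and sufficiently many projectives. -/
theorem bijective_ext_comparison (Φ : C ⥤ D) [Φ.Additive] [PreservesFiniteLimits Φ]
    [PreservesFiniteColimits Φ] (hfree : ∀ P, free P → fg P ∧ Projective P)
    (hres : ∀ X, fg X → ∃ (K P : C) (f : K ⟶ P) (g : P ⟶ X) (w : f ≫ g = 0),
      fg K ∧ free P ∧ (ShortComplex.mk f g w).ShortExact) (Y : C) (Z : D) (b : ℕ)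
    (A : Type*) [AddCommGroup A] [Module k A]
    (κ : ∀ X i, Ext.{w} X Y i ⊗[k] A →ₗ[k] Ext.{w'} (Φ.obj X) Z (i + b))
    (κ_mk₀ : ∀ {X X'} (f : X' ⟶ X) (i) (e : Ext.{w} X Y i) (a : A),
      κ X' i ((Ext.mk₀ f).comp e (zero_add i) ⊗ₜ a) =
        (Ext.mk₀ (Φ.map f)).comp (κ X i (e ⊗ₜ a)) (zero_add _))
    (κ_ext : ∀ {S : ShortComplex C} (hS : S.ShortExact) (i) (e : Ext.{w} S.X₁ Y i) (a : A)
      (h : 1 + (i + b) = i + 1 + b),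
      κ S.X₃ (i + 1) (hS.extClass.comp e (add_comm 1 i) ⊗ₜ a) =
        (hS.map_of_exact Φ).extClass.comp (κ S.X₁ i (e ⊗ₜ a)) h)
    (h₁ : ∀ P, free P → Function.Bijective (κ P 0))
    (h₂ : ∀ P, free P → ∀ j, j ≠ b → Subsingleton (Ext.{w'} (Φ.obj P) Z j)) (i : ℕ) :
    ∀ X, fg X → Function.Bijective (κ X i) := by
  have sq {X X' : C} (f : X' ⟶ X) (i : ℕ) :
      ((Ext.mk₀ (Φ.map f)).precompOfLinear k Z (zero_add _)).comp (κ X i) =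
        (κ X' i).comp (((Ext.mk₀ f).precompOfLinear k Y (zero_add i)).rTensor A) :=
    TensorProduct.ext' fun e a => (κ_mk₀ f i e a).symm
  have hex {M N P : Type w} [AddCommGroup M] [AddCommGroup N] [AddCommGroup P] [Module k M]
      [Module k N] [Module k P] (f : M →ₗ[k] N) (g : N →ₗ[k] P) (h : Function.Exact f g) :
      Function.Exact (f.rTensor A) (g.rTensor A) := Module.Flat.rTensor_exact A h
  induction i with
  | zero =>
    -- Injectivity is needed for all `X` first, since the four lemma below uses it for the syzygy
    -- `K`. The composite with precomposition along `P ⟶ X` factors as a composite of injective maps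
    -- through `κ P 0`.
    have hinj : ∀ X, fg X → Function.Injective (κ X 0) := by
      intro X hX
      obtain ⟨K, P, f, g, w, hK, hP, hS⟩ := hres X hX
      refine Function.Injective.of_comp
        (f := (Ext.mk₀ (Φ.map g)).precompOfLinear k Z (zero_add _)) ?_
      rw [← LinearMap.coe_comp, sq, LinearMap.coe_comp]
      exact (h₁ P hP).1.comp (Module.Flat.rTensor_preserves_injective_linearMap _
        (hS.injective_precomp Y fun m hm => absurd hm m.not_lt_zero))
    intro X hX
    obtain ⟨K, P, f, g, w, hK, hP, hS⟩ := hres X hX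
    -- This is left exactness of the target row in degree `b`; it uses that the groups of `Φ K`
    -- vanish below `b`.
    have hinj' : Function.Injective
        ((Ext.mk₀ (Φ.map g)).precompOfLinear k Z (zero_add (0 + b))) :=
      (hS.map_of_exact Φ).injective_precomp Z
        fun m hm => subsingleton_ext_of_lt Φ hres Z b h₂ m (by omega) K hK
    exact LinearMap.bijective_of_bijective_of_injective_of_left_exact _ _ _ _ _ _ _ (sq g 0)
      (sq f 0) (hex _ _ (hS.exact_precomp Y 0)) ((hS.map_of_exact Φ).exact_precomp Z (0 + b))
      (h₁ P hP) (hinj K hK) (Module.Flat.rTensor_preserves_injective_linearMap _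
        (hS.injective_precomp Y fun m hm => absurd hm m.not_lt_zero)) hinj'
  | succ i ih =>
    intro X hX
    obtain ⟨K, P, f, g, w, hK, hP, hS⟩ := hres X hX
    have := (hfree P hP).2
    have h : 1 + (i + b) = i + 1 + b := by omega
    have sq' : ((hS.map_of_exact Φ).extClass.precompOfLinear k Z h).comp (κ K i) =
        (κ X (i + 1)).comp ((hS.extClass.precompOfLinear k Y (add_comm 1 i)).rTensor A) :=
      TensorProduct.ext' fun e a => (κ_ext hS i e a h).symm
    have hs : Function.Surjective (hS.extClass.precompOfLinear k Y (add_comm 1 i)) :=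
      hS.surjective_extClass_precomp Y _ (Ext.subsingleton_of_projective P Y i)
    -- In degree `i + 1` both rows present the group of `X` as the cokernel of the map from the
    -- group of `P` to that of `K`, because the next group of `P` vanishes on both sides.
    exact LinearMap.bijective_of_surjective_of_bijective_of_right_exact _ _ _ _ _ _ _ (sq f i)
      sq' (hex _ _ (hS.exact_precomp_extClass Y (add_comm 1 i)))
      ((hS.map_of_exact Φ).exact_precomp_extClass Z h) (ih P (hfree P hP).1).2 (ih K hK)
      (LinearMap.rTensor_surjective A hs)
      ((hS.map_of_exact Φ).surjective_extClass_precomp Z h (h₂ P hP _ (by omega)))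

end Comparison

/-! ### The Künneth formula -/

namespace ExternalTensor

/-! ### Homomorphisms out of external tensor products of free modules -/

section Free

open scoped ModuleCat

variable {k : Type u} [Field k] {Λ₁ Λ₂ : Type u} [Ring Λ₁] [Algebra k Λ₁] [Ring Λ₂] [Algebra k Λ₂]
  {P : ModuleCat.{u} Λ₁} {Q : ModuleCat.{u} Λ₂} {ι κ : Type*}
  (b₁ : Module.Basis ι Λ₁ P) (b₂ : Module.Basis κ Λ₂ Q)

include b₁ b₂

theorem hom_ext_basis {Z : ModuleCat.{u} (Λ₁ ⊗[k] Λ₂)} {f g : externalTensor k P Q ⟶ Z}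
    (h : ∀ i j, f.hom (equiv k P Q (b₁ i ⊗ₜ b₂ j)) = g.hom (equiv k P Q (b₁ i ⊗ₜ b₂ j))) :
    f = g := by
  refine hom_ext fun x y => ?_
  have hx : x ∈ Submodule.span Λ₁ (Set.range b₁) := b₁.span_eq ▸ Submodule.mem_top
  have hy : y ∈ Submodule.span Λ₂ (Set.range b₂) := b₂.span_eq ▸ Submodule.mem_top
  induction hx using Submodule.span_induction with
  | mem x hx =>
    obtain ⟨i, rfl⟩ := hx
    induction hy using Submodule.span_induction with
    | mem y hy => obtain ⟨j, rfl⟩ := hy; exact h i j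
    | zero => rw [TensorProduct.tmul_zero, map_zero, _root_.map_zero, _root_.map_zero]
    | add y z _ _ hy hz => rw [TensorProduct.tmul_add, map_add, _root_.map_add, hy, hz,
        _root_.map_add]
    | smul a y _ hy =>
      rw [← one_smul Λ₁ (b₁ i), ← smul_equiv_tmul, _root_.map_smul, _root_.map_smul, hy]
  | zero => rw [TensorProduct.zero_tmul, map_zero, _root_.map_zero, _root_.map_zero]
  | add y z _ _ hy hz => rw [TensorProduct.add_tmul, map_add, _root_.map_add, hy, hz,
      _root_.map_add]
  | smul a x _ hx =>
    rw [← one_smul Λ₂ y, ← smul_equiv_tmul, _root_.map_smul, _root_.map_smul, hx]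

/-- Coordinates identify `P ⊗ Q` with finitely supported functions from `ι × κ` to `Λ₁ ⊗ Λ₂`; with
`hom_ext_basis` this says that the elements `b₁ i ⊗ b₂ j` behave as a basis. -/
theorem exists_hom_basis {Z : ModuleCat.{u} (Λ₁ ⊗[k] Λ₂)} (g : ι × κ → Z) :
    ∃ f : externalTensor k P Q ⟶ Z, ∀ i j, f.hom (equiv k P Q (b₁ i ⊗ₜ b₂ j)) = g (i, j) := by
  let L : P ⊗[k] Q →ₗ[k] Z :=
    (Finsupp.lsum k fun p => (LinearMap.toSpanSingleton (Λ₁ ⊗[k] Λ₂) Z (g p)).restrictScalars k) ∘ₗ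
      (finsuppTensorFinsupp k k Λ₁ Λ₂ ι κ).toLinearMap ∘ₗ
        TensorProduct.map (b₁.repr.toLinearMap.restrictScalars k)
          (b₂.repr.toLinearMap.restrictScalars k)
  have hL (i j) (a : Λ₁) (b : Λ₂) : L ((a • b₁ i) ⊗ₜ (b • b₂ j)) = (a ⊗ₜ[k] b) • g (i, j) := by
    simp only [L, LinearMap.comp_apply, TensorProduct.map_tmul, LinearMap.restrictScalars_apply,
      LinearEquiv.coe_coe, map_smul, Module.Basis.repr_self, Finsupp.smul_single, smul_eq_mul,
      mul_one, finsuppTensorFinsupp_single]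
    rw [Finsupp.lsum_single]
    rfl
  refine ⟨homMk L fun a b x y => ?_, fun i j => ?_⟩
  · have hx : x ∈ Submodule.span Λ₁ (Set.range b₁) := b₁.span_eq ▸ Submodule.mem_top
    induction hx using Submodule.span_induction generalizing a b with
    | mem x hx =>
      obtain ⟨i, rfl⟩ := hx
      have hy : y ∈ Submodule.span Λ₂ (Set.range b₂) := b₂.span_eq ▸ Submodule.mem_top
      induction hy using Submodule.span_induction generalizing a b with
      | mem y hy =>
        obtain ⟨j, rfl⟩ := hy
        rw [hL, ← one_smul Λ₁ (b₁ i), ← one_smul Λ₂ (b₂ j), hL, smul_smul,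
          Algebra.TensorProduct.tmul_mul_tmul, mul_one, mul_one]
      | zero => rw [smul_zero, TensorProduct.tmul_zero, TensorProduct.tmul_zero, map_zero,
          smul_zero]
      | add y z _ _ hy hz => rw [smul_add, TensorProduct.tmul_add, TensorProduct.tmul_add,
          _root_.map_add, _root_.map_add, smul_add, hy, hz]
      | smul c y _ hy =>
        have h := hy 1 c
        rw [one_smul] at h
        rw [smul_smul, hy, h, smul_smul, Algebra.TensorProduct.tmul_mul_tmul, mul_one]
    | zero => rw [smul_zero, TensorProduct.zero_tmul, TensorProduct.zero_tmul, map_zero,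
        smul_zero]
    | add y z _ _ hy hz => rw [smul_add, TensorProduct.add_tmul, TensorProduct.add_tmul,
        _root_.map_add, _root_.map_add, smul_add, hy, hz]
    | smul c x _ hx =>
      have h := hx c 1
      rw [one_smul] at h
      rw [smul_smul, hx, h, smul_smul, Algebra.TensorProduct.tmul_mul_tmul, mul_one]
  · rw [homMk_equiv, ← one_smul Λ₁ (b₁ i), ← one_smul Λ₂ (b₂ j), hL]
    exact one_smul _ _

theorem projective_of_basis : Projective (externalTensor k P Q) where
  factors {E X} f e he := by
    have hs := (ModuleCat.epi_iff_surjective e).1 he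
    choose g hg using fun p : ι × κ => hs (f.hom (equiv k P Q (b₁ p.1 ⊗ₜ b₂ p.2)))
    obtain ⟨f', hf'⟩ := exists_hom_basis b₁ b₂ g
    refine ⟨f', hom_ext_basis b₁ b₂ fun i j => ?_⟩
    rw [ModuleCat.hom_comp, LinearMap.comp_apply, hf']
    exact hg (i, j)

end Free

section Kunneth

open Abelian

variable {k : Type u} [Field k] {Λ₁ Λ₂ : Type u} [Ring Λ₁] [Algebra k Λ₁] [Ring Λ₂] [Algebra k Λ₂]

section

open scoped ModuleCat

/-- Evaluation of morphisms out of a free module on a basis. -/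
noncomputable def basisEval {Λ : Type u} [Ring Λ] [Algebra k Λ] {P : ModuleCat.{u} Λ} {ι : Type*}
    (b : Module.Basis ι Λ P) (Y : ModuleCat.{u} Λ) : Ext.{u} P Y 0 ≃ₗ[k] (ι → Y) :=
  Ext.linearEquiv₀.trans (LinearEquiv.ofBijective
    { toFun := fun f i => f.hom (b i)
      map_add' := fun _ _ => rfl
      map_smul' := fun _ _ => rfl }
    ⟨fun _ _ h => ModuleCat.hom_ext (b.ext fun i => congrFun h i),
      fun g => ⟨ModuleCat.ofHom (b.constr ℕ g), funext fun i => b.constr_basis ℕ g i⟩⟩)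

theorem basisEval_mk₀ {Λ : Type u} [Ring Λ] [Algebra k Λ] {P : ModuleCat.{u} Λ} {ι : Type*}
    (b : Module.Basis ι Λ P) {Y : ModuleCat.{u} Λ} (f : P ⟶ Y) (i : ι) :
    basisEval (k := k) b Y (Ext.mk₀ f) i = f.hom (b i) := by
  obtain ⟨e, rfl⟩ : ∃ e : Ext.{u} P Y 0, Ext.linearEquiv₀ (R := k) e = f :=
    Ext.linearEquiv₀.surjective f
  rw [Ext.mk₀_linearEquiv₀_apply]
  rfl

/-- Evaluation on bases turns the product into the map `Y₁^ι ⊗ Y₂^κ → (Y₁ ⊗ Y₂)^(ι × κ)`, which is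
bijective because the bases are finite. -/
theorem bijective_extProd_of_basis {P Y₁ : ModuleCat.{u} Λ₁} {Q Y₂ : ModuleCat.{u} Λ₂}
    {ι κ : Type*} [Finite ι] [Finite κ] (b₁ : Module.Basis ι Λ₁ P) (b₂ : Module.Basis κ Λ₂ Q) :
    Function.Bijective (TensorProduct.lift
      (extProd k (zero_add 0) (X₁ := P) (Y₁ := Y₁) (X₂ := Q) (Y₂ := Y₂))) := by
  let ev : Ext.{u} (externalTensor k P Q) (externalTensor k Y₁ Y₂) 0 ≃ₗ[k]
      (ι × κ → externalTensor k Y₁ Y₂) :=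
    Ext.linearEquiv₀.trans (LinearEquiv.ofBijective
      { toFun := fun f p => f.hom (equiv k P Q (b₁ p.1 ⊗ₜ b₂ p.2))
        map_add' := fun _ _ => rfl
        map_smul' := fun _ _ => rfl }
      ⟨fun f g h => hom_ext_basis b₁ b₂ fun i j => congrFun h (i, j),
        fun g => (exists_hom_basis b₁ b₂ g).imp fun f hf => funext fun p => hf p.1 p.2⟩)
  have hev (f : externalTensor k P Q ⟶ externalTensor k Y₁ Y₂) (p : ι × κ) :
      ev (Ext.mk₀ f) p = f.hom (equiv k P Q (b₁ p.1 ⊗ₜ b₂ p.2)) := by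
    obtain ⟨e, rfl⟩ := (Ext.linearEquiv₀ (R := k)).surjective f
    rw [Ext.mk₀_linearEquiv₀_apply]
    rfl
  let T : Ext.{u} P Y₁ 0 ⊗[k] Ext.{u} Q Y₂ 0 ≃ₗ[k] (ι × κ → externalTensor k Y₁ Y₂) :=
    (TensorProduct.congr
      ((basisEval b₁ Y₁).trans (Finsupp.linearEquivFunOnFinite k Y₁ ι).symm)
      ((basisEval b₂ Y₂).trans (Finsupp.linearEquivFunOnFinite k Y₂ κ).symm)).trans
      ((finsuppTensorFinsupp k k Y₁ Y₂ ι κ).trans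
        ((Finsupp.linearEquivFunOnFinite k _ (ι × κ)).trans
          (LinearEquiv.piCongrRight fun _ => equiv k Y₁ Y₂)))
  have h : ev.toLinearMap ∘ₗ TensorProduct.lift
      (extProd k (zero_add 0) (X₁ := P) (Y₁ := Y₁) (X₂ := Q) (Y₂ := Y₂)) = T.toLinearMap := by
    refine TensorProduct.ext' fun e₁ e₂ => funext fun p => ?_
    obtain ⟨f, rfl⟩ := (Ext.mk₀_bijective _ _).2 e₁
    obtain ⟨g, rfl⟩ := (Ext.mk₀_bijective _ _).2 e₂
    rw [LinearMap.comp_apply, TensorProduct.lift.tmul, extProd_mk₀_mk₀, LinearEquiv.coe_coe, hev,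
      map_tmul]
    refine (congrArg (equiv k Y₁ Y₂) ?_)
    refine Eq.trans ?_ (finsuppTensorFinsupp_apply k k Y₁ Y₂ ι κ
      ((Finsupp.linearEquivFunOnFinite k Y₁ ι).symm (basisEval b₁ Y₁ (Ext.mk₀ f)))
      ((Finsupp.linearEquivFunOnFinite k Y₂ κ).symm (basisEval b₂ Y₂ (Ext.mk₀ g))) p.1 p.2).symm
    exact congrArg₂ (· ⊗ₜ[k] ·) (basisEval_mk₀ b₁ f p.1).symm (basisEval_mk₀ b₂ g p.2).symm
  have h' := T.bijective
  rw [← LinearEquiv.coe_coe, ← h, LinearMap.coe_comp] at h'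
  exact (Function.Bijective.of_comp_iff' ev.bijective _).1 h'

end

theorem exists_finite_free_presentation {Λ : Type u} [Ring Λ] [IsNoetherianRing Λ]
    (X : ModuleCat.{u} Λ) (hX : Module.Finite Λ X) :
    ∃ (K P : ModuleCat.{u} Λ) (f : K ⟶ P) (g : P ⟶ X) (w : f ≫ g = 0), Module.Finite Λ K ∧
      (Module.Free Λ P ∧ Module.Finite Λ P) ∧ (ShortComplex.mk f g w).ShortExact := by
  obtain ⟨n, f, hf⟩ := Module.Finite.exists_fin' Λ X
  exact ⟨_, _, _, _, f.shortComplexKer.zero, inferInstanceAs (Module.Finite Λ (LinearMap.ker f)),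
    ⟨inferInstanceAs (Module.Free Λ (Fin n → Λ)), inferInstanceAs (Module.Finite Λ (Fin n → Λ))⟩,
    LinearMap.shortExact_shortComplexKer hf⟩

theorem projective_of_free_finite {Λ : Type u} [Ring Λ] (P : ModuleCat.{u} Λ)
    (hP : Module.Free Λ P ∧ Module.Finite Λ P) : Module.Finite Λ P ∧ Projective P :=
  have := hP.1
  have : Module.Projective Λ P := Module.Projective.of_free
  ⟨hP.2, P.projective_of_categoryTheory_projective⟩

/-- This is the Künneth formula for free `P`, by dimension shifting in the second variable along the
exact functor `P ⊠ -`. -/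
theorem bijective_extProd_of_free [IsNoetherianRing Λ₂] {P Y₁ : ModuleCat.{u} Λ₁}
    (hP : Module.Free Λ₁ P ∧ Module.Finite Λ₁ P) {X₂ Y₂ : ModuleCat.{u} Λ₂}
    (hX₂ : Module.Finite Λ₂ X₂) {i n : ℕ} (h : 0 + i = n) :
    Function.Bijective (TensorProduct.lift
      (extProd k h (X₁ := P) (Y₁ := Y₁) (X₂ := X₂) (Y₂ := Y₂))) := by
  obtain rfl : i = n := (zero_add i).symm.trans h
  have hPQ (Q : ModuleCat.{u} Λ₂) (hQ : Module.Free Λ₂ Q ∧ Module.Finite Λ₂ Q) :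
      Function.Bijective (TensorProduct.lift
        (extProd k (zero_add 0) (X₁ := P) (Y₁ := Y₁) (X₂ := Q) (Y₂ := Y₂))) ∧
      Projective (externalTensor k P Q) := by
    obtain ⟨_, _⟩ := hP
    obtain ⟨_, _⟩ := hQ
    exact ⟨bijective_extProd_of_basis (Module.Free.chooseBasis Λ₁ P) (Module.Free.chooseBasis Λ₂ Q),
      projective_of_basis (Module.Free.chooseBasis Λ₁ P) (Module.Free.chooseBasis Λ₂ Q)⟩
  have hflip (Q : ModuleCat.{u} Λ₂) (i : ℕ) :
      TensorProduct.lift (extProd k (zero_add i) (X₁ := P) (Y₁ := Y₁) (X₂ := Q) (Y₂ := Y₂)).flip =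
        TensorProduct.lift (extProd k (zero_add i)) ∘ₗ (TensorProduct.comm k _ _).toLinearMap :=
    TensorProduct.ext' fun _ _ => rfl
  -- The varying group must be the left tensor factor in the comparison theorem, hence the flipped
  -- product. The degree shift is `0` because `P ⊠ Q` is projective for free `Q`.
  have key := bijective_ext_comparison (k := k) (leftFunctor k P Λ₂) projective_of_free_finite
    exists_finite_free_presentation Y₂ (externalTensor k Y₁ Y₂) 0 (Ext.{u} P Y₁ 0)
    (fun X i => TensorProduct.lift (extProd k (zero_add i)).flip)
    (fun {_ _} f i e a => extProd_mk₀_comp_right (zero_add i) f a e)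
    (fun {S} hS i e a h => by
      obtain ⟨f, rfl⟩ := (Ext.mk₀_bijective _ _).2 a
      refine (extProd_mk₀_comp f hS.extClass e (add_comm 1 i)).trans ?_
      rw [Ext.mapExactFunctor_extClass]
      rfl)
    (fun Q hQ => by
      change Function.Bijective (TensorProduct.lift (extProd k (zero_add 0)).flip)
      rw [hflip, LinearMap.coe_comp]
      exact (hPQ Q hQ).1.comp (TensorProduct.comm k _ _).bijective)
    (fun Q hQ j hj => by
      have := (hPQ Q hQ).2
      obtain ⟨j, rfl⟩ := Nat.exists_eq_succ_of_ne_zero hj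
      exact Ext.subsingleton_of_projective (externalTensor k P Q) _ j) i X₂ hX₂
  change Function.Bijective (TensorProduct.lift (extProd k (zero_add i)).flip) at key
  rw [hflip, LinearMap.coe_comp] at key
  exact (Function.Bijective.of_comp_iff _ (TensorProduct.comm k _ _).bijective).1 key

variable [IsNoetherianRing Λ₁] [IsNoetherianRing Λ₂] {X₁ Y₁ : ModuleCat.{u} Λ₁}
  {X₂ Y₂ : ModuleCat.{u} Λ₂} (hX₁ : Module.Finite Λ₁ X₁) (hX₂ : Module.Finite Λ₂ X₂)
  {b : ℕ} (hb : ∀ j, j ≠ b → Subsingleton (Ext.{u} X₂ Y₂ j))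

omit [IsNoetherianRing Λ₁] in
include hX₂ hb in
-- The group is `Ext⁰(P, Y₁) ⊗ Extʲ(X₂, Y₂)`, whose second factor vanishes. Concentration of
-- `Ext(X₂, Y₂)` thus supplies the vanishing on free modules that dimension shifting in the first
-- variable requires.
theorem subsingleton_ext_of_free (P : ModuleCat.{u} Λ₁)
    (hP : Module.Free Λ₁ P ∧ Module.Finite Λ₁ P) (j : ℕ) (hj : j ≠ b) :
    Subsingleton (Ext.{u} (externalTensor k P X₂) (externalTensor k Y₁ Y₂) j) := by
  have := hb j hj
  have : Subsingleton (Ext.{u} P Y₁ 0 ⊗[k] Ext.{u} X₂ Y₂ j) := inferInstance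
  exact (bijective_extProd_of_free hP hX₂ (zero_add j)).2.subsingleton

include hX₁ hX₂ hb

theorem subsingleton_ext_externalTensor_of_lt (j : ℕ) (hj : j < b) :
    Subsingleton (Ext.{u} (externalTensor k X₁ X₂) (externalTensor k Y₁ Y₂) j) :=
  subsingleton_ext_of_lt (rightFunctor k Λ₁ X₂) exists_finite_free_presentation
    (externalTensor k Y₁ Y₂) b (fun P hP => subsingleton_ext_of_free hX₂ hb P hP) j hj X₁ hX₁

/-- The Künneth formula, in the case where `Ext(X₂, Y₂)` is concentrated in one degree. -/
theorem bijective_extProd (i : ℕ) :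
    Function.Bijective (TensorProduct.lift
      (extProd k (rfl : i + b = i + b) (X₁ := X₁) (Y₁ := Y₁) (X₂ := X₂) (Y₂ := Y₂))) := by
  -- Now the first variable is shifted along `- ⊠ X₂`, with `Extᵇ(X₂, Y₂)` as the constant tensor
  -- factor and degree shift `b`.
  refine bijective_ext_comparison (k := k) (rightFunctor k Λ₁ X₂) projective_of_free_finite
    exists_finite_free_presentation Y₁ (externalTensor k Y₁ Y₂) b (Ext.{u} X₂ Y₂ b)
    (fun X i => TensorProduct.lift (extProd k (rfl : i + b = i + b)))
    (fun {_ _} f i e a => extProd_mk₀_comp_left (rfl : i + b = i + b) f e a)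
    (fun {S} hS i e a h => by
      refine (extProd_comp_left (rfl : i + b = i + b) hS.extClass e a (add_comm 1 i) rfl h).trans ?_
      rw [Ext.mapExactFunctor_extClass]
      rfl)
    (fun P hP => ?_) (fun P hP => subsingleton_ext_of_free hX₂ hb P hP) i X₁ hX₁
  exact bijective_extProd_of_free hP hX₂ rfl

end Kunneth

end ExternalTensor

/-! ### Complexes in the derived category that are concentrated in degree zero -/

namespace DerivedCategory

open Limits

universe w w' v v' u₁ u₂

variable {C : Type u₁} [Category.{v} C] [Abelian C] [HasDerivedCategory.{w} C]
  {D : Type u₂} [Category.{v'} D] [Abelian D] [HasDerivedCategory.{w'} D]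

/-- For the canonical t-structure, an object that is both `≥ 0` and `≤ 0` is a stalk complex, and
the stalk is recovered as its cohomology in degree `0`. -/
theorem nonempty_iso_plus_single_iff (X : DerivedCategory.Plus C) (M : C) :
    Nonempty (X ≅ (Plus.singleFunctor C 0).obj M) ↔
      (∀ i : ℤ, i ≠ 0 → IsZero ((homologyFunctor C i).obj (Plus.ι.obj X))) ∧
        Nonempty ((homologyFunctor C 0).obj (Plus.ι.obj X) ≅ M) := by
  constructor
  · rintro ⟨e⟩
    let e' : Plus.ι.obj X ≅ (singleFunctor C 0).obj M := Plus.ι.mapIso e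
    refine ⟨fun i hi => ?_, ⟨(homologyFunctor C 0).mapIso e' ≪≫
      (singleFunctorCompHomologyFunctorIso C 0).app M⟩⟩
    refine IsZero.of_iso ?_ ((homologyFunctor C i).mapIso e')
    rcases hi.lt_or_gt with hi | hi
    · exact isZero_of_isGE _ 0 i hi
    · exact isZero_of_isLE _ 0 i hi
  · rintro ⟨h, ⟨e⟩⟩
    have : (Plus.ι.obj X).IsGE 0 := (isGE_iff _ _).2 fun i hi => h i hi.ne
    have : (Plus.ι.obj X).IsLE 0 := (isLE_iff _ _).2 fun i hi => h i hi.ne'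
    obtain ⟨Y, ⟨f⟩⟩ := exists_iso_singleFunctor_obj_of_isGE_of_isLE (Plus.ι.obj X) 0
    exact ⟨Plus.ι.preimageIso (f ≪≫ (singleFunctor C 0).mapIso
      (((singleFunctorCompHomologyFunctorIso C 0).app Y).symm ≪≫
        (homologyFunctor C 0).mapIso f.symm ≪≫ e))⟩

/-- The value of a right derived functor on an object, computed by an injective resolution. -/
noncomputable def rightDerivedFunctorPlusSingleIso [EnoughInjectives C] (F : C ⥤ D) [F.Additive]
    {M : C} (R : InjectiveResolution M) :
    Plus.ι.obj (F.rightDerivedFunctorPlus.obj ((Plus.singleFunctor C 0).obj M)) ≅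
      Q.obj ((F.mapHomologicalComplex (ComplexShape.up ℤ)).obj R.cochainComplex) :=
  let K : CochainComplex.Plus C := ⟨R.cochainComplex, 0, inferInstance⟩
  -- On a complex of injectives the unit of the derived functor is an isomorphism.
  have (n : ℤ) : Injective (K.obj.X n) := inferInstanceAs (Injective (R.cochainComplex.X n))
  let e : Plus.Qh.obj ((HomotopyCategory.Plus.quotient C).obj K) ≅
      (Plus.singleFunctor C 0).obj M := Plus.ι.preimageIso
    ((quotientCompQhIso C).app R.cochainComplex ≪≫ (asIso (Q.map R.ι')).symm ≪≫
      (singleFunctorIsoCompQ C 0).symm.app M)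
  Plus.ι.mapIso (F.rightDerivedFunctorPlus.mapIso e.symm ≪≫
    (asIso (F.rightDerivedFunctorPlusUnit.app ((HomotopyCategory.Plus.quotient C).obj K))).symm) ≪≫
    (quotientCompQhIso D).app ((F.mapHomologicalComplex (ComplexShape.up ℤ)).obj R.cochainComplex)

/-- The homology of a shift of a right derived functor. -/
noncomputable def homologyShiftRightDerivedIso [EnoughInjectives C] (F : C ⥤ D) [F.Additive]
    {M : C} (R : InjectiveResolution M) (n i j : ℤ) (h : n + i = j) :
    (homologyFunctor D i).obj (Plus.ι.obj ((F.rightDerivedFunctorPlus ⋙ shiftFunctor _ n).obj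
      ((Plus.singleFunctor C 0).obj M))) ≅
      ((F.mapHomologicalComplex (ComplexShape.up ℤ)).obj R.cochainComplex).homology j :=
  (homologyFunctor D i).mapIso ((Plus.ι.commShiftIso n).app _) ≪≫
    ((homologyFunctor D 0).shiftIso n i j h).app _ ≪≫
      (homologyFunctor D j).mapIso (rightDerivedFunctorPlusSingleIso F R) ≪≫
        (homologyFunctorFactors D j).app _

end DerivedCategory

/-! ### The modules `Extⁿ_Λ(DΛ, M)` and the inverse Serre functor -/

section DualExt

open Abelian Limits

variable (k : Type u) [Field k] (Λ : Type u) [Ring Λ] [Algebra k Λ]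

/-- `Extⁿ_Λ(DΛ, M)`. -/
def DualExt (M : ModuleCat.{u} Λ) (n : ℕ) : Type u :=
  Ext.{u} (ModuleCat.of Λ (DualBimodule k Λ)) M n

namespace DualExt

variable {k Λ} {M : ModuleCat.{u} Λ} {n : ℕ}

noncomputable instance : AddCommGroup (DualExt k Λ M n) :=
  inferInstanceAs (AddCommGroup (Ext.{u} _ _ n))

/-- The action of `Λ` on `Extⁿ_Λ(DΛ, M)`, induced by the right action of `Λ` on `DΛ`. -/
noncomputable instance : Module Λ (DualExt k Λ M n) where
  smul a e := (Ext.mk₀ (ExtDual.dualMul k Λ a)).comp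
    (show Ext.{u} (ModuleCat.of Λ (DualBimodule k Λ)) M n from e) (zero_add n)
  one_smul e := by
    change Ext.comp _ _ _ = _
    rw [ExtDual.dualMul_one, Ext.mk₀_id_comp]
  mul_smul a b e := by
    change Ext.comp _ _ _ = Ext.comp _ (Ext.comp _ _ _) _
    rw [ExtDual.dualMul_mul, Ext.mk₀_comp_mk₀_assoc]
  smul_zero a := Ext.comp_zero _ _ _ _ _
  smul_add a e e' := Ext.comp_add _ _ _ _
  add_smul a b e := by
    change Ext.comp _ _ _ = Ext.comp _ _ _ + Ext.comp _ _ _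
    rw [ExtDual.dualMul_add, Ext.mk₀_add, Ext.add_comp]; rfl
  zero_smul e := by
    change Ext.comp _ _ _ = 0
    rw [ExtDual.dualMul_zero, Ext.mk₀_zero, Ext.zero_comp]; rfl

end DualExt

end DualExt

/-! ### Extension classes as cocycles modulo coboundaries -/

namespace CategoryTheory.InjectiveResolution

open Abelian CochainComplex HomComplex

universe w v u₁

variable {C : Type u₁} [Category.{v} C] [Abelian C] [HasExt.{w} C] {X Y : C}
  (R : InjectiveResolution Y)

theorem extMk_congr {n m : ℕ} {f g : X ⟶ R.cocomplex.X n} (h : f = g) (hm : n + 1 = m)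
    (hf : f ≫ R.cocomplex.d n m = 0) :
    R.extMk f m hm hf = R.extMk g m hm (h ▸ hf) := by
  subst h
  rfl

/-- A variant of `extMk_eq_zero_iff` that includes the case of degree `0`. -/
theorem extMk_eq_zero_iff_int {n : ℕ} (f : X ⟶ R.cocomplex.X n) (m : ℕ) (hm : n + 1 = m)
    (hf : f ≫ R.cocomplex.d n m = 0) {p : ℤ} (hp : p + 1 = n) :
    R.extMk f m hm hf = 0 ↔ ∃ g : X ⟶ R.cochainComplex.X p,
      g ≫ R.cochainComplex.d p n = f ≫ (R.cochainComplexXIso n n rfl).inv := by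
  rw [← R.extEquivCohomologyClass.apply_eq_iff_eq, extEquivCohomologyClass_extMk,
    extEquivCohomologyClass_zero, CohomologyClass.mk_eq_zero_iff,
    Cocycle.fromSingleMk_mem_coboundaries_iff _ _ _ _ _ p hp]

end CategoryTheory.InjectiveResolution

section DualHom

open Abelian Limits

variable (k : Type u) [Field k] {Λ : Type u} [Ring Λ] [Algebra k Λ] {M : ModuleCat.{u} Λ}
  (R : InjectiveResolution M) (n : ℕ)

/-- The complex `Hom_Λ(DΛ, I)` for an injective resolution `I`. -/
noncomputable abbrev dualHomComplex : CochainComplex (ModuleCat.{u} Λ) ℤ :=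
  ((dualHomFunctor k Λ).mapHomologicalComplex (ComplexShape.up ℤ)).obj R.cochainComplex

/-- The complex `Hom_Λ(DΛ, I)` near degree `n`. -/
noncomputable abbrev dualHomShortComplex : ShortComplex (ModuleCat.{u} Λ) :=
  (dualHomComplex k R).sc' ((n : ℤ) - 1) n ((n + 1 : ℕ) : ℤ)

variable {k R n}

theorem cocycle_comp_d (z : LinearMap.ker (dualHomShortComplex k R n).g.hom) :
    (ModuleCat.ofHom (show DualBimodule k Λ →ₗ[Λ] R.cochainComplex.X n from z.1) ≫
      (R.cochainComplexXIso n n rfl).hom) ≫ R.cocomplex.d n (n + 1) = 0 := by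
  have h : ModuleCat.ofHom (show DualBimodule k Λ →ₗ[Λ] R.cochainComplex.X n from z.1) ≫
      R.cochainComplex.d n ((n + 1 : ℕ) : ℤ) = 0 := ModuleCat.hom_ext z.2
  rw [R.cochainComplex_d n ((n + 1 : ℕ) : ℤ) n (n + 1) rfl rfl] at h
  rw [← cancel_mono (R.cochainComplexXIso ((n + 1 : ℕ) : ℤ) (n + 1) rfl).inv, zero_comp]
  simpa only [Category.assoc] using h

variable (k R n)

/-- The extension class of a cocycle. -/
noncomputable def cocycleClass :
    LinearMap.ker (dualHomShortComplex k R n).g.hom →ₗ[Λ] DualExt k Λ M n where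
  toFun z := R.extMk (ModuleCat.ofHom (show DualBimodule k Λ →ₗ[Λ] R.cochainComplex.X n from z.1) ≫
    (R.cochainComplexXIso n n rfl).hom) (n + 1) rfl (cocycle_comp_d z)
  map_add' z z' := by
    refine Eq.trans ?_ (R.add_extMk _ _ (n + 1) rfl (cocycle_comp_d z) (cocycle_comp_d z')).symm
    congr 1
    rw [← Preadditive.add_comp]
    rfl
  map_smul' a z :=
    (R.mk₀_comp_extMk _ (n + 1) rfl (cocycle_comp_d z) (ExtDual.dualMul k Λ a)).symm

theorem cocycleClass_surjective : Function.Surjective (cocycleClass k R n) := fun e => by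
  obtain ⟨f, hf, rfl⟩ := R.extMk_surjective
    (show Ext.{u} (ModuleCat.of Λ (DualBimodule k Λ)) M n from e) (n + 1) rfl
  have h : (f ≫ (R.cochainComplexXIso n n rfl).inv) ≫
      R.cochainComplex.d n ((n + 1 : ℕ) : ℤ) = 0 := by
    rw [R.cochainComplex_d n ((n + 1 : ℕ) : ℤ) n (n + 1) rfl rfl, Category.assoc,
      Iso.inv_hom_id_assoc, reassoc_of% hf, zero_comp]
  refine ⟨⟨(f ≫ (R.cochainComplexXIso n n rfl).inv).hom, congrArg ModuleCat.Hom.hom h⟩, ?_⟩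
  exact R.extMk_congr (by
    change (f ≫ (R.cochainComplexXIso n n rfl).inv) ≫ (R.cochainComplexXIso n n rfl).hom = f
    rw [Category.assoc, Iso.inv_hom_id, Category.comp_id]) rfl (cocycle_comp_d ⟨_, _⟩)

/-- A cocycle has zero class exactly if it is a coboundary. The integer index `n - 1` covers `n = 0`
too, where the resolution is zero in degree `-1`. -/
theorem ker_cocycleClass : LinearMap.ker (cocycleClass k R n) =
    LinearMap.range (dualHomShortComplex k R n).moduleCatToCycles := by
  ext z
  rw [LinearMap.mem_ker, LinearMap.mem_range]
  refine (R.extMk_eq_zero_iff_int _ (n + 1) rfl (cocycle_comp_d z)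
    (sub_add_cancel (n : ℤ) 1)).trans ?_
  rw [Category.assoc, Iso.hom_inv_id, Category.comp_id]
  constructor
  · rintro ⟨g, hg⟩
    exact ⟨g.hom, Subtype.ext (congrArg ModuleCat.Hom.hom hg)⟩
  · rintro ⟨g, hg⟩
    exact ⟨ModuleCat.ofHom (show DualBimodule k Λ →ₗ[Λ] R.cochainComplex.X ((n : ℤ) - 1) from g),
      ModuleCat.hom_ext (congrArg Subtype.val hg)⟩

/-- The homology of `Hom_Λ(DΛ, I)`. -/
noncomputable def homologyDualHomIso :
    (dualHomComplex k R).homology n ≅ ModuleCat.of Λ (DualExt k Λ M n) :=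
  (dualHomComplex k R).homologyIsoSc' _ _ _ (by simp) (by simp) ≪≫
    (dualHomShortComplex k R n).moduleCatHomologyIso ≪≫
      ((Submodule.quotEquivOfEq _ _ (ker_cocycleClass k R n).symm).trans
        ((cocycleClass k R n).quotKerEquivOfSurjective (cocycleClass_surjective k R n))).toModuleIso

end DualHom

/-! ### The inverse Serre functor in terms of extension groups -/

section InverseSerre

open Abelian Limits

attribute [local instance] HasDerivedCategory.standard

variable (k : Type u) [Field k] {Λ : Type u} [Ring Λ] [Algebra k Λ] (n : ℕ)

/-- The inverse Serre functor sends a module to a module if and only if the extension groups are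
concentrated in one degree. -/
theorem nonempty_inverseSerre_iso_iff (M M' : ModuleCat.{u} Λ) :
    Nonempty ((inverseSerre k Λ n).obj
      ((DerivedCategory.Plus.singleFunctor (ModuleCat.{u} Λ) 0).obj M) ≅
      (DerivedCategory.Plus.singleFunctor (ModuleCat.{u} Λ) 0).obj M') ↔
      (∀ i, i ≠ n → Subsingleton (DualExt k Λ M i)) ∧ Nonempty (DualExt k Λ M n ≃ₗ[Λ] M') := by
  let R : InjectiveResolution M := InjectiveResolution.of M
  let e (i j : ℤ) (h : (n : ℤ) + i = j) :=
    DerivedCategory.homologyShiftRightDerivedIso (dualHomFunctor k Λ) R n i j h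
  rw [DerivedCategory.nonempty_iso_plus_single_iff]
  refine and_congr ⟨fun H i hi => ?_, fun H i hi => ?_⟩ ⟨?_, ?_⟩
  · exact ModuleCat.subsingleton_of_isZero
      ((H (i - n) (by omega)).of_iso ((homologyDualHomIso k R i).symm ≪≫
        (e (i - n) i (by omega)).symm))
  -- Cohomology in degree `i` is that of `Hom(DΛ, I)` in degree `n + i`. In negative degrees this
  -- complex is zero, and elsewhere the cohomology is an extension group.
  · rcases lt_or_ge ((n : ℤ) + i) 0 with hj | hj
    · refine IsZero.of_iso ?_ (e i _ rfl)
      have : (dualHomComplex k R).IsStrictlyGE 0 := inferInstanceAs (CochainComplex.IsStrictlyGE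
        (((dualHomFunctor k Λ).mapHomologicalComplex _).obj R.cochainComplex) 0)
      exact ((dualHomComplex k R).exactAt_of_isGE 0 _ hj).isZero_homology
    · obtain ⟨j, hj⟩ := Int.eq_ofNat_of_zero_le hj
      have := H j (by omega)
      exact (ModuleCat.isZero_of_subsingleton (ModuleCat.of Λ (DualExt k Λ M j))).of_iso
        (e i j hj ≪≫ homologyDualHomIso k R j)
  · rintro ⟨f⟩
    exact ⟨((homologyDualHomIso k R n).symm ≪≫ (e 0 n (add_zero _)).symm ≪≫ f).toLinearEquiv⟩
  · rintro ⟨f⟩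
    exact ⟨e 0 n (add_zero _) ≪≫ homologyDualHomIso k R n ≪≫ f.toModuleIso⟩

end InverseSerre

/-! ### Representation-infinite algebras and extension groups -/

section RepresentationInfinite

open Abelian Limits

variable {k : Type u} [Field k] {Λ : Type u} [Ring Λ] [Algebra k Λ]

/-- A sequence of modules `M l`, starting with `Λ`, such that `Ext_Λ(DΛ, M l)` is `M (l + 1)`, in
degree `n`. -/
structure IsInverseSerreSequence (k : Type u) [Field k] {Λ : Type u} [Ring Λ] [Algebra k Λ]
    (n : ℕ) (M : ℕ → ModuleCat.{u} Λ) : Prop where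
  finite (l : ℕ) : Module.Finite Λ (M l)
  zero : Nonempty (ModuleCat.of Λ Λ ≅ M 0)
  subsingleton (l i : ℕ) : i ≠ n → Subsingleton (DualExt k Λ (M l) i)
  succ (l : ℕ) : Nonempty (DualExt k Λ (M l) n ≃ₗ[Λ] M (l + 1))

attribute [local instance] HasDerivedCategory.standard

theorem inverseSerrePow_succ (n l : ℕ) : inverseSerrePow k Λ n (l + 1) =
    (inverseSerre k Λ n).obj (inverseSerrePow k Λ n l) :=
  Function.iterate_succ_apply' _ _ _

/-- As long as the iterates are modules, each further application of the functor starts from a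
module, so the condition on complexes is checked one step at a time by
`nonempty_inverseSerre_iso_iff`. -/
theorem exists_inverseSerrePow_iso_iff (n : ℕ) :
    (∀ l : ℕ, ∃ M : ModuleCat.{u} Λ, Module.Finite Λ M ∧
      Nonempty (inverseSerrePow k Λ n l ≅
        (DerivedCategory.Plus.singleFunctor (ModuleCat.{u} Λ) 0).obj M)) ↔
      ∃ M : ℕ → ModuleCat.{u} Λ, IsInverseSerreSequence k n M := by
  constructor
  · intro H
    choose M hM e using H
    have h (l : ℕ) := (nonempty_inverseSerre_iso_iff k n (M l) (M (l + 1))).1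
      ⟨(inverseSerre k Λ n).mapIso (e l).some.symm ≪≫
        eqToIso (inverseSerrePow_succ n l).symm ≪≫ (e (l + 1)).some⟩
    -- Modules embed fully faithfully in the derived category, so the isomorphism of stalk complexes
    -- for `l = 0` comes from one of modules.
    exact ⟨M, hM, ⟨(DerivedCategory.singleFunctor (ModuleCat.{u} Λ) 0).preimageIso
      (DerivedCategory.Plus.ι.mapIso (e 0).some)⟩, fun l => (h l).1, fun l => (h l).2⟩
  · rintro ⟨M, hM⟩ l
    refine ⟨M l, hM.finite l, ?_⟩
    induction l with
    | zero => exact ⟨Functor.mapIso _ hM.zero.some⟩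
    | succ l ih =>
      exact ⟨eqToIso (inverseSerrePow_succ n l) ≪≫ (inverseSerre k Λ n).mapIso ih.some ≪≫
        ((nonempty_inverseSerre_iso_iff k n (M l) (M (l + 1))).2
          ⟨hM.subsingleton l, hM.succ l⟩).some⟩

end RepresentationInfinite

/-! ### The bimodules `Λ` and `DΛ` for a tensor product of algebras -/

namespace ExternalTensor

open scoped ModuleCat
open Abelian

variable {k : Type u} [Field k] {Λ₁ Λ₂ : Type u} [Ring Λ₁] [Algebra k Λ₁] [Ring Λ₂] [Algebra k Λ₂]

/-- Construct an isomorphism from an external tensor product. -/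
noncomputable def isoMk {M : ModuleCat.{u} Λ₁} {N : ModuleCat.{u} Λ₂}
    {Z : ModuleCat.{u} (Λ₁ ⊗[k] Λ₂)} (f : M ⊗[k] N ≃ₗ[k] Z)
    (hf : ∀ a b x y, f ((a • x) ⊗ₜ (b • y)) = (a ⊗ₜ[k] b : Λ₁ ⊗[k] Λ₂) • f (x ⊗ₜ y)) :
    externalTensor k M N ≅ Z :=
  have : IsIso (homMk f.toLinearMap hf) := (ConcreteCategory.isIso_iff_bijective _).2
    (f.bijective.comp (equiv k M N).symm.bijective)
  asIso (homMk f.toLinearMap hf)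

/-- An additive equivalence that is compatible with the scalars of `k` is `k`-linear. -/
def linearEquivOfAlgebraMap {Λ : Type u} [Ring Λ] [Algebra k Λ] {M : ModuleCat.{u} Λ} {W : Type u}
    [AddCommGroup W] [Module k W] (e : M ≃+ W) (he : ∀ c m, e (algebraMap k Λ c • m) = c • e m) :
    M ≃ₗ[k] W where
  __ := e
  map_smul' c m := he c m

/-- The left module `Λ`. -/
def regularModule (Λ : Type u) [Ring Λ] : ModuleCat.{u} Λ := ModuleCat.of Λ Λ

/-- The left module `DΛ`. -/
noncomputable def dualModule (k : Type u) [Field k] (Λ : Type u) [Ring Λ] [Algebra k Λ] :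
    ModuleCat.{u} Λ :=
  ModuleCat.of Λ (DualBimodule k Λ)

/-- Right multiplication on `Λ`. -/
noncomputable def regularModuleMul {Λ : Type u} [Ring Λ] (a : Λ) :
    regularModule Λ ⟶ regularModule Λ := ExtDual.regMul Λ a

/-- Right multiplication on `DΛ`. -/
noncomputable def dualModuleMul (k : Type u) [Field k] {Λ : Type u} [Ring Λ] [Algebra k Λ]
    (a : Λ) : dualModule k Λ ⟶ dualModule k Λ := ExtDual.dualMul k Λ a

/-- The `k`-linear identification of the module `Λ` with `Λ`. -/
noncomputable def regularModuleEquiv (k : Type u) [Field k] (Λ : Type u) [Ring Λ] [Algebra k Λ] :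
    regularModule Λ ≃ₗ[k] Λ :=
  linearEquivOfAlgebraMap (M := regularModule Λ) (AddEquiv.refl Λ)
    fun c m => (Algebra.smul_def c (show Λ from m)).symm

/-- The `k`-linear identification of the module `DΛ` with the dual of `Λ`. -/
noncomputable def dualModuleEquiv (k : Type u) [Field k] (Λ : Type u) [Ring Λ] [Algebra k Λ] :
    dualModule k Λ ≃ₗ[k] Module.Dual k Λ :=
  linearEquivOfAlgebraMap (M := dualModule k Λ) (AddEquiv.refl (Module.Dual k Λ))
    fun c f => LinearMap.ext fun x =>
      (congrArg (show Module.Dual k Λ from f)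
        ((Algebra.commutes c x).symm.trans (Algebra.smul_def c x).symm)).trans
        (_root_.map_smul (show Module.Dual k Λ from f) c x)

theorem dualModuleEquiv_smul_apply {Λ : Type u} [Ring Λ] [Algebra k Λ] (a : Λ)
    (f : dualModule k Λ) (x : Λ) :
    dualModuleEquiv k Λ (a • f) x = dualModuleEquiv k Λ f (x * a) := rfl

theorem dualModuleEquiv_mul_apply {Λ : Type u} [Ring Λ] [Algebra k Λ] (a : Λ)
    (f : dualModule k Λ) (x : Λ) :
    dualModuleEquiv k Λ ((dualModuleMul k a).hom f) x = dualModuleEquiv k Λ f (a * x) := rfl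

variable (k Λ₁ Λ₂)

/-- The left module `Λ` of a tensor product of algebras. -/
noncomputable def regularModuleIso :
    externalTensor k (regularModule Λ₁) (regularModule Λ₂) ≅ regularModule (Λ₁ ⊗[k] Λ₂) :=
  isoMk ((TensorProduct.congr (regularModuleEquiv k Λ₁) (regularModuleEquiv k Λ₂)).trans
      (regularModuleEquiv k (Λ₁ ⊗[k] Λ₂)).symm)
    fun a b x y => (Algebra.TensorProduct.tmul_mul_tmul a (show Λ₁ from x) b (show Λ₂ from y)).symm

variable {k Λ₁ Λ₂} in
theorem map_regularModuleMul (a : Λ₁) (b : Λ₂) :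
    map k (regularModuleMul a) (regularModuleMul b) ≫ (regularModuleIso k Λ₁ Λ₂).hom =
      (regularModuleIso k Λ₁ Λ₂).hom ≫ regularModuleMul (a ⊗ₜ b) :=
  hom_ext fun x y =>
    (Algebra.TensorProduct.tmul_mul_tmul (show Λ₁ from x) a (show Λ₂ from y) b).symm

variable [Module.Finite k Λ₁] [Module.Finite k Λ₂]

/-- The isomorphism `DΛ₁ ⊗ DΛ₂ ≃ D(Λ₁ ⊗ Λ₂)`. -/
noncomputable def dualModuleTensorEquiv :
    dualModule k Λ₁ ⊗[k] dualModule k Λ₂ ≃ₗ[k] dualModule k (Λ₁ ⊗[k] Λ₂) :=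
  (TensorProduct.congr (dualModuleEquiv k Λ₁) (dualModuleEquiv k Λ₂)).trans
    ((TensorProduct.dualDistribEquiv k Λ₁ Λ₂).trans (dualModuleEquiv k (Λ₁ ⊗[k] Λ₂)).symm)

variable {k Λ₁ Λ₂} in
theorem dualModuleEquiv_dualModuleTensorEquiv (f : dualModule k Λ₁) (g : dualModule k Λ₂)
    (x : Λ₁) (y : Λ₂) :
    dualModuleEquiv k (Λ₁ ⊗[k] Λ₂) (dualModuleTensorEquiv k Λ₁ Λ₂ (f ⊗ₜ g)) (x ⊗ₜ y) =
      dualModuleEquiv k Λ₁ f x * dualModuleEquiv k Λ₂ g y := by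
  rw [dualModuleTensorEquiv, LinearEquiv.trans_apply, LinearEquiv.trans_apply,
    LinearEquiv.apply_symm_apply, TensorProduct.congr_tmul]
  exact TensorProduct.dualDistrib_apply _ _ _ _

/-- The left module `DΛ` of a tensor product of algebras. -/
noncomputable def dualModuleIso :
    externalTensor k (dualModule k Λ₁) (dualModule k Λ₂) ≅ dualModule k (Λ₁ ⊗[k] Λ₂) :=
  isoMk (dualModuleTensorEquiv k Λ₁ Λ₂) fun a b f g => by
    refine (dualModuleEquiv k (Λ₁ ⊗[k] Λ₂)).injective (TensorProduct.ext' fun x y => ?_)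
    rw [dualModuleEquiv_smul_apply, Algebra.TensorProduct.tmul_mul_tmul,
      dualModuleEquiv_dualModuleTensorEquiv, dualModuleEquiv_dualModuleTensorEquiv,
      dualModuleEquiv_smul_apply, dualModuleEquiv_smul_apply]

variable {k Λ₁ Λ₂} in
theorem map_dualModuleMul (a : Λ₁) (b : Λ₂) :
    map k (dualModuleMul k a) (dualModuleMul k b) ≫ (dualModuleIso k Λ₁ Λ₂).hom =
      (dualModuleIso k Λ₁ Λ₂).hom ≫ dualModuleMul k (a ⊗ₜ b) := by
  refine hom_ext fun f g =>
    (dualModuleEquiv k (Λ₁ ⊗[k] Λ₂)).injective (TensorProduct.ext' fun x y => ?_)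
  change dualModuleEquiv k (Λ₁ ⊗[k] Λ₂) (dualModuleTensorEquiv k Λ₁ Λ₂
    ((dualModuleMul k a).hom f ⊗ₜ (dualModuleMul k b).hom g)) (x ⊗ₜ y) =
      dualModuleEquiv k (Λ₁ ⊗[k] Λ₂) ((dualModuleMul k (a ⊗ₜ b)).hom
        (dualModuleTensorEquiv k Λ₁ Λ₂ (f ⊗ₜ g))) (x ⊗ₜ y)
  rw [dualModuleEquiv_mul_apply, Algebra.TensorProduct.tmul_mul_tmul,
    dualModuleEquiv_dualModuleTensorEquiv, dualModuleEquiv_dualModuleTensorEquiv,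
    dualModuleEquiv_mul_apply, dualModuleEquiv_mul_apply]

end ExternalTensor

/-! ### The bimodule `Extⁿ_Λ(DΛ, Λ)` for a tensor product of algebras -/

namespace CategoryTheory.Abelian.Ext

universe w v u₁ t

variable {C : Type u₁} [Category.{v} C] [Abelian C] [HasExt.{w} C] (R : Type t) [CommRing R]
  [Linear R C] {X X' Y Y' : C}

/-- Precomposition with an isomorphism. -/
noncomputable def precompIsoEquiv (e : X ≅ X') (Y : C) (n : ℕ) :
    Ext.{w} X' Y n ≃ₗ[R] Ext.{w} X Y n where
  __ := (bilinearCompOfLinear R X X' Y 0 n n (zero_add n)) (mk₀ e.hom)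
  invFun x := (mk₀ e.inv).comp x (zero_add n)
  left_inv x := by
    change (mk₀ e.inv).comp ((mk₀ e.hom).comp x (zero_add n)) (zero_add n) = x
    rw [mk₀_comp_mk₀_assoc, e.inv_hom_id, mk₀_id_comp]
  right_inv x := by
    change (mk₀ e.hom).comp ((mk₀ e.inv).comp x (zero_add n)) (zero_add n) = x
    rw [mk₀_comp_mk₀_assoc, e.hom_inv_id, mk₀_id_comp]

/-- Postcomposition with an isomorphism. -/
noncomputable def postcompIsoEquiv (X : C) (e : Y ≅ Y') (n : ℕ) :
    Ext.{w} X Y n ≃ₗ[R] Ext.{w} X Y' n where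
  __ := (bilinearCompOfLinear R X Y Y' n 0 n (add_zero n)).flip (mk₀ e.hom)
  invFun x := x.comp (mk₀ e.inv) (add_zero n)
  left_inv x := by
    change (x.comp (mk₀ e.hom) (add_zero n)).comp (mk₀ e.inv) (add_zero n) = x
    rw [comp_assoc_of_third_deg_zero, mk₀_comp_mk₀, e.hom_inv_id, comp_mk₀_id]
  right_inv x := by
    change (x.comp (mk₀ e.inv) (add_zero n)).comp (mk₀ e.hom) (add_zero n) = x
    rw [comp_assoc_of_third_deg_zero, mk₀_comp_mk₀, e.inv_hom_id, comp_mk₀_id]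

theorem postcompIsoEquiv_apply (e : Y ≅ Y') (n : ℕ) (x : Ext.{w} X Y n) :
    postcompIsoEquiv R X e n x = x.comp (mk₀ e.hom) (add_zero n) := rfl

end CategoryTheory.Abelian.Ext

namespace ExternalTensor

open scoped ModuleCat
open Abelian

variable {k : Type u} [Field k] {Λ₁ Λ₂ : Type u} [Ring Λ₁] [Algebra k Λ₁] [Ring Λ₂] [Algebra k Λ₂]

section Concentrated

variable [IsNoetherianRing Λ₁] [IsNoetherianRing Λ₂] {X₁ Y₁ : ModuleCat.{u} Λ₁}
  {X₂ Y₂ : ModuleCat.{u} Λ₂} (hX₁ : Module.Finite Λ₁ X₁) (hX₂ : Module.Finite Λ₂ X₂)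
  {a b : ℕ} (ha : ∀ j, j ≠ a → Subsingleton (Ext.{u} X₁ Y₁ j))
  (hb : ∀ j, j ≠ b → Subsingleton (Ext.{u} X₂ Y₂ j))

include hX₁ hX₂ ha hb

/-- Below `b` this is the vanishing part of the dimension shift. For `n = i + b` with `i ≠ a`, the
Künneth formula has the zero factor `Extⁱ(X₁, Y₁)`. -/
theorem subsingleton_ext_externalTensor (n : ℕ) (hn : n ≠ a + b) :
    Subsingleton (Ext.{u} (externalTensor k X₁ X₂) (externalTensor k Y₁ Y₂) n) := by
  rcases lt_or_ge n b with h | h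
  · exact subsingleton_ext_externalTensor_of_lt hX₁ hX₂ hb n h
  · obtain ⟨i, rfl⟩ := Nat.exists_eq_add_of_le' h
    have := ha i (by omega)
    have : Subsingleton (Ext.{u} X₁ Y₁ i ⊗[k] Ext.{u} X₂ Y₂ b) := inferInstance
    exact (bijective_extProd hX₁ hX₂ hb i).2.subsingleton

end Concentrated

variable [Module.Finite k Λ₁] [Module.Finite k Λ₂]

theorem finite_dualModule (k : Type u) [Field k] (Λ : Type u) [Ring Λ] [Algebra k Λ]
    [Module.Finite k Λ] : Module.Finite Λ (dualModule k Λ) :=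
  have : Module.Finite k (dualModule k Λ) := Module.Finite.equiv (dualModuleEquiv k Λ).symm
  Module.Finite.of_restrictScalars_finite k Λ _

theorem finite_externalTensor {M₁ : ModuleCat.{u} Λ₁} {M₂ : ModuleCat.{u} Λ₂}
    (h₁ : Module.Finite Λ₁ M₁) (h₂ : Module.Finite Λ₂ M₂) :
    Module.Finite (Λ₁ ⊗[k] Λ₂) (externalTensor k M₁ M₂) :=
  have : Module.Finite k M₁ := Module.Finite.trans Λ₁ M₁
  have : Module.Finite k M₂ := Module.Finite.trans Λ₂ M₂
  have : Module.Finite k (externalTensor k M₁ M₂) := Module.Finite.equiv (equiv k M₁ M₂)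
  Module.Finite.of_restrictScalars_finite k _ _

section DualExt

variable (M₁ : ModuleCat.{u} Λ₁) (M₂ : ModuleCat.{u} Λ₂) {n₁ n₂ : ℕ}
  (h₁ : ∀ i, i ≠ n₁ → Subsingleton (Ext.{u} (dualModule k Λ₁) M₁ i))
  (h₂ : ∀ i, i ≠ n₂ → Subsingleton (Ext.{u} (dualModule k Λ₂) M₂ i))

include h₁ h₂ in
theorem subsingleton_ext_dualModule (n : ℕ) (hn : n ≠ n₁ + n₂) :
    Subsingleton (Ext.{u} (dualModule k (Λ₁ ⊗[k] Λ₂)) (externalTensor k M₁ M₂) n) :=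
  have : IsNoetherianRing Λ₁ := IsNoetherianRing.of_finite k Λ₁
  have : IsNoetherianRing Λ₂ := IsNoetherianRing.of_finite k Λ₂
  have := subsingleton_ext_externalTensor (k := k) (finite_dualModule k Λ₁) (finite_dualModule k Λ₂)
    h₁ h₂ n hn
  (Ext.precompIsoEquiv k (dualModuleIso k Λ₁ Λ₂) (externalTensor k M₁ M₂) n).subsingleton

variable (n₁) in
/-- The isomorphism `Ext(DΛ₁, M₁) ⊗ Ext(DΛ₂, M₂) ≃ Ext(DΛ, M₁ ⊠ M₂)`, where
`Λ = Λ₁ ⊗ Λ₂`. -/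
noncomputable def extDualEquiv :
    Ext.{u} (dualModule k Λ₁) M₁ n₁ ⊗[k] Ext.{u} (dualModule k Λ₂) M₂ n₂ ≃ₗ[k]
      Ext.{u} (dualModule k (Λ₁ ⊗[k] Λ₂)) (externalTensor k M₁ M₂) (n₁ + n₂) :=
  have : IsNoetherianRing Λ₁ := IsNoetherianRing.of_finite k Λ₁
  have : IsNoetherianRing Λ₂ := IsNoetherianRing.of_finite k Λ₂
  (LinearEquiv.ofBijective _ (bijective_extProd (finite_dualModule k Λ₁) (finite_dualModule k Λ₂)
    h₂ n₁)).trans (Ext.precompIsoEquiv k (dualModuleIso k Λ₁ Λ₂) (externalTensor k M₁ M₂) _).symm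

theorem extDualEquiv_tmul (x : Ext.{u} (dualModule k Λ₁) M₁ n₁)
    (y : Ext.{u} (dualModule k Λ₂) M₂ n₂) :
    extDualEquiv M₁ M₂ n₁ h₂ (x ⊗ₜ y) = (Ext.mk₀ (dualModuleIso k Λ₁ Λ₂).inv).comp
      (extProd k rfl x y) (zero_add _) := rfl

/-- Left `Λ₁ ⊗ Λ₂`-linearity of the Künneth isomorphism: the left actions come from right
multiplication on the dual modules, and the product is natural in both sources. -/
theorem extDualEquiv_dualModuleMul (a : Λ₁) (b : Λ₂) (x : Ext.{u} (dualModule k Λ₁) M₁ n₁)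
    (y : Ext.{u} (dualModule k Λ₂) M₂ n₂) :
    extDualEquiv M₁ M₂ n₁ h₂ ((Ext.mk₀ (dualModuleMul k a)).comp x (zero_add _) ⊗ₜ
        (Ext.mk₀ (dualModuleMul k b)).comp y (zero_add _)) =
      (Ext.mk₀ (dualModuleMul k (a ⊗ₜ b))).comp (extDualEquiv M₁ M₂ n₁ h₂ (x ⊗ₜ y))
        (zero_add _) := by
  have h : (dualModuleIso k Λ₁ Λ₂).inv ≫ map k (dualModuleMul k a) (𝟙 _) ≫
      map k (𝟙 _) (dualModuleMul k b) = dualModuleMul k (a ⊗ₜ b) ≫ (dualModuleIso k Λ₁ Λ₂).inv := by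
    rw [Iso.inv_comp_eq, ← Category.assoc, Iso.eq_comp_inv, ← map_comp, Category.comp_id,
      Category.id_comp, map_dualModuleMul]
  rw [extDualEquiv_tmul, extDualEquiv_tmul, extProd_mk₀_comp_left, extProd_mk₀_comp_right,
    Ext.mk₀_comp_mk₀_assoc, Ext.mk₀_comp_mk₀_assoc, Ext.mk₀_comp_mk₀_assoc, Category.assoc, h]

end DualExt

end ExternalTensor

namespace ExternalTensor

open scoped ModuleCat
open Abelian

variable {k : Type u} [Field k] {Λ₁ Λ₂ : Type u} [Ring Λ₁] [Algebra k Λ₁] [Ring Λ₂] [Algebra k Λ₂]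

/-- The module `Extⁿ_Λ(DΛ, M)`. -/
noncomputable def dualExtModule (k : Type u) [Field k] {Λ : Type u} [Ring Λ] [Algebra k Λ]
    (M : ModuleCat.{u} Λ) (n : ℕ) : ModuleCat.{u} Λ := ModuleCat.of Λ (DualExt k Λ M n)

/-- The `k`-linear identification of `dualExtModule` with an extension group. -/
noncomputable def dualExtModuleEquiv (k : Type u) [Field k] {Λ : Type u} [Ring Λ] [Algebra k Λ]
    (M : ModuleCat.{u} Λ) (n : ℕ) : dualExtModule k M n ≃ₗ[k] Ext.{u} (dualModule k Λ) M n :=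
  linearEquivOfAlgebraMap (M := dualExtModule k M n) (AddEquiv.refl (Ext.{u} (dualModule k Λ) M n))
    fun c e => by
      change (Ext.mk₀ (ExtDual.dualMul k Λ (algebraMap k Λ c))).comp
        (show Ext.{u} (ModuleCat.of Λ (DualBimodule k Λ)) M n from e) (zero_add n) = _
      rw [Algebra.algebraMap_eq_smul_one, ExtDual.dualMul_smul, ExtDual.dualMul_one,
        Ext.mk₀_smul, Ext.smul_comp, Ext.mk₀_id_comp]
      rfl

theorem dualExtModuleEquiv_smul {Λ : Type u} [Ring Λ] [Algebra k Λ]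
    (M : ModuleCat.{u} Λ) (n : ℕ) (a : Λ) (e : dualExtModule k M n) :
    dualExtModuleEquiv k M n (a • e) =
      (Ext.mk₀ (dualModuleMul k a)).comp (dualExtModuleEquiv k M n e) (zero_add n) := rfl

variable [Module.Finite k Λ₁] [Module.Finite k Λ₂]

section

variable (M₁ : ModuleCat.{u} Λ₁) (M₂ : ModuleCat.{u} Λ₂) (n₁ : ℕ) {n₂ : ℕ}
  (h₂ : ∀ i, i ≠ n₂ → Subsingleton (Ext.{u} (dualModule k Λ₂) M₂ i))

/-- The isomorphism `Ext(DΛ₁, M₁) ⊠ Ext(DΛ₂, M₂) ≃ Ext(DΛ, M₁ ⊠ M₂)`, where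
`Λ = Λ₁ ⊗ Λ₂`. -/
noncomputable def dualExtModuleIso :
    externalTensor k (dualExtModule k M₁ n₁) (dualExtModule k M₂ n₂) ≅
      dualExtModule k (externalTensor k M₁ M₂) (n₁ + n₂) :=
  isoMk (((TensorProduct.congr (dualExtModuleEquiv k M₁ n₁) (dualExtModuleEquiv k M₂ n₂)).trans
      (extDualEquiv M₁ M₂ n₁ h₂)).trans
        (dualExtModuleEquiv k (externalTensor k M₁ M₂) (n₁ + n₂)).symm)
    fun a b x y => by
      refine (dualExtModuleEquiv k (externalTensor k M₁ M₂) (n₁ + n₂)).injective ?_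
      rw [dualExtModuleEquiv_smul]
      simp only [LinearEquiv.trans_apply, LinearEquiv.apply_symm_apply, TensorProduct.congr_tmul,
        dualExtModuleEquiv_smul]
      exact extDualEquiv_dualModuleMul M₁ M₂ h₂ a b _ _

end

/-- The sequences of modules `𝕊ₙ⁻ˡ(Λ)` of a tensor product of algebras. -/
theorem _root_.IsInverseSerreSequence.externalTensor {n₁ n₂ : ℕ} {M₁ : ℕ → ModuleCat.{u} Λ₁}
    {M₂ : ℕ → ModuleCat.{u} Λ₂} (h₁ : IsInverseSerreSequence k n₁ M₁)
    (h₂ : IsInverseSerreSequence k n₂ M₂) :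
    IsInverseSerreSequence k (n₁ + n₂) fun l => externalTensor k (M₁ l) (M₂ l) where
  finite l := finite_externalTensor (h₁.finite l) (h₂.finite l)
  zero := ⟨(regularModuleIso k Λ₁ Λ₂).symm ≪≫ mapIso k h₁.zero.some h₂.zero.some⟩
  subsingleton l := subsingleton_ext_dualModule (M₁ l) (M₂ l) (h₁.subsingleton l)
    (h₂.subsingleton l)
  -- The Künneth isomorphism is linear over `Λ₁ ⊗ Λ₂`, so the top extension module of `M₁ l ⊠ M₂ l`
  -- is the external tensor product of the next terms.
  succ l := ⟨((dualExtModuleIso (M₁ l) (M₂ l) n₁ (h₂.subsingleton l)).symm ≪≫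
    mapIso k (h₁.succ l).some.toModuleIso (h₂.succ l).some.toModuleIso).toLinearEquiv⟩

section ExtDual

variable {n₁ n₂ : ℕ}
  (h₂ : ∀ i, i ≠ n₂ → Subsingleton (Ext.{u} (dualModule k Λ₂) (regularModule Λ₂) i))

/-- The isomorphism `Ext(DΛ₁, Λ₁) ⊗ Ext(DΛ₂, Λ₂) ≃ Ext(DΛ, Λ)`, where `Λ = Λ₁ ⊗ Λ₂`. -/
noncomputable def extDualRegularEquiv :
    Ext.{u} (dualModule k Λ₁) (regularModule Λ₁) n₁ ⊗[k]
        Ext.{u} (dualModule k Λ₂) (regularModule Λ₂) n₂ ≃ₗ[k]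
      Ext.{u} (dualModule k (Λ₁ ⊗[k] Λ₂)) (regularModule (Λ₁ ⊗[k] Λ₂)) (n₁ + n₂) :=
  (extDualEquiv (regularModule Λ₁) (regularModule Λ₂) n₁ h₂).trans
    (Ext.postcompIsoEquiv k (dualModule k (Λ₁ ⊗[k] Λ₂)) (regularModuleIso k Λ₁ Λ₂) (n₁ + n₂))

variable (x : Ext.{u} (dualModule k Λ₁) (regularModule Λ₁) n₁)
  (y : Ext.{u} (dualModule k Λ₂) (regularModule Λ₂) n₂) (a : Λ₁) (b : Λ₂)

theorem extDualRegularEquiv_dualModuleMul :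
    extDualRegularEquiv h₂ ((Ext.mk₀ (dualModuleMul k a)).comp x (zero_add _) ⊗ₜ
        (Ext.mk₀ (dualModuleMul k b)).comp y (zero_add _)) =
      (Ext.mk₀ (dualModuleMul k (a ⊗ₜ b))).comp (extDualRegularEquiv h₂ (x ⊗ₜ y))
        (zero_add _) := by
  rw [extDualRegularEquiv, LinearEquiv.trans_apply, LinearEquiv.trans_apply,
    extDualEquiv_dualModuleMul, Ext.postcompIsoEquiv_apply, Ext.postcompIsoEquiv_apply,
    Ext.comp_assoc_of_third_deg_zero]

/-- Right linearity comes from the naturality of the product in the two targets; together with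
`extDualRegularEquiv_dualModuleMul` it makes the Künneth isomorphism one of bimodules. -/
theorem extDualRegularEquiv_regularModuleMul :
    extDualRegularEquiv h₂ (x.comp (Ext.mk₀ (regularModuleMul a)) (add_zero _) ⊗ₜ
        y.comp (Ext.mk₀ (regularModuleMul b)) (add_zero _)) =
      (extDualRegularEquiv h₂ (x ⊗ₜ y)).comp
        (Ext.mk₀ (regularModuleMul (a ⊗ₜ[k] b : Λ₁ ⊗[k] Λ₂))) (add_zero _) := by
  have h : map k (𝟙 _) (regularModuleMul b) ≫ map k (regularModuleMul a) (𝟙 _) ≫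
      (regularModuleIso k Λ₁ Λ₂).hom =
        (regularModuleIso k Λ₁ Λ₂).hom ≫ regularModuleMul (a ⊗ₜ b) := by
    rw [← Category.assoc, ← map_comp, Category.comp_id, Category.id_comp, map_regularModuleMul]
  rw [extDualRegularEquiv, LinearEquiv.trans_apply, LinearEquiv.trans_apply,
    Ext.postcompIsoEquiv_apply, Ext.postcompIsoEquiv_apply, extDualEquiv_tmul, extDualEquiv_tmul,
    extProd_comp_mk₀_left, extProd_comp_mk₀_right]
  simp only [Ext.comp_assoc_of_third_deg_zero, Ext.mk₀_comp_mk₀, Category.assoc, h]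

end ExtDual

end ExternalTensor

section Preprojective

open Abelian

variable {k : Type u} [Field k] {Λ₁ Λ₂ : Type u} [Ring Λ₁] [Algebra k Λ₁] [Ring Λ₂] [Algebra k Λ₂]
  [Module.Finite k Λ₁] [Module.Finite k Λ₂]

/-- The Segre product of two preprojective algebras. -/
theorem PreprojectiveAlgebra.exists_segreProduct_algEquiv (n₁ : ℕ) {n₂ : ℕ}
    (h₂ : ∀ i, i ≠ n₂ → Subsingleton (DualExt k Λ₂ (ModuleCat.of Λ₂ Λ₂) i)) :
    ∃ e : segreProduct (PreprojectiveAlgebra.grading k Λ₁ n₁)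
          (PreprojectiveAlgebra.grading k Λ₂ n₂) ≃ₐ[k]
        PreprojectiveAlgebra k (Λ₁ ⊗[k] Λ₂) (n₁ + n₂),
      (∀ l : ℕ,
        (segreGrading (PreprojectiveAlgebra.grading k Λ₁ n₁)
            (PreprojectiveAlgebra.grading k Λ₂ n₂) l).map e.toLinearMap =
          PreprojectiveAlgebra.grading k (Λ₁ ⊗[k] Λ₂) (n₁ + n₂) l) ∧
      ∀ (a : Λ₁) (b : Λ₂),
        e (segreTmul _ _
            ⟨PreprojectiveAlgebra.incl k Λ₁ n₁ a, BimoduleTensorAlgebra.incl_mem_grading a⟩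
            ⟨PreprojectiveAlgebra.incl k Λ₂ n₂ b, BimoduleTensorAlgebra.incl_mem_grading b⟩) =
          PreprojectiveAlgebra.incl k (Λ₁ ⊗[k] Λ₂) (n₁ + n₂) (a ⊗ₜ[k] b) :=
  let φ : ExtDual k Λ₁ n₁ ⊗[k] ExtDual k Λ₂ n₂ ≃ₗ[k] ExtDual k (Λ₁ ⊗[k] Λ₂) (n₁ + n₂) :=
    ExternalTensor.extDualRegularEquiv h₂
  BimoduleTensorAlgebra.exists_segreProduct_algEquiv φ
    (fun a b x y => ExternalTensor.extDualRegularEquiv_dualModuleMul h₂ x y a b)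
    (fun a b x y => ExternalTensor.extDualRegularEquiv_regularModuleMul h₂ x y a b)

end Preprojective

/-! ### Separability idempotents -/

section Separable

variable {k : Type*} [Field k] {A B : Type*} [Ring A] [Algebra k A] [Ring B] [Algebra k B]

/-- A separability idempotent of an algebra. -/
structure IsSeparabilityIdempotent (k : Type*) [Field k] {A : Type*} [Ring A] [Algebra k A]
    (e : A ⊗[k] A) : Prop where
  mul' : LinearMap.mul' k A e = 1
  comm (a : A) : (a ⊗ₜ 1) * e = e * (1 ⊗ₜ a)

theorem IsSeparabilityIdempotent.map (f : A ≃ₐ[k] B) {e : A ⊗[k] A}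
    (he : IsSeparabilityIdempotent k e) :
    IsSeparabilityIdempotent k (Algebra.TensorProduct.map f.toAlgHom f.toAlgHom e) where
  mul' := by
    have h : LinearMap.mul' k B ∘ₗ
        (Algebra.TensorProduct.map f.toAlgHom f.toAlgHom).toLinearMap =
          f.toLinearMap ∘ₗ LinearMap.mul' k A :=
      TensorProduct.ext' fun x y => (map_mul f x y).symm
    refine (LinearMap.congr_fun h e).trans ?_
    rw [LinearMap.comp_apply, he.mul']
    exact map_one f
  comm b := by
    obtain ⟨a, rfl⟩ := f.surjective b
    have := congrArg (Algebra.TensorProduct.map f.toAlgHom f.toAlgHom) (he.comm a)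
    rw [map_mul, map_mul, Algebra.TensorProduct.map_tmul, Algebra.TensorProduct.map_tmul,
      map_one] at this
    exact this

/-- In each block take `∑ E_{i0} ⊗ E_{0i}`; the index `0` exists because the blocks are nonempty.
Its product is `∑ E_{ii} = 1`, and multiplication by `b` on the outer left or the outer right gives
`∑ b_{ji} E_{j0} ⊗ E_{0i}` in both cases. -/
theorem isSeparabilityIdempotent_pi_matrix {n : ℕ} (d : Fin n → ℕ) [∀ r, NeZero (d r)] :
    IsSeparabilityIdempotent k (A := Π r, Matrix (Fin (d r)) (Fin (d r)) k)
      (∑ r, ∑ i, Pi.single r (Matrix.single i 0 1) ⊗ₜ Pi.single r (Matrix.single 0 i 1)) where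
  mul' := by
    rw [map_sum]
    ext r : 1
    rw [Finset.sum_apply, Finset.sum_eq_single r]
    · rw [map_sum, Finset.sum_apply, Pi.one_apply, ← Matrix.sum_single_one]
      refine Finset.sum_congr rfl fun i _ => ?_
      rw [LinearMap.mul'_apply, Pi.mul_apply, Pi.single_eq_same, Pi.single_eq_same,
        Matrix.single_mul_single_same, one_mul]
    · intro s _ hs
      rw [map_sum, Finset.sum_apply]
      refine Finset.sum_eq_zero fun i _ => ?_
      rw [LinearMap.mul'_apply, Pi.mul_apply, Pi.single_eq_of_ne hs.symm, zero_mul]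
    · exact fun h => absurd (Finset.mem_univ r) h
  comm b := by
    rw [Finset.mul_sum, Finset.sum_mul]
    refine Finset.sum_congr rfl fun r _ => ?_
    rw [Finset.mul_sum, Finset.sum_mul]
    have h₁ (i : Fin (d r)) : b * Pi.single r (Matrix.single i 0 1) =
        ∑ j, b r j i • (Pi.single r (Matrix.single j 0 1) :
          Π r, Matrix (Fin (d r)) (Fin (d r)) k) := by
      have (X : Matrix (Fin (d r)) (Fin (d r)) k) : X * Matrix.single i 0 1 =
          ∑ j, X j i • Matrix.single j 0 1 := by
        ext p q
        simp [Matrix.mul_apply, Matrix.sum_apply, Matrix.single_apply, ite_and]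
      rw [← Pi.single_mul_right, this]
      exact (map_sum (LinearMap.single k _ r) _ _).trans
        (Finset.sum_congr rfl fun j _ => map_smul (LinearMap.single k _ r) _ _)
    have h₂ (i : Fin (d r)) : Pi.single r (Matrix.single 0 i 1) * b =
        ∑ j, b r i j • (Pi.single r (Matrix.single 0 j 1) :
          Π r, Matrix (Fin (d r)) (Fin (d r)) k) := by
      have (X : Matrix (Fin (d r)) (Fin (d r)) k) : Matrix.single 0 i 1 * X =
          ∑ j, X i j • Matrix.single 0 j 1 := by
        ext p q
        simp [Matrix.mul_apply, Matrix.sum_apply, Matrix.single_apply, ite_and]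
      rw [← Pi.single_mul_left, this]
      exact (map_sum (LinearMap.single k _ r) _ _).trans
        (Finset.sum_congr rfl fun j _ => map_smul (LinearMap.single k _ r) _ _)
    simp only [Algebra.TensorProduct.tmul_mul_tmul, h₁, h₂, one_mul, mul_one,
      TensorProduct.sum_tmul, TensorProduct.tmul_sum, TensorProduct.tmul_smul,
      TensorProduct.smul_tmul']
    exact Finset.sum_comm

variable (k A) in
-- By Wedderburn–Artin over an algebraically closed field, `A` is a product of matrix algebras over
-- `k` itself.
theorem exists_isSeparabilityIdempotent [IsAlgClosed k] [Module.Finite k A] [IsSemisimpleRing A] :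
    ∃ e : A ⊗[k] A, IsSeparabilityIdempotent k e := by
  obtain ⟨n, d, _, ⟨f⟩⟩ := IsSemisimpleRing.exists_algEquiv_pi_matrix_of_isAlgClosed k A
  exact ⟨_, (isSeparabilityIdempotent_pi_matrix d).map f.symm⟩

end Separable

/-! ### The projective dimension of an external tensor product -/

section ProjectiveDimension

open Limits

universe v v₁ w

variable {R : Type u} [Ring R] {D : Type v} [Category.{v₁} D] [Abelian D]

/-- The presentation of a module by a free module. -/
theorem ModuleCat.exists_shortExact_free (M : ModuleCat.{u} R) :
    ∃ (ι : Type u) (S : ShortComplex (ModuleCat.{u} R)), S.ShortExact ∧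
      S.X₂ = ModuleCat.of R (ι →₀ R) ∧ S.X₃ = M := by
  let f : ModuleCat.of R (M →₀ R) ⟶ M :=
    ModuleCat.ofHom (Finsupp.linearCombination R (id : M → M))
  have : Epi f := (ModuleCat.epi_iff_surjective _).2 (Finsupp.linearCombination_id_surjective R M)
  exact ⟨M, ShortComplex.mk _ _ (kernel.condition f),
    { exact := ShortComplex.exact_of_f_is_kernel _ (kernelIsKernel _) }, rfl, rfl⟩

theorem projective_of_finsupp (ι : Type u) : Projective (ModuleCat.of R (ι →₀ R)) :=
  ModuleCat.projective_of_free (Finsupp.basisSingleOne (R := R) (ι := ι))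

/-- An exact functor increases the projective dimension of modules by at most the projective
dimension of the images of free modules. -/
theorem hasProjectiveDimensionLT_map (F : ModuleCat.{u} R ⥤ D) [F.Additive]
    [PreservesFiniteLimits F] [PreservesFiniteColimits F] {c : ℕ}
    (hF : ∀ ι : Type u, HasProjectiveDimensionLT (F.obj (ModuleCat.of R (ι →₀ R))) (c + 1))
    (a : ℕ) (M : ModuleCat.{u} R) (hM : HasProjectiveDimensionLT M (a + 1)) :
    HasProjectiveDimensionLT (F.obj M) (a + c + 1) := by
  induction a generalizing M with
  | zero =>
    obtain ⟨ι, S, hS, h₂, rfl⟩ := M.exists_shortExact_free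
    have := projective_iff_hasProjectiveDimensionLT_one.2 hM
    have := hS.epi_g
    -- A projective module is a retract of a free one, and functors preserve retracts.
    let r : Retract S.X₃ (ModuleCat.of R (ι →₀ R)) :=
      { i := Projective.factorThru (𝟙 _) S.g ≫ eqToHom h₂
        r := eqToHom h₂.symm ≫ S.g }
    rw [zero_add]
    exact (r.map F).hasProjectiveDimensionLT (c + 1)
  | succ a ih =>
    obtain ⟨ι, S, hS, h₂, rfl⟩ := M.exists_shortExact_free
    have hF₂ := hF ι
    have h₂' := projective_of_finsupp (R := R) ι
    rw [← h₂] at hF₂ h₂'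
    have : HasProjectiveDimensionLT (S.map F).X₂ (c + 1) := hF₂
    have h₁ := ih S.X₁ ((hS.hasProjectiveDimensionLT_X₃_iff a h₂').1 hM)
    have h := (hS.map_of_exact F).hasProjectiveDimensionLT_X₃ (a + c + 1) h₁
      (hasProjectiveDimensionLT_of_ge _ (c + 1) _ (by omega))
    rwa [show a + 1 + c + 1 = a + c + 1 + 1 by omega]

/-- Resolve one factor at a time: `F ⊠ -` preserves projectivity for free `F`, so `F ⊠ M₂` has
dimension at most `b`, and this is the bound on free modules for `- ⊠ M₂`. -/
theorem hasProjectiveDimensionLT_externalTensor {k : Type u} [Field k] {Λ₁ Λ₂ : Type u} [Ring Λ₁]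
    [Algebra k Λ₁] [Ring Λ₂] [Algebra k Λ₂] {a b : ℕ} {M₁ : ModuleCat.{u} Λ₁}
    {M₂ : ModuleCat.{u} Λ₂} (h₁ : HasProjectiveDimensionLT M₁ (a + 1))
    (h₂ : HasProjectiveDimensionLT M₂ (b + 1)) :
    HasProjectiveDimensionLT (externalTensor k M₁ M₂) (a + b + 1) := by
  refine hasProjectiveDimensionLT_map (ExternalTensor.rightFunctor k Λ₁ M₂) (fun ι => ?_) a M₁ h₁
  refine hasProjectiveDimensionLT_map (ExternalTensor.leftFunctor k (ModuleCat.of Λ₁ (ι →₀ Λ₁)) Λ₂)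
    (c := 0) (fun κ => ?_) b M₂ h₂
  exact projective_iff_hasProjectiveDimensionLT_one.1
    (ExternalTensor.projective_of_basis Finsupp.basisSingleOne Finsupp.basisSingleOne)

end ProjectiveDimension

/-! ### The global dimension of a tensor product -/

namespace ExternalTensor

open scoped ModuleCat

variable {k : Type u} [Field k] {Λ₁ Λ₂ : Type u} [Ring Λ₁] [Algebra k Λ₁] [Ring Λ₂] [Algebra k Λ₂]

/-! ### Modules annihilated by an ideal with separable quotient -/

section Retract

variable (M : ModuleCat.{u} (Λ₁ ⊗[k] Λ₂))

/-- The restriction of scalars to the second factor. -/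
noncomputable def restrictRight : ModuleCat.{u} Λ₂ :=
  (ModuleCat.restrictScalars
    (Algebra.TensorProduct.includeRight : Λ₂ →ₐ[k] Λ₁ ⊗[k] Λ₂).toRingHom).obj M

/-- The identity map of the restriction of scalars. -/
noncomputable def restrictRightEquiv : restrictRight M ≃ₗ[k] M :=
  linearEquivOfAlgebraMap (M := restrictRight M) (AddEquiv.refl M) fun c m =>
    congrArg (fun t : Λ₁ ⊗[k] Λ₂ => t • (show M from m))
      ((Algebra.TensorProduct.includeRight : Λ₂ →ₐ[k] Λ₁ ⊗[k] Λ₂).commutes c)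

theorem restrictRightEquiv_smul (b : Λ₂) (m : restrictRight M) :
    restrictRightEquiv M (b • m) = (1 ⊗ₜ b : Λ₁ ⊗[k] Λ₂) • restrictRightEquiv M m := rfl

variable (I : Ideal Λ₁) [I.IsTwoSided]

/-- The left module `Λ / I`. -/
def quotientModule : ModuleCat.{u} Λ₁ := ModuleCat.of Λ₁ (Λ₁ ⧸ I)

variable (k) in
/-- The identity map of `Λ / I`. -/
noncomputable def quotientModuleEquiv : quotientModule I ≃ₗ[k] Λ₁ ⧸ I :=
  linearEquivOfAlgebraMap (M := quotientModule I) (AddEquiv.refl (Λ₁ ⧸ I)) fun c m => by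
    obtain ⟨m, rfl⟩ := Ideal.Quotient.mk_surjective m
    exact congrArg (Ideal.Quotient.mk I) (Algebra.smul_def c m).symm

theorem quotientModuleEquiv_smul (a : Λ₁) (m : quotientModule I) :
    quotientModuleEquiv k I (a • m) = Ideal.Quotient.mk I a * quotientModuleEquiv k I m := by
  obtain ⟨m, rfl⟩ := Ideal.Quotient.mk_surjective m
  rfl

variable {M I} (hM : ∀ a ∈ I, ∀ m : M, (a ⊗ₜ 1 : Λ₁ ⊗[k] Λ₂) • m = 0)

/-- The action of `Λ / I` on a module that is annihilated by `I`. -/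
noncomputable def quotientAction : Λ₁ ⧸ I →ₐ[k] Module.End k M :=
  Ideal.Quotient.liftₐ I
    ((Algebra.lsmul k k M).comp (Algebra.TensorProduct.includeLeft : Λ₁ →ₐ[k] Λ₁ ⊗[k] Λ₂))
    fun a ha => LinearMap.ext (hM a ha)

theorem quotientAction_mk (a : Λ₁) (m : M) :
    quotientAction hM (Ideal.Quotient.mk I a) m = (a ⊗ₜ 1 : Λ₁ ⊗[k] Λ₂) • m := rfl

theorem quotientAction_smul (x : Λ₁ ⧸ I) (b : Λ₂) (m : M) :
    quotientAction hM x ((1 ⊗ₜ b : Λ₁ ⊗[k] Λ₂) • m) =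
      (1 ⊗ₜ b : Λ₁ ⊗[k] Λ₂) • quotientAction hM x m := by
  obtain ⟨a, rfl⟩ := Ideal.Quotient.mk_surjective x
  rw [quotientAction_mk, quotientAction_mk, smul_smul, smul_smul,
    Algebra.TensorProduct.tmul_mul_tmul, Algebra.TensorProduct.tmul_mul_tmul, mul_one, mul_one,
    one_mul, one_mul]

/-- The action map of a module that is annihilated by `I`. -/
noncomputable def actionMap : externalTensor k (quotientModule I) (restrictRight M) ⟶ M :=
  homMk (TensorProduct.lift (quotientAction hM).toLinearMap ∘ₗ
      (TensorProduct.congr (quotientModuleEquiv k I) (restrictRightEquiv M)).toLinearMap)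
    fun a b x y => by
      change quotientAction hM (quotientModuleEquiv k I (a • x)) (restrictRightEquiv M (b • y)) =
        (a ⊗ₜ b : Λ₁ ⊗[k] Λ₂) •
          quotientAction hM (quotientModuleEquiv k I x) (restrictRightEquiv M y)
      rw [quotientModuleEquiv_smul, restrictRightEquiv_smul, quotientAction_smul, map_mul,
        Module.End.mul_apply, quotientAction_mk, smul_smul, Algebra.TensorProduct.tmul_mul_tmul,
        mul_one, one_mul]

theorem actionMap_tmul (x : quotientModule I) (y : restrictRight M) :
    (actionMap hM).hom (equiv k _ _ (x ⊗ₜ y)) =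
      quotientAction hM (quotientModuleEquiv k I x) (restrictRightEquiv M y) := rfl

/-- The map `m ↦ ∑ xᵢ ⊗ yᵢ m` for a tensor `∑ xᵢ ⊗ yᵢ`. -/
noncomputable def coactionMap :
    (Λ₁ ⧸ I) ⊗[k] (Λ₁ ⧸ I) →ₗ[k] M →ₗ[k] externalTensor k (quotientModule I) (restrictRight M) :=
  TensorProduct.lift
    (((LinearMap.llcomp k M M (externalTensor k (quotientModule I) (restrictRight M))).compl₂
      (quotientAction hM).toLinearMap) ∘ₗ
      ((TensorProduct.mk k _ _).compl₂ (restrictRightEquiv M).symm.toLinearMap).compr₂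
        (equiv k (quotientModule I) (restrictRight M)).toLinearMap ∘ₗ
          (quotientModuleEquiv k I).symm.toLinearMap)

theorem coactionMap_tmul (x y : Λ₁ ⧸ I) (m : M) : coactionMap hM (x ⊗ₜ y) m =
    equiv k _ _ ((quotientModuleEquiv k I).symm x ⊗ₜ
      (restrictRightEquiv M).symm (quotientAction hM y m)) := rfl

theorem coactionMap_mul_left (a : Λ₁) (t : (Λ₁ ⧸ I) ⊗[k] (Λ₁ ⧸ I)) (m : M) :
    coactionMap hM ((Ideal.Quotient.mk I a ⊗ₜ 1) * t) m =
      (a ⊗ₜ 1 : Λ₁ ⊗[k] Λ₂) • coactionMap hM t m := by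
  induction t using TensorProduct.induction_on with
  | zero => rw [mul_zero, _root_.map_zero, LinearMap.zero_apply, smul_zero]
  | add s t hs ht => rw [mul_add, _root_.map_add, _root_.map_add, LinearMap.add_apply, hs, ht,
      LinearMap.add_apply, smul_add]
  | tmul x y =>
    have h : (quotientModuleEquiv k I).symm (Ideal.Quotient.mk I a * x) =
        a • (quotientModuleEquiv k I).symm x := by
      rw [LinearEquiv.symm_apply_eq, quotientModuleEquiv_smul, LinearEquiv.apply_symm_apply]
    rw [Algebra.TensorProduct.tmul_mul_tmul, one_mul, coactionMap_tmul, coactionMap_tmul,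
      smul_equiv_tmul, one_smul, h]

theorem coactionMap_mul_right (a : Λ₁) (t : (Λ₁ ⧸ I) ⊗[k] (Λ₁ ⧸ I)) (m : M) :
    coactionMap hM (t * (1 ⊗ₜ Ideal.Quotient.mk I a)) m =
      coactionMap hM t ((a ⊗ₜ 1 : Λ₁ ⊗[k] Λ₂) • m) := by
  induction t using TensorProduct.induction_on with
  | zero => rw [zero_mul, _root_.map_zero, LinearMap.zero_apply, LinearMap.zero_apply]
  | add s t hs ht => rw [add_mul, _root_.map_add, _root_.map_add, LinearMap.add_apply, hs, ht,
      LinearMap.add_apply]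
  | tmul x y =>
    rw [Algebra.TensorProduct.tmul_mul_tmul, mul_one, coactionMap_tmul, coactionMap_tmul, map_mul,
      Module.End.mul_apply, quotientAction_mk]

theorem coactionMap_smul (b : Λ₂) (t : (Λ₁ ⧸ I) ⊗[k] (Λ₁ ⧸ I)) (m : M) :
    coactionMap hM t ((1 ⊗ₜ b : Λ₁ ⊗[k] Λ₂) • m) =
      (1 ⊗ₜ b : Λ₁ ⊗[k] Λ₂) • coactionMap hM t m := by
  induction t using TensorProduct.induction_on with
  | zero => rw [_root_.map_zero, LinearMap.zero_apply, LinearMap.zero_apply, smul_zero]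
  | add s t hs ht => rw [_root_.map_add, LinearMap.add_apply, hs, ht, LinearMap.add_apply, smul_add]
  | tmul x y =>
    have h (m : M) : (restrictRightEquiv M).symm ((1 ⊗ₜ b : Λ₁ ⊗[k] Λ₂) • m) =
        b • (restrictRightEquiv M).symm m := by
      rw [LinearEquiv.symm_apply_eq, restrictRightEquiv_smul, LinearEquiv.apply_symm_apply]
    rw [coactionMap_tmul, coactionMap_tmul, smul_equiv_tmul, one_smul, quotientAction_smul, h]

theorem actionMap_coactionMap (t : (Λ₁ ⧸ I) ⊗[k] (Λ₁ ⧸ I)) (m : M) :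
    (actionMap hM).hom (coactionMap hM t m) = quotientAction hM (LinearMap.mul' k _ t) m := by
  induction t using TensorProduct.induction_on with
  | zero => rw [_root_.map_zero, _root_.map_zero, _root_.map_zero, LinearMap.zero_apply,
      LinearMap.zero_apply, _root_.map_zero]
  | add s t hs ht => rw [_root_.map_add, LinearMap.add_apply, _root_.map_add, hs, ht,
      _root_.map_add, _root_.map_add, LinearMap.add_apply]
  | tmul x y =>
    rw [coactionMap_tmul, actionMap_tmul, LinearEquiv.apply_symm_apply,
      LinearEquiv.apply_symm_apply, LinearMap.mul'_apply, map_mul, Module.End.mul_apply]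

variable {e : (Λ₁ ⧸ I) ⊗[k] (Λ₁ ⧸ I)} (he : IsSeparabilityIdempotent k e)

include he in
-- Linearity over `Λ₂` holds for every tensor. Linearity over `Λ₁` amounts to `∑ xᵢ ⊗ yᵢ a = ∑ a xᵢ
-- ⊗ yᵢ`, the commutation property of the separability idempotent.
theorem coactionMap_smul_of_isSeparabilityIdempotent (c : Λ₁ ⊗[k] Λ₂) (m : M) :
    coactionMap hM e (c • m) = c • coactionMap hM e m := by
  induction c using TensorProduct.induction_on with
  | zero => rw [zero_smul, zero_smul, _root_.map_zero]
  | add c d hc hd => rw [add_smul, add_smul, _root_.map_add, hc, hd]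
  | tmul a b =>
    have h : (a ⊗ₜ b : Λ₁ ⊗[k] Λ₂) = (a ⊗ₜ 1) * (1 ⊗ₜ b) := by
      rw [Algebra.TensorProduct.tmul_mul_tmul, mul_one, one_mul]
    rw [h, mul_smul, mul_smul, ← coactionMap_mul_right, ← he.comm, coactionMap_mul_left,
      coactionMap_smul]

/-- A module that is annihilated by `I` is a retract of an external tensor product, if `Λ / I` is
separable. -/
noncomputable def retractExternalTensor :
    CategoryTheory.Retract M (externalTensor k (quotientModule I) (restrictRight M)) where
  i := ConcreteCategory.ofHom (C := ModuleCat.{u} (Λ₁ ⊗[k] Λ₂)) (X := M)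
    (Y := externalTensor k (quotientModule I) (restrictRight M))
    { toFun := coactionMap hM e
      map_add' := _root_.map_add _
      map_smul' := coactionMap_smul_of_isSeparabilityIdempotent hM he }
  r := actionMap hM
  retract := ModuleCat.hom_ext (LinearMap.ext fun m => by
    refine (actionMap_coactionMap hM e m).trans ?_
    rw [he.mul', map_one]
    rfl)

end Retract

end ExternalTensor

section GlobalDimension

open Limits

variable {k : Type u} [Field k] {Λ₁ Λ₂ : Type u} [Ring Λ₁] [Algebra k Λ₁] [Ring Λ₂] [Algebra k Λ₂]

theorem globalDim_le_iff {Λ : Type u} [Ring Λ] {n : ℕ} :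
    globalDim Λ ≤ n ↔ ∀ M : ModuleCat.{u} Λ, HasProjectiveDimensionLT M (n + 1) := by
  simp only [globalDim, iSup_le_iff, projectiveDimension_le_iff]

/-- The short exact sequence of a submodule. -/
theorem Submodule.shortExact_subtype_mkQ {Λ : Type u} [Ring Λ] {M : Type u} [AddCommGroup M]
    [Module Λ M] (N : Submodule Λ M) :
    (ShortComplex.mk (ModuleCat.ofHom N.subtype) (ModuleCat.ofHom N.mkQ)
      (ModuleCat.hom_ext (LinearMap.ext fun x =>
        (Submodule.Quotient.mk_eq_zero N).2 x.2))).ShortExact where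
  exact := (ShortComplex.ShortExact.moduleCat_exact_iff_function_exact _).2
    (LinearMap.exact_subtype_mkQ N)
  mono_f := (ModuleCat.mono_iff_injective _).2 N.injective_subtype
  epi_g := (ModuleCat.epi_iff_surjective _).2 N.mkQ_surjective

/-- Induction along the powers of a nilpotent ideal of the first factor. -/
theorem hasProjectiveDimensionLT_of_pow_smul_eq_zero (I : Ideal Λ₁) [I.IsTwoSided] {d : ℕ}
    (hI : ∀ M : ModuleCat.{u} (Λ₁ ⊗[k] Λ₂),
      (∀ a ∈ I, ∀ m : M, (a ⊗ₜ 1 : Λ₁ ⊗[k] Λ₂) • m = 0) → HasProjectiveDimensionLT M d)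
    (r : ℕ) (M : ModuleCat.{u} (Λ₁ ⊗[k] Λ₂))
    (hM : ∀ a ∈ I ^ r, ∀ m : M, (a ⊗ₜ 1 : Λ₁ ⊗[k] Λ₂) • m = 0) :
    HasProjectiveDimensionLT M d := by
  induction r generalizing M with
  | zero =>
    -- The zeroth power of `I` contains `1`, so `M` is zero and is in particular annihilated by `I`.
    refine hI M fun a _ m => ?_
    rw [← one_smul (Λ₁ ⊗[k] Λ₂) m, Algebra.TensorProduct.one_def,
      hM 1 (by rw [Submodule.pow_zero, Ideal.one_eq_top]; trivial), smul_zero]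
  | succ r ih =>
    -- `N` is `I M`: it is annihilated by `I ^ r` and the quotient by it is annihilated by `I`, so
    -- the dimension bound passes to `M` from the two ends.
    let N : Submodule (Λ₁ ⊗[k] Λ₂) M :=
      Submodule.span _ {z | ∃ a ∈ I, ∃ m : M, (a ⊗ₜ 1 : Λ₁ ⊗[k] Λ₂) • m = z}
    have hN (z : M) (hz : z ∈ N) : ∀ a ∈ I ^ r, (a ⊗ₜ 1 : Λ₁ ⊗[k] Λ₂) • z = 0 := by
      induction hz using Submodule.span_induction with
      | mem z hz =>
        obtain ⟨b, hb, m, rfl⟩ := hz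
        intro a ha
        rw [smul_smul, Algebra.TensorProduct.tmul_mul_tmul, mul_one]
        exact hM _ (Submodule.pow_succ I ▸ Ideal.mul_mem_mul ha hb) m
      | zero => exact fun _ _ => smul_zero _
      | add x y _ _ hx hy =>
        intro a ha
        rw [smul_add, hx a ha, hy a ha, add_zero]
      | smul c x _ hx =>
        intro a ha
        induction c using TensorProduct.induction_on with
        | zero => rw [zero_smul, smul_zero]
        | add c d hc hd => rw [add_smul, smul_add, hc, hd, add_zero]
        | tmul b b' =>
          have h : (a ⊗ₜ 1 : Λ₁ ⊗[k] Λ₂) * (b ⊗ₜ b') = (1 ⊗ₜ b') * ((a * b) ⊗ₜ 1) := by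
            simp only [Algebra.TensorProduct.tmul_mul_tmul, one_mul, mul_one]
          rw [smul_smul, h, mul_smul, hx _ (Ideal.mul_mem_right b _ ha), smul_zero]
    refine N.shortExact_subtype_mkQ.hasProjectiveDimensionLT_X₂ _ ?_ ?_
    · exact ih (ModuleCat.of _ N) fun a ha m => Subtype.ext (hN m.1 m.2 a ha)
    · refine hI (ModuleCat.of _ (M ⧸ N)) fun a ha m => ?_
      obtain ⟨m, rfl⟩ := N.mkQ_surjective m
      rw [← map_smul]
      exact (Submodule.Quotient.mk_eq_zero N).2 (Submodule.subset_span ⟨a, ha, m, rfl⟩)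

/-- The radical of `Λ₁` is nilpotent with separable quotient, so it is enough to bound modules
killed by it. These are retracts of external tensor products, where projective dimensions add up. -/
theorem globalDim_tensorProduct_le [IsAlgClosed k] [Module.Finite k Λ₁] {n₁ n₂ : ℕ}
    (h₁ : globalDim Λ₁ ≤ n₁) (h₂ : globalDim Λ₂ ≤ n₂) :
    globalDim (Λ₁ ⊗[k] Λ₂) ≤ (n₁ + n₂ : ℕ) := by
  rw [globalDim_le_iff] at h₁ h₂ ⊢
  have : IsArtinianRing Λ₁ := IsArtinianRing.of_finite k Λ₁
  obtain ⟨e, he⟩ := exists_isSeparabilityIdempotent k (Λ₁ ⧸ Ring.jacobson Λ₁)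
  obtain ⟨r, hr⟩ := IsSemiprimaryRing.isNilpotent (R := Λ₁)
  refine fun M => hasProjectiveDimensionLT_of_pow_smul_eq_zero (Ring.jacobson Λ₁)
    (fun M hM => ?_) r M fun a ha m => ?_
  · have := hasProjectiveDimensionLT_externalTensor (k := k)
      (h₁ (ExternalTensor.quotientModule (Ring.jacobson Λ₁))) (h₂ (ExternalTensor.restrictRight M))
    exact (ExternalTensor.retractExternalTensor hM he).hasProjectiveDimensionLT _
  · rw [hr] at ha
    rw [show a = 0 from ha, TensorProduct.zero_tmul, zero_smul]

end GlobalDimension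

/-! ### The lower bound for the global dimension -/

section Nontrivial

open Abelian Limits ExternalTensor

/-- The identity of `P` is a finite sum of maps that factor through `Λ`, so every class with values
in `P` is a sum of classes that factor through zero. -/
theorem Ext.subsingleton_of_free_finite {Λ : Type u} [Ring Λ] {X : ModuleCat.{u} Λ} {i : ℕ}
    (h : Subsingleton (Ext.{u} X (regularModule Λ) i)) (P : ModuleCat.{u} Λ)
    [Module.Free Λ P] [Module.Finite Λ P] : Subsingleton (Ext.{u} X P i) := by
  let b := Module.Free.chooseBasis Λ P
  let p (j : Module.Free.ChooseBasisIndex Λ P) : P ⟶ regularModule Λ := ModuleCat.ofHom (b.coord j)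
  let q (j : Module.Free.ChooseBasisIndex Λ P) : regularModule Λ ⟶ P :=
    ModuleCat.ofHom (LinearMap.toSpanSingleton Λ P (b j))
  have hid : 𝟙 P = ∑ j, p j ≫ q j := by
    ext x
    rw [ModuleCat.hom_sum, LinearMap.sum_apply]
    exact (b.sum_repr x).symm
  refine subsingleton_of_forall_eq 0 fun e => ?_
  rw [← e.comp_mk₀_id, hid, Ext.mk₀_sum, Ext.comp_sum]
  refine Finset.sum_eq_zero fun j _ => ?_
  rw [← Ext.mk₀_comp_mk₀, ← Ext.comp_assoc_of_third_deg_zero,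
    Subsingleton.elim (e.comp (Ext.mk₀ (p j)) (add_zero i)) 0, Ext.zero_comp]

theorem Ext.subsingleton_of_finite {Λ : Type u} [Ring Λ] [IsNoetherianRing Λ]
    {X : ModuleCat.{u} Λ} {n : ℕ} [HasProjectiveDimensionLT X n]
    (h : ∀ i, Subsingleton (Ext.{u} X (regularModule Λ) i)) (Y : ModuleCat.{u} Λ)
    (hY : Module.Finite Λ Y) (i : ℕ) : Subsingleton (Ext.{u} X Y i) := by
  by_cases hi : n ≤ i
  · exact HasProjectiveDimensionLT.subsingleton X n i hi Y
  -- Descending induction on the degree: with `Extⁱ(X, P) = 0` for a free cover `P` of `Y`, the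
  -- group `Extⁱ(X, Y)` embeds in `Extⁱ⁺¹(X, K)`, and the groups vanish from degree `n` on.
  · induction hm : n - i generalizing i Y with
    | zero => omega
    | succ m ih =>
      obtain ⟨K, P, f, g, w, hK, ⟨_, _⟩, hS⟩ := exists_finite_free_presentation Y hY
      have hP := Ext.subsingleton_of_free_finite (h i) P
      have hK' : Subsingleton (Ext.{u} X K (i + 1)) := by
        by_cases hi' : n ≤ i + 1
        · exact HasProjectiveDimensionLT.subsingleton X n (i + 1) hi' K
        · exact ih K hK (i + 1) hi' (by omega)
      refine subsingleton_of_forall_eq 0 fun e => ?_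
      obtain ⟨e', rfl⟩ := Ext.covariant_sequence_exact₃ X hS e rfl (Subsingleton.elim _ _)
      rw [Subsingleton.elim e' 0, Ext.zero_comp]

variable {k : Type u} [Field k]

/-- If the group were zero, all `Extⁱ(DΛ, Λ)` would vanish, and finite projective dimension would
force `Ext⁰(DΛ, DΛ) = 0`. Then `DΛ` would be zero, although `Λ` is not. -/
theorem nontrivial_ext_dualModule {Λ : Type u} [Ring Λ] [Algebra k Λ] [Module.Finite k Λ]
    [Nontrivial Λ] {n m : ℕ} (hm : globalDim Λ ≤ m)
    (h : ∀ i, i ≠ n → Subsingleton (Ext.{u} (dualModule k Λ) (regularModule Λ) i)) :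
    Nontrivial (Ext.{u} (dualModule k Λ) (regularModule Λ) n) := by
  by_contra hn
  rw [not_nontrivial_iff_subsingleton] at hn
  have : IsNoetherianRing Λ := IsNoetherianRing.of_finite k Λ
  have := globalDim_le_iff.1 hm (dualModule k Λ)
  have h₀ := Ext.subsingleton_of_finite (X := dualModule k Λ) (n := m + 1)
    (fun i => if hi : i = n then hi ▸ hn else h i hi) (dualModule k Λ) (finite_dualModule k Λ) 0
  have hid : 𝟙 (dualModule k Λ) = 0 := (Ext.mk₀_bijective _ _).1 (Subsingleton.elim _ _)
  have := ModuleCat.subsingleton_of_isZero ((IsZero.iff_id_eq_zero _).2 hid)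
  exact not_subsingleton _ (dualModuleEquiv k Λ).symm.subsingleton

variable {Λ₁ Λ₂ : Type u} [Ring Λ₁] [Algebra k Λ₁] [Ring Λ₂] [Algebra k Λ₂]

/-- The bound is attained at `DΛ`: its extension group with `Λ` in degree `n₁ + n₂` is a tensor
product of two nonzero vector spaces. -/
theorem globalDim_tensorProduct [IsAlgClosed k] [Module.Finite k Λ₁] [Module.Finite k Λ₂]
    [Nontrivial Λ₁] [Nontrivial Λ₂] {n₁ n₂ : ℕ} (hd₁ : globalDim Λ₁ = n₁)
    (hd₂ : globalDim Λ₂ = n₂)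
    (h₁ : ∀ i, i ≠ n₁ → Subsingleton (Ext.{u} (dualModule k Λ₁) (regularModule Λ₁) i))
    (h₂ : ∀ i, i ≠ n₂ → Subsingleton (Ext.{u} (dualModule k Λ₂) (regularModule Λ₂) i)) :
    globalDim (Λ₁ ⊗[k] Λ₂) = (n₁ + n₂ : ℕ) := by
  refine le_antisymm (globalDim_tensorProduct_le hd₁.le hd₂.le) ?_
  refine le_trans ?_ (le_iSup _ (dualModule k (Λ₁ ⊗[k] Λ₂)))
  rw [projectiveDimension_ge_iff]
  intro h
  have := HasProjectiveDimensionLT.subsingleton (dualModule k (Λ₁ ⊗[k] Λ₂)) (n₁ + n₂) (n₁ + n₂)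
    le_rfl (regularModule (Λ₁ ⊗[k] Λ₂))
  have := nontrivial_ext_dualModule hd₁.le h₁
  have := nontrivial_ext_dualModule hd₂.le h₂
  exact not_subsingleton _ (extDualRegularEquiv (Λ₁ := Λ₁) (n₁ := n₁) h₂).subsingleton

end Nontrivial

/-! ### Assembly of the theorem -/

section

open Abelian ExternalTensor

theorem IsInverseSerreSequence.subsingleton_ext_regularModule {k : Type u} [Field k] {Λ : Type u}
    [Ring Λ] [Algebra k Λ] {n : ℕ} {M : ℕ → ModuleCat.{u} Λ} (h : IsInverseSerreSequence k n M)
    (i : ℕ) (hi : i ≠ n) : Subsingleton (Ext.{u} (dualModule k Λ) (regularModule Λ) i) :=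
  have : Subsingleton (Ext.{u} (dualModule k Λ) (M 0) i) := h.subsingleton 0 i hi
  (Ext.postcompIsoEquiv k (dualModule k Λ)
    (show regularModule Λ ≅ M 0 from h.zero.some) i).subsingleton

/-- The sequences of modules multiply termwise under `⊠`. The terms for `l = 0` also provide the
concentration of `Ext(DΛᵢ, Λᵢ)` that the global dimension needs. -/
theorem IsRepresentationInfinite.tensorProduct {k : Type u} [Field k] [IsAlgClosed k]
    {Λ₁ Λ₂ : Type u} [Ring Λ₁] [Algebra k Λ₁] [Ring Λ₂] [Algebra k Λ₂] [Nontrivial Λ₁]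
    [Nontrivial Λ₂] {n₁ n₂ : ℕ} (h₁ : IsRepresentationInfinite k Λ₁ n₁)
    (h₂ : IsRepresentationInfinite k Λ₂ n₂) :
    IsRepresentationInfinite k (Λ₁ ⊗[k] Λ₂) (n₁ + n₂) := by
  obtain ⟨_, hd₁, h₁⟩ := h₁
  obtain ⟨_, hd₂, h₂⟩ := h₂
  obtain ⟨M₁, h₁⟩ := (exists_inverseSerrePow_iso_iff n₁).1 h₁
  obtain ⟨M₂, h₂⟩ := (exists_inverseSerrePow_iso_iff n₂).1 h₂
  exact ⟨inferInstance, globalDim_tensorProduct hd₁ hd₂ h₁.subsingleton_ext_regularModule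
    h₂.subsingleton_ext_regularModule,
    (exists_inverseSerrePow_iso_iff (n₁ + n₂)).2 ⟨_, h₁.externalTensor h₂⟩⟩

end

theorem mainTheorem8 {k : Type u} [Field k] [IsAlgClosed k] [CharZero k]
    {Λ₁ Λ₂ : Type u} [Ring Λ₁] [Algebra k Λ₁] [Ring Λ₂] [Algebra k Λ₂]
    (hc₁ : IsConnectedAlgebra k Λ₁) (hc₂ : IsConnectedAlgebra k Λ₂) (n₁ n₂ : ℕ)
    (h₁ : IsRepresentationInfinite k Λ₁ n₁) (h₂ : IsRepresentationInfinite k Λ₂ n₂) :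
    IsConnectedAlgebra k (Λ₁ ⊗[k] Λ₂) ∧
    IsRepresentationInfinite k (Λ₁ ⊗[k] Λ₂) (n₁ + n₂) ∧
    ∃ e : segreProduct (PreprojectiveAlgebra.grading k Λ₁ n₁)
          (PreprojectiveAlgebra.grading k Λ₂ n₂) ≃ₐ[k]
        PreprojectiveAlgebra k (Λ₁ ⊗[k] Λ₂) (n₁ + n₂),
      (∀ l : ℕ,
        (segreGrading (PreprojectiveAlgebra.grading k Λ₁ n₁)
            (PreprojectiveAlgebra.grading k Λ₂ n₂) l).map e.toLinearMap =
          PreprojectiveAlgebra.grading k (Λ₁ ⊗[k] Λ₂) (n₁ + n₂) l) ∧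
      ∀ (a : Λ₁) (b : Λ₂),
        e (segreTmul _ _
            ⟨PreprojectiveAlgebra.incl k Λ₁ n₁ a, BimoduleTensorAlgebra.incl_mem_grading a⟩
            ⟨PreprojectiveAlgebra.incl k Λ₂ n₂ b, BimoduleTensorAlgebra.incl_mem_grading b⟩) =
          PreprojectiveAlgebra.incl k (Λ₁ ⊗[k] Λ₂) (n₁ + n₂) (a ⊗ₜ[k] b) := by
  have := hc₁.1
  have := hc₂.1
  have : Module.Finite k Λ₁ := h₁.1
  have : Module.Finite k Λ₂ := h₂.1
  obtain ⟨M₂, h⟩ := (exists_inverseSerrePow_iso_iff n₂).1 h₂.2.2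
  exact ⟨hc₁.tensorProduct hc₂, h₁.tensorProduct h₂,
    PreprojectiveAlgebra.exists_segreProduct_algEquiv n₁ h.subsingleton_ext_regularModule⟩
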